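/- Let $0<\nu<1$, $\beta=2\nu$, $D>0$. For $\lambda>-1$ and $\mu,z\in\mathbb C$ let $W_{\lambda,\mu}(z)=\sum_{n\ge0}\frac{z^n}{n!\,\Gamma(\lambda n+\mu)}$ (with $1/\Gamma=0$ at the poles of $\Gamma$), and put $F_\nu(z)=W_{-\nu,0}(-z)$ and $M_\nu(z)=W_{-\nu,1-\nu}(-z)$ (the $M$-Wright function). Consider the time-fractional diffusion-wave equation $$\partial_t^{\beta}u=D\,\partial_x^2u,\qquad t>0,\tag{1}$$ where $\partial_t^\beta$ is the Caputo derivative: with $m=\lceil\beta\rceil$, $\partial_t^\beta u(x,t)=\frac1{\Gamma(m-\beta)}\int_0^t(t-\tau)^{m-1-\beta}\,\partial_\tau^m u(x,\tau)\,d\tau$ if $\beta\neq m$, and $\partial_t^\beta u=\partial_t^m u$ if $\beta=m$. By a solution of (1) for $x$ in an open set $X\subseteq\mathbb R$ we mean a function $u$ which is $C^m$ in $t>0$ and $C^2$ in $x\in X$, satisfies (1) pointwise, and whose derivative $\partial_t^mu$ is integrable on $(0,T]$ for each $x\in X$ and jointly integrable on $K\times(0,T]$ for all compact $K\subset X$ and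 all $T>0$. *Cauchy problem* with data $f$: a solution $u$ of (1) for $x\in\mathbb R$ with $u(x,0^+)=f(x)$ for all $x$, $u(\pm\infty,t)=0$ for all $t>0$ and, if $\beta>1$, $u_t(x,0^+)=0$. *Signalling problem* with data $g$: a solution $u$ of (1) for $x>0$ with $u(x,0^+)=0$ for all $x>0$, $u(0^+,t)=g(t)$ and $u(+\infty,t)=0$ for all $t>0$ and, if $\beta>1$, $u_t(x,0^+)=0$. A *Green function of the Cauchy problem* is a function $G$ that is continuous on $\mathbb R\times(0,\infty)$, with $G(\cdot,t)$ integrable for every $t>0$ and $e^{-st}G(x,t)$ integrable on $\mathbb R\times(0,\infty)$ for some real $s$, such that for every Schwartz function $f$ the function $u(x,t)=\int_{\mathbb R}G(\xi,t)f(x-\xi)\,d\xi$ solves the Cauchy problem with data $f$. A *Green function of the signalling problem* is a function $G$ that is continuous on $[0,\infty)\times(0,\infty)$, with $e^{-st}G(x,t)$ integrable over $t\in(0,\infty)$ for every $x>0$ and $\sup_{x>0}\int_0^\infty e^{-st}|G(x,t)|\,dt<\infty$ for some real $s$, such that for every continuous $g$ on $[0,\infty)$ the function $u(x,t)=\int_0^tG(x,\tau)g(t-\tau)\,d\tau$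 solves the signalling problem with data $g$. Then: 1. The Cauchy problem has exactly one Green function on $\mathbb R\times(0,\infty)$, namely $$G_c(x,t)=\frac{t^{-\nu}}{2\sqrt D}\,M_\nu\!\Big(\frac{|x|}{\sqrt D\,t^\nu}\Big),\qquad x\in\mathbb R,\ t>0.$$ 2. The signalling problem has exactly one Green function on $[0,\infty)\times(0,\infty)$, namely $$G_s(x,t)=\frac{\nu\,x\,t^{-\nu-1}}{\sqrt D}\,M_\nu\!\Big(\frac{x}{\sqrt D\,t^\nu}\Big),\qquad x\ge0,\ t>0.$$ 3. For $\operatorname{Re}s>0$ their Laplace transforms in $t$ converge absolutely and are, with principal powers, $$\int_0^\infty e^{-st}G_c(x,t)\,dt=\frac{e^{-(|x|/\sqrt D)s^\nu}}{2\sqrt D\,s^{1-\nu}}\quad(x\in\mathbb R),\qquad \int_0^\infty e^{-st}G_s(x,t)\,dt=e^{-(x/\sqrt D)s^\nu}\quad(x>0).$$ 4. For $x>0$, $t>0$ and $z=x/(\sqrt D\,t^\nu)$ the reciprocity relation $$2\nu x\,G_c(x,t)=t\,G_s(x,t)=F_\nu(z)=\nu z\,M_\nu(z)$$ holds; moreover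 $F_\nu(z)=\nu z\,M_\nu(z)$ for all $z\in\mathbb C$. -/

import Mathlib

open Set Filter Topology MeasureTheory

noncomputable section

namespace DiffusionWave

/-- The Wright function `W_{lam, mu}(z) = ∑ zⁿ / (n! Γ(lam n + mu))`. Since `Complex.Gamma` takes
the value `0` at its poles, the terms with `lam n + mu = 0, -1, -2, …` vanish, as they should. -/
def wright (lam : ℝ) (mu z : ℂ) : ℂ :=
  ∑' n : ℕ, z ^ n / ((n.factorial : ℂ) * Complex.Gamma ((lam : ℂ) * n + mu))

/-- The auxiliary function `F_ν(z) = W_{-ν, 0}(-z)`. -/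
def wrightF (ν : ℝ) (z : ℂ) : ℂ := wright (-ν) 0 (-z)

/-- The `M`-Wright function `M_ν(z) = W_{-ν, 1-ν}(-z)`. -/
def wrightM (ν : ℝ) (z : ℂ) : ℂ := wright (-ν) (1 - (ν : ℂ)) (-z)

/-- The Caputo derivative of order `β > 0` at time `t > 0`, with `m - 1 < β ≤ m`, `m = ⌈β⌉`. -/
def caputo (β : ℝ) (f : ℝ → ℝ) (t : ℝ) : ℝ :=
  if β = (⌈β⌉₊ : ℝ) then iteratedDeriv ⌈β⌉₊ f t
  else 1 / Real.Gamma (⌈β⌉₊ - β) *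
    ∫ τ in (0 : ℝ)..t, iteratedDeriv ⌈β⌉₊ f τ / (t - τ) ^ (β + 1 - ⌈β⌉₊)

/-- `u = u(x, t)` is a classical solution, for `x` in the open set `X` and `t > 0`, of the
time-fractional diffusion-wave equation `∂^β u / ∂t^β = D ∂²u / ∂x²`. The time derivative of
order `⌈β⌉` is integrable up to `t = 0` (for each `x`, and jointly for `x` in compact sets), as the
Caputo derivative requires. -/
structure IsSolution (β D : ℝ) (X : Set ℝ) (u : ℝ → ℝ → ℝ) : Prop where
  time_smooth : ∀ x ∈ X, ContDiffOn ℝ (⌈β⌉₊ : ℕ) (u x) (Ioi 0)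
  time_integrable : ∀ x ∈ X, ∀ T : ℝ, 0 < T →
    IntegrableOn (iteratedDeriv ⌈β⌉₊ (u x)) (Ioc 0 T)
  time_integrable_joint : ∀ K ⊆ X, IsCompact K → ∀ T : ℝ, 0 < T →
    IntegrableOn (fun p : ℝ × ℝ => iteratedDeriv ⌈β⌉₊ (u p.1) p.2) (K ×ˢ Ioc 0 T)
  space_smooth : ∀ t : ℝ, 0 < t → ContDiffOn ℝ 2 (fun x => u x t) X
  equation : ∀ x ∈ X, ∀ t : ℝ, 0 < t →
    caputo β (u x) t = D * iteratedDeriv 2 (fun y => u y t) x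

/-- The Cauchy problem: `u(x, 0⁺) = f(x)` and `u(±∞, t) = 0`, and `u_t(x, 0⁺) = 0` if `β > 1`. -/
structure SolvesCauchy (β D : ℝ) (f : ℝ → ℝ) (u : ℝ → ℝ → ℝ) : Prop where
  solution : IsSolution β D univ u
  initial : ∀ x : ℝ, Tendsto (u x) (𝓝[>] 0) (𝓝 (f x))
  initial_deriv : 1 < β → ∀ x : ℝ, Tendsto (deriv (u x)) (𝓝[>] 0) (𝓝 0)
  at_top : ∀ t : ℝ, 0 < t → Tendsto (fun x => u x t) atTop (𝓝 0)
  at_bot : ∀ t : ℝ, 0 < t → Tendsto (fun x => u x t) atBot (𝓝 0)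

/-- The signalling problem on `x > 0`: `u(x, 0⁺) = 0`, `u(0⁺, t) = g(t)` and `u(+∞, t) = 0`,
and `u_t(x, 0⁺) = 0` if `β > 1`. -/
structure SolvesSignalling (β D : ℝ) (g : ℝ → ℝ) (u : ℝ → ℝ → ℝ) : Prop where
  solution : IsSolution β D (Ioi 0) u
  initial : ∀ x : ℝ, 0 < x → Tendsto (u x) (𝓝[>] 0) (𝓝 0)
  initial_deriv : 1 < β → ∀ x : ℝ, 0 < x → Tendsto (deriv (u x)) (𝓝[>] 0) (𝓝 0)
  boundary : ∀ t : ℝ, 0 < t → Tendsto (fun x => u x t) (𝓝[>] 0) (𝓝 (g t))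
  at_top : ∀ t : ℝ, 0 < t → Tendsto (fun x => u x t) atTop (𝓝 0)

/-- `G` is a Green function of the Cauchy problem: a continuous, space-integrable and
Laplace-transformable kernel on `ℝ × (0, ∞)` such that, for every Schwartz function `f`, the
convolution `∫ G(ξ, t) f(x - ξ) dξ` solves the Cauchy problem with data `f`. -/
structure IsCauchyGreen (β D : ℝ) (G : ℝ → ℝ → ℝ) : Prop where
  cont : ContinuousOn (fun p : ℝ × ℝ => G p.1 p.2) (univ ×ˢ Ioi 0)
  space_integrable : ∀ t : ℝ, 0 < t → Integrable (fun x => G x t)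
  laplace : ∃ s : ℝ,
    IntegrableOn (fun p : ℝ × ℝ => Real.exp (-s * p.2) * G p.1 p.2) (univ ×ˢ Ioi 0)
  solves : ∀ f : SchwartzMap ℝ ℝ,
    SolvesCauchy β D f (fun x t => ∫ ξ, G ξ t * f (x - ξ))

/-- `G` is a Green function of the signalling problem: a continuous kernel on
`[0, ∞) × (0, ∞)`, Laplace-transformable in time uniformly in `x`, such that, for every continuous
`g` on `[0, ∞)`, the convolution `∫₀ᵗ G(x, τ) g(t - τ) dτ` solves the signalling problem with
data `g`. -/
structure IsSignallingGreen (β D : ℝ) (G : ℝ → ℝ → ℝ) : Prop where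
  cont : ContinuousOn (fun p : ℝ × ℝ => G p.1 p.2) (Ici 0 ×ˢ Ioi 0)
  laplace : ∃ s C : ℝ, ∀ x : ℝ, 0 < x →
    IntegrableOn (fun t => Real.exp (-s * t) * G x t) (Ioi 0) ∧
    ∫ t in Ioi (0 : ℝ), Real.exp (-s * t) * |G x t| ≤ C
  solves : ∀ g : ℝ → ℝ, ContinuousOn g (Ici 0) →
    SolvesSignalling β D g (fun x t => ∫ τ in (0 : ℝ)..t, G x τ * g (t - τ))

/-- The Laplace integral of `f` converges absolutely at `s` and has the value `L`. -/
def HasLaplace (f : ℝ → ℝ) (s L : ℂ) : Prop :=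
  IntegrableOn (fun t : ℝ => Complex.exp (-s * t) * f t) (Ioi 0) ∧
    ∫ t in Ioi (0 : ℝ), Complex.exp (-s * t) * f t = L

end DiffusionWave

end

/-!
The proof rests on one family of kernels. For `0 < ν < 1` and `μ < 1` let `K_μ(x, t)` be the inverse
Laplace transform of `s ^ (-μ) e ^ (-x s ^ ν)` (`waveKernel`), written as an integral over a Hankel
contour that opens at an angle between `π / 2` and `π / (2 ν)`; in the coordinate `w = log s` the two
sides of the contour are horizontal lines and the integrand is entire. Differentiating under the
integral gives `∂_t K_μ = K_{μ-1}` and `∂_x K_μ = -K_{μ-ν}`; expanding `e ^ (-x s ^ ν)` and using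
Hankel's formula for `1 / Γ` gives the Wright series (`waveKernel_eq_wright`), so that the asserted
Green functions are `K_{1-ν}(|x| / √D, t) / (2 √D)` and `K_0(x / √D, t)`. Their transforms in time
(`hasLaplace_waveKernel`) come from closing the contour around the pole at `s`, that is from Cauchy's
theorem in a strip. The reciprocity relation is the termwise identity `z Γ(z) = Γ(z + 1)`.

*Existence.* A Caputo derivative can be identified through its Laplace transform
(`caputo_eq_of_hasLaplace`), as Laplace transforms determine continuous functions. So the fractional
equation reduces to `D U'' = s ^ (2 ν) (U - f / s)` for the transform `U` of the solution of the
Cauchy problem, where `e ^ (-l |x|) / (2 l)` is the fundamental solution of `l² - d²/dx²`, and for the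
signalling problem to `(s ^ ν)² = s ^ (2 ν)`. The initial and boundary values hold because the kernels
are self-similar approximate identities. The Cauchy solution is a function of `x` and `√D t ^ ν`, and
the vanishing first moment of its profile controls the time derivatives at `t = 0⁺`.

*Uniqueness for the Cauchy problem* (`IsCauchyGreen.eq`). The fractional integral of order `2 ν` of
the equation gives `D U'' = s ^ (2 ν) (U - f / s)` for any Green function. The difference of two
transforms is a bounded solution of `d'' = l² d`, with `l = s ^ ν / √D` of positive real part, on the
whole line, hence zero; so the two solutions agree for every Schwartz function `f`.

*Uniqueness for the signalling problem* (`IsSignallingGreen.eq`). Here nothing is known about the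
Laplace transform of `u_xx`. Integrating the equation in `x` against the Green function of the second
derivative on `[a, b]` replaces `u_xx` by values of `u` (`IsSolution.rl_integral_eq`), which have
transforms. For the data `g = 1` this shows that the transform `γ(x)` of the Green function solves
`γ'' = l² γ` on `x > 0`; it is bounded with `γ(0⁺) = 1`, hence equal to `e ^ (-l x)`.
-/

open Set Filter Topology MeasureTheory

noncomputable section

namespace DiffusionWave

/-! ### Integrals along horizontal lines -/

lemma image_exp_univ : Real.exp '' (univ : Set ℝ) = Ioi 0 := by
  rw [image_univ, Real.range_exp]

lemma integrable_exp_smul_comp_exp {E : Type*} [NormedAddCommGroup E] [NormedSpace ℝ E]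
    (g : ℝ → E) :
    Integrable (fun ρ : ℝ => Real.exp ρ • g (Real.exp ρ)) ↔ IntegrableOn g (Ioi 0) := by
  have := integrableOn_image_iff_integrableOn_abs_deriv_smul (s := (univ : Set ℝ))
    MeasurableSet.univ (fun x _ => (Real.hasDerivAt_exp x).hasDerivWithinAt)
    Real.exp_injective.injOn g
  rw [image_exp_univ] at this
  rw [this, integrableOn_univ]
  simp [abs_of_pos (Real.exp_pos _)]

lemma integral_exp_smul_comp_exp {E : Type*} [NormedAddCommGroup E] [NormedSpace ℝ E]
    (g : ℝ → E) :
    ∫ ρ : ℝ, Real.exp ρ • g (Real.exp ρ) = ∫ r in Ioi (0 : ℝ), g r := by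
  have := integral_image_eq_integral_abs_deriv_smul (s := (univ : Set ℝ))
    MeasurableSet.univ (fun x _ => (Real.hasDerivAt_exp x).hasDerivWithinAt)
    Real.exp_injective.injOn g
  rw [image_exp_univ] at this
  rw [this, setIntegral_univ]
  simp [abs_of_pos (Real.exp_pos _)]

/-- The basic integrable majorant on horizontal lines, a Gamma integral in logarithmic
coordinates. -/
lemma integrable_exp_sub_exp {a b κ : ℝ} (ha : 0 < a) (hb : 0 < b) (hκ : 0 < κ) :
    Integrable (fun ρ : ℝ => Real.exp (a * ρ - b * Real.exp (κ * ρ))) := by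
  have h := integrableOn_rpow_mul_exp_neg_mul_rpow (s := a - 1) (p := κ) (b := b)
    (by linarith) hκ hb
  rw [← integrable_exp_smul_comp_exp] at h
  refine h.congr (ae_of_all _ fun ρ => ?_)
  simp only [smul_eq_mul]
  rw [← Real.exp_mul, ← Real.exp_mul, ← Real.exp_add, ← Real.exp_add]
  ring_nf

lemma integral_exp_sub_exp_scale (a κ : ℝ) {b : ℝ} (hb : 0 < b) (hκ : 0 < κ) :
    ∫ ρ : ℝ, Real.exp (a * ρ - b * Real.exp (κ * ρ)) =
      b ^ (-a / κ) * ∫ ρ : ℝ, Real.exp (a * ρ - Real.exp (κ * ρ)) := by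
  rw [← integral_const_mul,
    ← integral_add_right_eq_self (fun ρ : ℝ => b ^ (-a / κ) * Real.exp (a * ρ - Real.exp (κ * ρ)))
      (Real.log b / κ)]
  congr 1 with ρ
  rw [Real.rpow_def_of_pos hb, ← Real.exp_add]
  congr 1
  have : κ * (ρ + Real.log b / κ) = κ * ρ + Real.log b := by field_simp
  rw [this, Real.exp_add, Real.exp_log hb]
  field_simp
  ring

lemma tendsto_exp_sub_exp_atTop (a : ℝ) {b κ : ℝ} (hb : 0 < b) (hκ : 0 < κ) :
    Tendsto (fun ρ : ℝ => Real.exp (a * ρ - b * Real.exp (κ * ρ))) atTop (𝓝 0) := by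
  have h1 : Tendsto (fun r : ℝ => Real.exp (κ * r)) atTop atTop :=
    Real.tendsto_exp_atTop.comp (tendsto_id.const_mul_atTop hκ)
  have h := (tendsto_rpow_mul_exp_neg_mul_atTop_nhds_zero (a / κ) b hb).comp h1
  refine h.congr fun ρ => ?_
  simp only [Function.comp]
  rw [← Real.exp_mul, ← Real.exp_add]
  congr 1
  field_simp
  ring

lemma tendsto_exp_sub_exp_atBot {a b : ℝ} (κ : ℝ) (ha : 0 < a) (hb : 0 ≤ b) :
    Tendsto (fun ρ : ℝ => Real.exp (a * ρ - b * Real.exp (κ * ρ))) atBot (𝓝 0) := by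
  have h1 : Tendsto (fun ρ : ℝ => Real.exp (a * ρ)) atBot (𝓝 0) :=
    Real.tendsto_exp_atBot.comp (tendsto_id.const_mul_atBot ha)
  refine squeeze_zero (fun _ => (Real.exp_pos _).le) (fun ρ => ?_) h1
  have := mul_nonneg hb (Real.exp_pos (κ * ρ)).le
  exact Real.exp_le_exp.2 (by linarith)

/-- Cauchy's theorem for a horizontal strip: the integrals of a holomorphic function with an
integrable majorant that vanishes at infinity agree along the two edges. -/
lemma integral_line_eq {f : ℂ → ℂ} {y₁ y₂ : ℝ} {B : ℝ → ℝ}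
    (hf : DifferentiableOn ℂ f {w | w.im ∈ uIcc y₁ y₂})
    (hB : ∀ ρ : ℝ, ∀ y ∈ uIcc y₁ y₂, ‖f (ρ + y * Complex.I)‖ ≤ B ρ)
    (hBi : Integrable B) (hBt : Tendsto B atTop (𝓝 0)) (hBb : Tendsto B atBot (𝓝 0)) :
    ∫ ρ : ℝ, f (ρ + y₁ * Complex.I) = ∫ ρ : ℝ, f (ρ + y₂ * Complex.I) := by
  have hint : ∀ y ∈ uIcc y₁ y₂, Integrable (fun ρ : ℝ => f (ρ + y * Complex.I)) := by
    intro y hy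
    refine hBi.mono' ?_ (ae_of_all _ fun ρ => hB ρ y hy)
    refine Continuous.aestronglyMeasurable ?_
    exact hf.continuousOn.comp_continuous (by fun_prop) (fun ρ => by simpa using hy)
  have hlim : ∀ y ∈ uIcc y₁ y₂, Tendsto (fun R : ℝ => ∫ ρ in (-R)..R, f (ρ + y * Complex.I))
      atTop (𝓝 (∫ ρ : ℝ, f (ρ + y * Complex.I))) := fun y hy =>
    intervalIntegral_tendsto_integral (hint y hy) tendsto_neg_atTop_atBot tendsto_id
  have hvert : ∀ s : ℝ → ℝ, Tendsto (fun R => B (s R)) atTop (𝓝 0) →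
      Tendsto (fun R : ℝ => Complex.I • ∫ y in y₁..y₂, f ((s R : ℝ) + y * Complex.I)) atTop
        (𝓝 0) := by
    intro s hs
    have h2 : Tendsto (fun R => B (s R) * |y₂ - y₁|) atTop (𝓝 0) := by
      simpa using hs.mul_const |y₂ - y₁|
    refine squeeze_zero_norm (fun R => ?_) h2
    rw [norm_smul, Complex.norm_I, one_mul]
    refine intervalIntegral.norm_integral_le_of_norm_le_const fun y hy => ?_
    exact hB _ _ (uIoc_subset_uIcc hy)
  have hrect : ∀ R : ℝ, (∫ ρ in (-R)..R, f (ρ + y₁ * Complex.I)) -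
      (∫ ρ in (-R)..R, f (ρ + y₂ * Complex.I)) +
      Complex.I • (∫ y in y₁..y₂, f ((R : ℝ) + y * Complex.I)) -
      Complex.I • (∫ y in y₁..y₂, f ((-R : ℝ) + y * Complex.I)) = 0 := by
    intro R
    have := Complex.integral_boundary_rect_eq_zero_of_differentiableOn f ⟨-R, y₁⟩ ⟨R, y₂⟩
      (hf.mono fun w hw => hw.2)
    simpa using this
  have hl := (((hlim y₁ left_mem_uIcc).sub (hlim y₂ right_mem_uIcc)).add
    (hvert id hBt)).sub (hvert (fun R => -R) (hBb.comp tendsto_neg_atTop_atBot))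
  have h0 := tendsto_nhds_unique (hl.congr hrect) tendsto_const_nhds
  simp only [add_zero, sub_zero] at h0
  exact sub_eq_zero.1 h0

lemma norm_exp_sub_exp (a b : ℝ) (w : ℂ) :
    ‖Complex.exp (a * w - b * Complex.exp w)‖ =
      Real.exp (a * w.re - b * Real.cos w.im * Real.exp (1 * w.re)) := by
  rw [Complex.norm_exp]
  simp [Complex.exp_re]
  ring

/-- The Gamma integral along the horizontal line through `w₀`. -/
lemma integral_exp_sub_exp_line {a : ℝ} (ha : 0 < a) {w₀ : ℂ} (hw : |w₀.im| < Real.pi / 2) :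
    ∫ ρ : ℝ, Complex.exp (a * (ρ + w₀) - Complex.exp (ρ + w₀)) = Complex.Gamma a := by
  have hc : 0 < Real.cos w₀.im := Real.cos_pos_of_mem_Ioo (abs_lt.1 hw)
  have h1 : ∫ ρ : ℝ, Complex.exp (a * (ρ + w₀) - Complex.exp (ρ + w₀)) =
      ∫ ρ : ℝ, Complex.exp (a * (ρ + w₀.im * Complex.I) -
        Complex.exp (ρ + w₀.im * Complex.I)) := by
    rw [← integral_add_right_eq_self (fun ρ : ℝ => Complex.exp (a * (ρ + w₀.im * Complex.I) -
        Complex.exp (ρ + w₀.im * Complex.I))) w₀.re]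
    congr 1 with ρ
    have : ((ρ + w₀.re : ℝ) : ℂ) + w₀.im * Complex.I = ρ + w₀ := by
      push_cast
      rw [add_assoc, Complex.re_add_im]
    rw [this]
  have h2 := integral_line_eq (f := fun w => Complex.exp (a * w - Complex.exp w))
    (y₁ := w₀.im) (y₂ := 0)
    (B := fun ρ => Real.exp (a * ρ - Real.cos w₀.im * Real.exp (1 * ρ)))
    (by fun_prop) ?_ (integrable_exp_sub_exp ha hc one_pos)
    (tendsto_exp_sub_exp_atTop a hc one_pos) (tendsto_exp_sub_exp_atBot 1 ha hc.le)
  · rw [h1, h2, Complex.Gamma_eq_integral (by simpa using ha), Complex.GammaIntegral,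
      ← integral_exp_smul_comp_exp]
    congr 1 with ρ
    have : ((Real.exp ρ : ℝ) : ℂ) ^ ((a : ℂ) - 1) = Complex.exp ((a - 1) * ρ) := by
      rw [Complex.ofReal_exp, Complex.cpow_def_of_ne_zero
        (Complex.exp_ne_zero _), ← Complex.ofReal_exp, ← Complex.ofReal_log (Real.exp_pos _).le,
        Real.log_exp, mul_comm]
    rw [this, Complex.real_smul, Complex.ofReal_exp, Complex.ofReal_exp, ← Complex.exp_add,
      ← Complex.exp_add]
    congr 1
    simp
    ring
  · intro ρ y hy
    have := norm_exp_sub_exp a 1 (ρ + y * Complex.I)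
    simp only [Complex.ofReal_one, one_mul] at this ⊢
    rw [this]
    refine Real.exp_le_exp.2 ?_
    simp only [Complex.add_re, Complex.ofReal_re, Complex.mul_re, Complex.I_re, mul_zero,
      Complex.ofReal_im, Complex.I_im, mul_one, sub_self, add_zero, Complex.add_im, Complex.mul_im,
      zero_add]
    have hy' : |y| ≤ |w₀.im| := by
      rcases le_total 0 w₀.im with h | h
      · rw [uIcc_of_ge h] at hy
        rw [abs_of_nonneg hy.1, abs_of_nonneg h]; exact hy.2
      · rw [uIcc_of_le h] at hy
        rw [abs_of_nonpos hy.2, abs_of_nonpos h]; linarith [hy.1]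
    have : Real.cos w₀.im ≤ Real.cos y := by
      rw [← Real.cos_abs w₀.im, ← Real.cos_abs y]
      exact Real.cos_le_cos_of_nonneg_of_le_pi (abs_nonneg _) (by linarith [Real.pi_pos]) hy'
    nlinarith [Real.exp_pos ρ]

/-! ### Laplace transforms -/

/-- A function that is continuous on `(0, ∞)` is determined by its Laplace transform on a vertical
line, by Fourier inversion. -/
lemma eqOn_of_hasLaplace {f g : ℝ → ℝ} {σ : ℝ} (hf : ContinuousOn f (Ioi 0))
    (hg : ContinuousOn g (Ioi 0))
    (h : ∀ s : ℂ, s.re = σ → ∃ L, HasLaplace f s L ∧ HasLaplace g s L) :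
    EqOn f g (Ioi 0) := by
  set F : ℝ → ℂ := (Ioi (0 : ℝ)).indicator
    (fun t => Complex.exp (-(σ : ℂ) * t) * ((f t - g t : ℝ) : ℂ)) with hF
  have hFi : Integrable F := by
    rw [hF, integrable_indicator_iff measurableSet_Ioi]
    obtain ⟨L, h1, h2⟩ := h σ (by simp)
    refine (h1.1.sub h2.1).congr (ae_of_all _ fun t => ?_)
    simp [mul_sub]
  have hF0 : FourierTransform.fourier F = (0 : ℝ → ℂ) := by
    ext w
    rw [Real.fourier_real_eq_integral_exp_smul]
    obtain ⟨L, h1, h2⟩ := h (σ + (2 * Real.pi * w : ℝ) * Complex.I) (by simp)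
    have h3 : ∫ t in Ioi (0 : ℝ),
        (Complex.exp (-(σ + (2 * Real.pi * w : ℝ) * Complex.I) * t) * f t -
          Complex.exp (-(σ + (2 * Real.pi * w : ℝ) * Complex.I) * t) * g t) = 0 := by
      rw [integral_sub h1.1 h2.1, h1.2, h2.2, sub_self]
    rw [← integral_indicator measurableSet_Ioi] at h3
    rw [Pi.zero_apply, ← h3]
    congr 1 with t
    by_cases ht : t ∈ Ioi (0 : ℝ)
    · simp only [hF, indicator_of_mem ht, smul_eq_mul]
      rw [← mul_assoc, ← Complex.exp_add]
      push_cast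
      rw [mul_sub]
      congr 3 <;> ring
    · simp [hF, indicator_of_notMem ht]
  intro t ht
  have hcont : ContinuousAt F t := by
    have : ContinuousOn F (Ioi 0) := by
      refine ContinuousOn.congr (f := fun t : ℝ => Complex.exp (-(σ : ℂ) * t) *
        ((f t - g t : ℝ) : ℂ)) ?_ (fun t ht => indicator_of_mem ht _)
      refine ContinuousOn.mul (by fun_prop) ?_
      exact Complex.continuous_ofReal.comp_continuousOn (hf.sub hg)
    exact this.continuousAt (Ioi_mem_nhds ht)
  have hinv := hFi.fourierInv_fourier_eq (by rw [hF0]; exact integrable_zero _ _ _) hcont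
  rw [hF0] at hinv
  have h0 : F t = 0 := by
    rw [← hinv, Real.fourierInv_eq]
    simp
  rw [hF, indicator_of_mem ht, mul_eq_zero] at h0
  rcases h0 with h0 | h0
  · exact absurd h0 (Complex.exp_ne_zero _)
  · exact sub_eq_zero.1 (by exact_mod_cast h0)

/-! ### The equation `w'' = λ² w` -/

/-- On a convex open set of reals, the solutions of `d'' = l² d` are combinations of `e^{lx}`
and `e^{-lx}`. -/
lemma exists_eq_exp_add_exp {S : Set ℝ} (hS : Convex ℝ S) (hSo : IsOpen S) {d e : ℝ → ℂ} {l : ℂ}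
    (hl : l ≠ 0) (hd : ∀ x ∈ S, HasDerivAt d (e x) x)
    (he : ∀ x ∈ S, HasDerivAt e (l ^ 2 * d x) x) :
    ∃ A B : ℂ, ∀ x ∈ S, d x = A * Complex.exp (l * x) + B * Complex.exp (-l * x) := by
  have key : ∀ k : ℂ, k ^ 2 = l ^ 2 →
      ∃ c : ℂ, ∀ x ∈ S, e x + k * d x = c * Complex.exp (k * x) := by
    intro k hk
    rcases S.eq_empty_or_nonempty with rfl | ⟨x₀, hx₀⟩
    · exact ⟨0, by simp⟩
    refine ⟨(e x₀ + k * d x₀) * Complex.exp (-k * x₀), fun x hx => ?_⟩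
    have hder : ∀ x ∈ S, HasDerivAt (fun x : ℝ => (e x + k * d x) * Complex.exp (-k * x)) 0 x := by
      intro x hx
      have h1 : HasDerivAt (fun x : ℝ => Complex.exp (-k * x)) (Complex.exp (-k * x) * (-k)) x := by
        have := ((Complex.ofRealCLM.hasDerivAt (x := x)).const_mul (-k)).cexp
        simpa using this
      have h2 := ((he x hx).add ((hd x hx).const_mul k)).mul h1
      refine h2.congr_deriv ?_
      simp only [Pi.add_apply]
      linear_combination (Complex.exp (-k * x) * d x) * (-hk)
    have := hS.is_const_of_fderivWithin_eq_zero (𝕜 := ℝ)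
      (f := fun x : ℝ => (e x + k * d x) * Complex.exp (-k * x))
      (fun x hx => (hder x hx).differentiableAt.differentiableWithinAt)
      (fun x hx => by
        rw [fderivWithin_of_isOpen hSo hx]
        ext
        simpa using (hder x hx).deriv) hx hx₀
    rw [← this, mul_assoc, ← Complex.exp_add]
    simp
  obtain ⟨c₁, h₁⟩ := key l rfl
  obtain ⟨c₂, h₂⟩ := key (-l) (by ring)
  refine ⟨c₁ / (2 * l), -c₂ / (2 * l), fun x hx => ?_⟩
  have e1 := h₁ x hx
  have e2 := h₂ x hx
  simp only [neg_mul] at e1 e2 ⊢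
  field_simp
  linear_combination e1 - e2

lemma tendsto_norm_exp_mul_atTop {l : ℂ} (hl : 0 < l.re) :
    Tendsto (fun x : ℝ => ‖Complex.exp (l * x)‖) atTop atTop := by
  simp only [Complex.norm_exp, Complex.mul_re, Complex.ofReal_re, Complex.ofReal_im, mul_zero,
    sub_zero]
  exact Real.tendsto_exp_atTop.comp (tendsto_id.const_mul_atTop hl)

lemma eq_zero_of_bounded_exp {l A B : ℂ} (hl : 0 < l.re) {d : ℝ → ℂ} {C : ℝ}
    (hd : ∀ x : ℝ, 0 < x → ‖d x‖ ≤ C)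
    (h : ∀ x : ℝ, 0 < x → d x = A * Complex.exp (l * x) + B * Complex.exp (-l * x)) : A = 0 := by
  by_contra hA
  have h1 : Tendsto (fun x : ℝ => ‖A‖ * ‖Complex.exp (l * x)‖) atTop atTop :=
    (tendsto_norm_exp_mul_atTop hl).const_mul_atTop (norm_pos_iff.2 hA)
  obtain ⟨x, hx, hx0⟩ := ((h1.eventually_gt_atTop (C + ‖B‖)).and (eventually_gt_atTop 0)).exists
  have h2 := h x hx0
  have h3 : ‖A * Complex.exp (l * x)‖ ≤ C + ‖B‖ := by
    have : A * Complex.exp (l * x) = d x - B * Complex.exp (-l * x) := by rw [h2]; ring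
    rw [this]
    refine (norm_sub_le _ _).trans (add_le_add (hd x hx0) ?_)
    rw [norm_mul]
    refine mul_le_of_le_one_right (norm_nonneg _) ?_
    rw [Complex.norm_exp, Real.exp_le_one_iff]
    simp
    positivity
  rw [norm_mul] at h3
  linarith

/-! ### Calculus of Laplace transforms -/

lemma HasLaplace.unique {f : ℝ → ℝ} {s A B : ℂ} (hA : HasLaplace f s A) (hB : HasLaplace f s B) :
    A = B := hA.2.symm.trans hB.2

lemma HasLaplace.congr {f g : ℝ → ℝ} {s A : ℂ} (h : HasLaplace f s A)
    (hfg : EqOn f g (Ioi 0)) : HasLaplace g s A := by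
  have e : EqOn (fun t : ℝ => Complex.exp (-s * t) * f t) (fun t => Complex.exp (-s * t) * g t)
      (Ioi 0) := fun t ht => by simp only [hfg ht]
  exact ⟨h.1.congr_fun e measurableSet_Ioi, (setIntegral_congr_fun measurableSet_Ioi e).symm.trans
    h.2⟩

lemma HasLaplace.const_mul {f : ℝ → ℝ} {s A : ℂ} (h : HasLaplace f s A) (c : ℝ) :
    HasLaplace (fun t => c * f t) s (c * A) := by
  have e : (fun t : ℝ => Complex.exp (-s * t) * ((c * f t : ℝ) : ℂ)) =
      fun t : ℝ => (c : ℂ) * (Complex.exp (-s * t) * f t) := by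
    ext t; push_cast; ring
  refine ⟨?_, ?_⟩
  · rw [e]; exact h.1.const_mul _
  · rw [e, integral_const_mul, h.2]

lemma HasLaplace.sub {f g : ℝ → ℝ} {s A B : ℂ} (hf : HasLaplace f s A) (hg : HasLaplace g s B) :
    HasLaplace (fun t => f t - g t) s (A - B) := by
  have e : (fun t : ℝ => Complex.exp (-s * t) * ((f t - g t : ℝ) : ℂ)) =
      fun t : ℝ => Complex.exp (-s * t) * f t - Complex.exp (-s * t) * g t := by
    ext t; push_cast; ring
  refine ⟨?_, ?_⟩
  · rw [e]; exact hf.1.sub hg.1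
  · rw [e, integral_sub hf.1 hg.1, hf.2, hg.2]

lemma norm_exp_neg_mul_ofReal (s : ℂ) (t : ℝ) :
    ‖Complex.exp (-s * t)‖ = Real.exp (-s.re * t) := by
  simp [Complex.norm_exp]

/-- Absolute convergence of a Laplace integral only depends on the real part of `s`. -/
lemma hasLaplace_of_integrableOn {f : ℝ → ℝ} {s : ℂ}
    (h : IntegrableOn (fun t : ℝ => Real.exp (-s.re * t) * f t) (Ioi 0)) :
    HasLaplace f s (∫ t in Ioi (0 : ℝ), Complex.exp (-s * t) * f t) := by
  refine ⟨?_, rfl⟩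
  have h1 : IntegrableOn (fun t : ℝ => ((Real.exp (-s.re * t) * f t : ℝ) : ℂ)) (Ioi 0) := h.ofReal
  have h2 := h1.bdd_mul (c := 1) (f := fun t : ℝ => Complex.exp (-(s.im * Complex.I) * t))
    (by fun_prop) (ae_of_all _ fun t => by rw [norm_exp_neg_mul_ofReal]; simp)
  refine h2.congr (ae_of_all _ fun t => ?_)
  simp only
  push_cast
  rw [← mul_assoc, ← Complex.exp_add]
  congr 2
  conv_rhs => rw [← Complex.re_add_im s]
  ring

/-- The Laplace transform turns convolution on the half-line into a product. -/
lemma HasLaplace.conv {f g : ℝ → ℝ} {s A B : ℂ} (hf : HasLaplace f s A) (hg : HasLaplace g s B) :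
    HasLaplace (fun t => ∫ τ in (0 : ℝ)..t, f τ * g (t - τ)) s (A * B) := by
  have e : ∀ t : ℝ, ∫ τ in (0 : ℝ)..t, (ContinuousLinearMap.mul ℝ ℂ)
      (Complex.exp (-s * τ) * f τ) (Complex.exp (-s * (t - τ : ℝ)) * g (t - τ)) =
      Complex.exp (-s * t) * ((∫ τ in (0 : ℝ)..t, f τ * g (t - τ) : ℝ) : ℂ) := by
    intro t
    rw [← intervalIntegral.integral_ofReal, ← intervalIntegral.integral_const_mul]
    refine intervalIntegral.integral_congr fun τ _ => ?_
    simp only [ContinuousLinearMap.mul_apply']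
    have : Complex.exp (-s * t) = Complex.exp (-s * τ) * Complex.exp (-s * (t - τ : ℝ)) := by
      rw [← Complex.exp_add]; congr 1; push_cast; ring
    rw [this]; push_cast; ring
  refine ⟨?_, ?_⟩
  · have := (integrable_posConvolution hf.1 hg.1 (ContinuousLinearMap.mul ℝ ℂ)).integrableOn
      (s := Ioi 0)
    refine this.congr_fun (fun t ht => ?_) measurableSet_Ioi
    rw [posConvolution, indicator_of_mem ht, ← e t]
  · have := integral_posConvolution hf.1 hg.1 (ContinuousLinearMap.mul ℝ ℂ)
    simp only [e] at this
    rw [this, hf.2, hg.2, ContinuousLinearMap.mul_apply']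

/-! ### Riemann–Liouville integrals and the Caputo derivative -/

/-- The kernel `t ^ (β - 1) / Γ(β)` of fractional integration of order `β`. -/
def powKernel (β t : ℝ) : ℝ := t ^ (β - 1) / Real.Gamma β

/-- The Riemann–Liouville integral of order `β > 0` of `h`, at time `t > 0`. -/
def rl (β : ℝ) (h : ℝ → ℝ) (t : ℝ) : ℝ := ∫ τ in (0 : ℝ)..t, h τ * powKernel β (t - τ)

lemma powKernel_one (t : ℝ) : powKernel 1 t = 1 := by simp [powKernel]

lemma powKernel_two (t : ℝ) : powKernel 2 t = t := by
  simp only [powKernel]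
  norm_num

lemma measurable_powKernel (β : ℝ) : Measurable (powKernel β) := by
  unfold powKernel; fun_prop

lemma powKernel_nonneg {β t : ℝ} (hβ : 0 < β) (ht : 0 ≤ t) : 0 ≤ powKernel β t :=
  div_nonneg (Real.rpow_nonneg ht _) (Real.Gamma_pos_of_pos hβ).le

lemma integrableOn_powKernel {β : ℝ} (hβ : 0 < β) (T : ℝ) :
    IntegrableOn (powKernel β) (Ioc 0 T) := by
  rcases le_or_gt 0 T with h | h
  · have := (intervalIntegral.intervalIntegrable_rpow' (a := 0) (b := T) (r := β - 1)
      (by linarith)).div_const (Real.Gamma β)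
    rwa [intervalIntegrable_iff_integrableOn_Ioc_of_le h] at this
  · rw [Ioc_eq_empty (by linarith)]; exact integrableOn_empty

lemma cpow_log_line {s : ℂ} (hs : 0 < s.re) : |(Complex.log s).im| < Real.pi / 2 := by
  rw [Complex.log_im]
  exact Complex.abs_arg_lt_pi_div_two_iff.2 (Or.inl hs)

lemma ne_zero_of_re_pos {s : ℂ} (hs : 0 < s.re) : s ≠ 0 := by
  rintro rfl; simp at hs

/-- The Laplace transform of the fractional kernel is `s ^ (-β)`. -/
lemma hasLaplace_powKernel {β : ℝ} (hβ : 0 < β) {s : ℂ} (hs : 0 < s.re) :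
    HasLaplace (powKernel β) s (s ^ (-β : ℂ)) := by
  have hs0 := ne_zero_of_re_pos hs
  have hi : IntegrableOn (fun t : ℝ => Real.exp (-s.re * t) * powKernel β t) (Ioi 0) := by
    have := (integrableOn_rpow_mul_exp_neg_mul_rpow (s := β - 1) (p := 1) (b := s.re)
      (by linarith) one_pos hs).div_const (Real.Gamma β)
    refine this.congr (ae_of_all _ fun t => ?_)
    simp only [powKernel, Real.rpow_one]
    ring
  have h := hasLaplace_of_integrableOn hi
  convert h using 1
  rw [← integral_exp_smul_comp_exp]
  have h2 := integral_exp_sub_exp_line hβ (cpow_log_line hs)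
  have hΓ : Complex.Gamma β ≠ 0 := by
    rw [Complex.Gamma_ofReal]
    exact_mod_cast (Real.Gamma_pos_of_pos hβ).ne'
  have : ∀ ρ : ℝ, Real.exp ρ • (Complex.exp (-s * (Real.exp ρ : ℝ)) *
      ((powKernel β (Real.exp ρ) : ℝ) : ℂ)) =
      s ^ (-β : ℂ) / Complex.Gamma β *
      Complex.exp (β * (ρ + Complex.log s) - Complex.exp (ρ + Complex.log s)) := by
    intro ρ
    rw [powKernel, ← Real.exp_mul, Complex.real_smul, Complex.cpow_def_of_ne_zero hs0,
      Complex.exp_add, Complex.exp_log hs0, Complex.Gamma_ofReal]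
    push_cast
    rw [div_mul_eq_mul_div, mul_div_assoc', mul_div_assoc', ← Complex.exp_add, ← Complex.exp_add,
      ← Complex.exp_add]
    congr 2
    ring
  simp_rw [this]
  rw [integral_const_mul, h2]
  field_simp

lemma hasLaplace_rl {β : ℝ} (hβ : 0 < β) {h : ℝ → ℝ} {s A : ℂ} (hs : 0 < s.re)
    (hh : HasLaplace h s A) : HasLaplace (rl β h) s (s ^ (-β : ℂ) * A) := by
  rw [mul_comm]
  exact hh.conv (hasLaplace_powKernel hβ hs)

lemma hasLaplace_one {s : ℂ} (hs : 0 < s.re) : HasLaplace (fun _ => 1) s s⁻¹ := by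
  have := hasLaplace_powKernel one_pos hs
  rw [Complex.ofReal_one, Complex.cpow_neg_one] at this
  exact this.congr fun t _ => powKernel_one t

/-- The semigroup law of the fractional kernels, i.e. the Beta integral. -/
lemma integral_powKernel_mul {α β t : ℝ} (hα : 0 < α) (hβ : 0 < β) (ht : 0 < t) :
    ∫ τ in (0 : ℝ)..t, powKernel α τ * powKernel β (t - τ) = powKernel (α + β) t := by
  have h1 := Complex.betaIntegral_scaled α β ht
  have h2 := Complex.Gamma_mul_Gamma_eq_betaIntegral (s := α) (t := β) (by simpa) (by simpa)
  have h3 : Complex.betaIntegral α β =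
      ((Real.Gamma α * Real.Gamma β / Real.Gamma (α + β) : ℝ) : ℂ) := by
    have : Complex.Gamma (α + β) ≠ 0 := by
      rw [← Complex.ofReal_add, Complex.Gamma_ofReal]
      exact_mod_cast (Real.Gamma_pos_of_pos (add_pos hα hβ)).ne'
    push_cast
    rw [← Complex.Gamma_ofReal, ← Complex.Gamma_ofReal, ← Complex.Gamma_ofReal]
    push_cast
    rw [h2]
    field_simp
  have h4 : ∫ x in (0 : ℝ)..t, (x : ℂ) ^ ((α : ℂ) - 1) * ((t : ℂ) - x) ^ ((β : ℂ) - 1) =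
      ((∫ x in (0 : ℝ)..t, x ^ (α - 1) * (t - x) ^ (β - 1) : ℝ) : ℂ) := by
    rw [← intervalIntegral.integral_ofReal]
    refine intervalIntegral.integral_congr fun x hx => ?_
    rw [uIcc_of_le ht.le] at hx
    rw [Complex.ofReal_mul, Complex.ofReal_cpow hx.1, Complex.ofReal_cpow (by linarith [hx.2])]
    push_cast
    rfl
  rw [h4, h3] at h1
  have h5 : ∫ x in (0 : ℝ)..t, x ^ (α - 1) * (t - x) ^ (β - 1) =
      t ^ (α + β - 1) * (Real.Gamma α * Real.Gamma β / Real.Gamma (α + β)) := by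
    have : (t : ℂ) ^ ((α : ℂ) + β - 1) = ((t ^ (α + β - 1) : ℝ) : ℂ) := by
      rw [Complex.ofReal_cpow ht.le]; push_cast; rfl
    rw [this] at h1
    exact_mod_cast h1
  have : ∀ τ : ℝ, powKernel α τ * powKernel β (t - τ) =
      (Real.Gamma α * Real.Gamma β)⁻¹ * (τ ^ (α - 1) * (t - τ) ^ (β - 1)) := by
    intro τ; simp only [powKernel]; field_simp
  simp_rw [this]
  rw [intervalIntegral.integral_const_mul, h5, powKernel]
  field_simp

/-- The convolution of functions cut off to `(0, T]` is, up to time `T`, their convolution on the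
half-line. -/
lemma convolution_indicator {f g : ℝ → ℝ} {T t : ℝ} (ht : t ≤ T) :
    convolution ((Ioc 0 T).indicator f) ((Ioc 0 T).indicator g) (ContinuousLinearMap.mul ℝ ℝ) volume
      t = if 0 < t then ∫ τ in (0 : ℝ)..t, f τ * g (t - τ) else 0 := by
  rw [convolution]
  split_ifs with h
  · rw [intervalIntegral.integral_of_le h.le, integral_Ioc_eq_integral_Ioo,
      ← integral_indicator measurableSet_Ioo]
    congr 1 with τ
    by_cases hτ : τ ∈ Ioo 0 t
    · rw [indicator_of_mem hτ, indicator_of_mem (show τ ∈ Ioc 0 T from ⟨hτ.1, hτ.2.le.trans ht⟩),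
        indicator_of_mem (show t - τ ∈ Ioc 0 T from ⟨sub_pos.2 hτ.2, by linarith [hτ.1]⟩)]
      rfl
    · rw [indicator_of_notMem hτ]
      by_cases h0 : 0 < τ
      · rw [indicator_of_notMem (s := Ioc 0 T) (a := t - τ), map_zero]
        intro h'
        exact hτ ⟨h0, sub_pos.1 h'.1⟩
      · rw [indicator_of_notMem (s := Ioc 0 T) (a := τ), map_zero]
        · rfl
        · exact fun h' => h0 h'.1
  · refine integral_eq_zero_of_ae (ae_of_all _ fun τ => ?_)
    simp only [Pi.zero_apply]
    by_cases h0 : 0 < τ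
    · rw [indicator_of_notMem (s := Ioc 0 T) (a := t - τ), map_zero]
      intro h'
      linarith [h'.1]
    · rw [indicator_of_notMem (s := Ioc 0 T) (a := τ), map_zero]
      · rfl
      · exact fun h' => h0 h'.1

/-- The semigroup law of fractional integration. The total order is at least one, so that the
composite kernel is bounded and the identity holds at every time. -/
lemma rl_rl {α β : ℝ} (hα : 0 < α) (hβ : 0 < β) (hαβ : 1 ≤ α + β) {h : ℝ → ℝ} {t : ℝ} (ht : 0 < t)
    (hh : IntegrableOn h (Ioc 0 t)) : rl β (rl α h) t = rl (α + β) h t := by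
  set M := ContinuousLinearMap.mul ℝ ℝ
  set H := (Ioc 0 t).indicator h with hH
  set a := (Ioc 0 t).indicator (powKernel α) with ha
  set b := (Ioc 0 t).indicator (powKernel β) with hb
  have iH : Integrable H := (integrable_indicator_iff measurableSet_Ioc).2 hh
  have ia : Integrable a := (integrable_indicator_iff measurableSet_Ioc).2
    (integrableOn_powKernel hα t)
  have ib : Integrable b := (integrable_indicator_iff measurableSet_Ioc).2
    (integrableOn_powKernel hβ t)
  have na : (fun x => ‖a x‖) = a := by
    ext x
    rw [Real.norm_eq_abs, abs_of_nonneg]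
    exact indicator_nonneg (fun x hx => powKernel_nonneg hα hx.1.le) x
  have nb : (fun x => ‖b x‖) = b := by
    ext x
    rw [Real.norm_eq_abs, abs_of_nonneg]
    exact indicator_nonneg (fun x hx => powKernel_nonneg hβ hx.1.le) x
  have hab : ∀ x ≤ t, convolution a b M volume x = if 0 < x then powKernel (α + β) x else 0 := by
    intro x hx
    rw [ha, hb, convolution_indicator hx]
    split_ifs with h0
    · exact integral_powKernel_mul hα hβ h0
    · rfl
  have hassoc := convolution_assoc (f := H) (g := a) (k := b) (x₀ := t) (μ := volume)
    (ν := volume) M M M M (fun x y z => mul_assoc x y z) iH.1 ia.1 ib.1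
    (iH.ae_convolution_exists M ia) (by rw [na, nb]; exact ia.ae_convolution_exists _ ib) (by
      rw [na, nb]
      set C := t ^ (α + β - 1) / Real.Gamma (α + β) with hC
      have key : Integrable (fun τ => (Ioc 0 t).indicator (fun τ => ‖h τ‖) τ *
          (Icc 0 t).indicator (fun τ => convolution a b M volume (t - τ)) τ) := by
        refine Integrable.mul_bdd (c := C) ?_ ?_ (ae_of_all _ fun τ => ?_)
        · exact (integrable_indicator_iff measurableSet_Ioc).2 hh.norm
        · refine AEStronglyMeasurable.indicator ?_ measurableSet_Icc
          have := (ia.integrable_convolution M ib).1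
          exact this.comp_quasiMeasurePreserving
            (quasiMeasurePreserving_sub_left volume t)
        · by_cases hτ : τ ∈ Icc 0 t
          · rw [indicator_of_mem hτ, hab _ (by linarith [hτ.1])]
            split_ifs with h0
            · rw [Real.norm_eq_abs, abs_of_nonneg (powKernel_nonneg (add_pos hα hβ) h0.le),
                powKernel, hC]
              gcongr
              linarith [hτ.1]
            · rw [norm_zero, hC]; positivity
          · rw [indicator_of_notMem hτ, norm_zero, hC]; positivity
      refine key.congr (ae_of_all _ fun τ => ?_)
      by_cases hτ : τ ∈ Ioc 0 t
      · simp only [hH, indicator_of_mem hτ, indicator_of_mem (Ioc_subset_Icc_self hτ)]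
        rfl
      · simp [hH, indicator_of_notMem hτ])
  have e1 : convolution (convolution H a M volume) b M volume t = rl β (rl α h) t := by
    rw [convolution, rl, intervalIntegral.integral_of_le ht.le, integral_Ioc_eq_integral_Ioo,
      ← integral_indicator measurableSet_Ioo]
    congr 1 with τ
    by_cases hτ : τ ∈ Ioo 0 t
    · rw [indicator_of_mem hτ, hH, ha, convolution_indicator hτ.2.le, if_pos hτ.1, hb,
        indicator_of_mem (show t - τ ∈ Ioc 0 t from ⟨sub_pos.2 hτ.2, by linarith [hτ.1]⟩)]
      rfl
    · rw [indicator_of_notMem hτ]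
      by_cases h0 : 0 < τ
      · rw [hb, indicator_of_notMem (s := Ioc 0 t) (a := t - τ), map_zero]
        intro h'
        exact hτ ⟨h0, sub_pos.1 h'.1⟩
      · rw [hH, ha, convolution_indicator (by linarith), if_neg h0, map_zero]
        rfl
  have e2 : convolution H (convolution a b M volume) M volume t = rl (α + β) h t := by
    rw [convolution, rl, intervalIntegral.integral_of_le ht.le, integral_Ioc_eq_integral_Ioo,
      ← integral_indicator measurableSet_Ioo]
    congr 1 with τ
    by_cases hτ : τ ∈ Ioo 0 t
    · rw [indicator_of_mem hτ, hab _ (by linarith [hτ.1]), if_pos (sub_pos.2 hτ.2), hH,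
        indicator_of_mem (show τ ∈ Ioc 0 t from ⟨hτ.1, hτ.2.le⟩)]
      rfl
    · rw [indicator_of_notMem hτ]
      by_cases h0 : 0 < τ
      · rw [hab _ (by linarith), if_neg (fun h' => hτ ⟨h0, sub_pos.1 h'⟩), map_zero]
      · rw [hH, indicator_of_notMem (s := Ioc 0 t) (fun h' => h0 h'.1), map_zero]
        rfl
  rw [← e1, ← e2, hassoc]

lemma caputo_eq_rl {β : ℝ} (hβ : β ≠ (⌈β⌉₊ : ℝ)) (f : ℝ → ℝ) {t : ℝ} (ht : 0 < t) :
    caputo β f t = rl (⌈β⌉₊ - β) (iteratedDeriv ⌈β⌉₊ f) t := by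
  rw [caputo, if_neg hβ, rl, ← intervalIntegral.integral_const_mul]
  refine intervalIntegral.integral_congr fun τ hτ => ?_
  rw [uIcc_of_le ht.le] at hτ
  have : β + 1 - (⌈β⌉₊ : ℝ) = -(⌈β⌉₊ - β - 1) := by ring
  simp only [powKernel]
  rw [this, Real.rpow_neg (by linarith [hτ.2])]
  field_simp

lemma caputo_eq_iteratedDeriv {β : ℝ} (hβ : β = (⌈β⌉₊ : ℝ)) (f : ℝ → ℝ) (t : ℝ) :
    caputo β f t = iteratedDeriv ⌈β⌉₊ f t := by
  rw [caputo, if_pos hβ]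

lemma rl_congr {β t : ℝ} {f g : ℝ → ℝ} (ht : 0 < t) (h : ∀ τ ∈ Ioc 0 t, f τ = g τ) :
    rl β f t = rl β g t := by
  rw [rl, rl, intervalIntegral.integral_of_le ht.le, intervalIntegral.integral_of_le ht.le]
  exact setIntegral_congr_fun measurableSet_Ioc fun τ hτ => by simp only [h τ hτ]

lemma rl_caputo {β : ℝ} (hβ : 0 < β) {f : ℝ → ℝ} {t : ℝ} (ht : 0 < t)
    (hi : IntegrableOn (iteratedDeriv ⌈β⌉₊ f) (Ioc 0 t)) :
    rl β (caputo β f) t = rl ⌈β⌉₊ (iteratedDeriv ⌈β⌉₊ f) t := by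
  by_cases h : β = (⌈β⌉₊ : ℝ)
  · rw [rl_congr ht fun τ _ => caputo_eq_iteratedDeriv h f τ, ← h]
  · have h1 : β < ⌈β⌉₊ := lt_of_le_of_ne (Nat.le_ceil β) h
    have h2 : (1 : ℝ) ≤ ⌈β⌉₊ := by exact_mod_cast Nat.ceil_pos.2 hβ
    rw [rl_congr ht fun τ hτ => caputo_eq_rl h f hτ.1,
      rl_rl (sub_pos.2 h1) hβ (by simpa using h2) ht hi]
    simp

lemma ceil_eq_one_or_two {β : ℝ} (hβ : 0 < β) (hβ2 : β < 2) :
    (β ≤ 1 ∧ ⌈β⌉₊ = 1) ∨ (1 < β ∧ ⌈β⌉₊ = 2) := by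
  rcases le_or_gt β 1 with h | h
  · refine Or.inl ⟨h, ?_⟩
    rw [Nat.ceil_eq_iff one_ne_zero]
    simpa using ⟨hβ, h⟩
  · refine Or.inr ⟨h, ?_⟩
    rw [Nat.ceil_eq_iff two_ne_zero]
    norm_num
    exact ⟨h, hβ2.le⟩

lemma hasDerivAt_of_contDiffOn_Ioi {f : ℝ → ℝ} {n : WithTop ℕ∞} (hf : ContDiffOn ℝ n f (Ioi 0))
    (hn : n ≠ 0) {t : ℝ} (ht : 0 < t) : HasDerivAt f (deriv f t) t :=
  ((hf.differentiableOn hn).differentiableAt (Ioi_mem_nhds ht)).hasDerivAt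

/-- Taylor's formula at `0⁺`: the repeated integral of the derivative of order `⌈β⌉ ≤ 2`. -/
lemma rl_iteratedDeriv {β : ℝ} (hβ : 0 < β) (hβ2 : β < 2) {f : ℝ → ℝ} {c t : ℝ} (ht : 0 < t)
    (hf : ContDiffOn ℝ (⌈β⌉₊ : ℕ) f (Ioi 0))
    (hi : IntegrableOn (iteratedDeriv ⌈β⌉₊ f) (Ioc 0 t))
    (h0 : Tendsto f (𝓝[>] 0) (𝓝 c)) (h1 : 1 < β → Tendsto (deriv f) (𝓝[>] 0) (𝓝 0)) :
    rl ⌈β⌉₊ (iteratedDeriv ⌈β⌉₊ f) t = f t - c := by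
  rcases ceil_eq_one_or_two hβ hβ2 with ⟨hb, hm⟩ | ⟨hb, hm⟩
  · rw [hm] at hf hi ⊢
    rw [iteratedDeriv_one] at hi ⊢
    simp only [rl, Nat.cast_one, powKernel_one, mul_one]
    refine intervalIntegral.integral_eq_sub_of_hasDerivAt_of_tendsto ht
      (fun x hx => hasDerivAt_of_contDiffOn_Ioi hf (by simp) hx.1)
      ((intervalIntegrable_iff_integrableOn_Ioc_of_le ht.le).2 hi) h0 ?_
    exact (hasDerivAt_of_contDiffOn_Ioi hf (by simp) ht).continuousAt.tendsto.mono_left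
      nhdsWithin_le_nhds
  · rw [hm] at hf hi ⊢
    have hd : ∀ x, 0 < x → HasDerivAt (deriv f) (iteratedDeriv 2 f x) x := by
      intro x hx
      have h2 : ContDiffOn ℝ (1 + 1 : ℕ) f (Ioi 0) := by simpa using hf
      have := (contDiffOn_succ_iff_deriv_of_isOpen (n := 1) isOpen_Ioi).1 (by exact_mod_cast h2)
      rw [iteratedDeriv_succ, iteratedDeriv_one]
      exact hasDerivAt_of_contDiffOn_Ioi this.2.2 (by simp) hx
    have hc : ContinuousOn f (Ioi 0) := hf.continuousOn
    simp only [rl, Nat.cast_ofNat, powKernel_two]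
    have h3 := intervalIntegral.integral_eq_sub_of_hasDerivAt_of_tendsto ht
      (f := fun τ => deriv f τ * (t - τ) + f τ)
      (f' := fun τ => iteratedDeriv 2 f τ * (t - τ)) (fa := c) (fb := f t)
      (fun x hx => ?_) ?_ ?_ ?_
    · exact h3
    · have e := ((hd x hx.1).mul ((hasDerivAt_id x).const_sub t)).add
        (hasDerivAt_of_contDiffOn_Ioi hf (by simp) hx.1)
      refine e.congr_deriv ?_
      simp
    · exact ((intervalIntegrable_iff_integrableOn_Ioc_of_le ht.le).2 hi).mul_continuousOn
        (by fun_prop)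
    · have e : Tendsto (fun τ : ℝ => t - τ) (𝓝[>] 0) (𝓝 (t - 0)) :=
        ((continuous_const.sub continuous_id).tendsto 0).mono_left nhdsWithin_le_nhds
      simpa using ((h1 hb).mul e).add h0
    · have e : Tendsto (fun τ : ℝ => t - τ) (𝓝 t) (𝓝 (t - t)) :=
        (continuous_const.sub continuous_id).tendsto t
      have := ((hd t ht).continuousAt.tendsto.mul e).add (hc.continuousAt (Ioi_mem_nhds ht))
      rw [sub_self, mul_zero, zero_add] at this
      exact this.mono_left nhdsWithin_le_nhds

/-- The Riemann–Liouville integral of order `β` undoes the Caputo derivative. -/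
lemma rl_caputo_eq_sub {β : ℝ} (hβ : 0 < β) (hβ2 : β < 2) {f : ℝ → ℝ} {c t : ℝ} (ht : 0 < t)
    (hf : ContDiffOn ℝ (⌈β⌉₊ : ℕ) f (Ioi 0))
    (hi : IntegrableOn (iteratedDeriv ⌈β⌉₊ f) (Ioc 0 t))
    (h0 : Tendsto f (𝓝[>] 0) (𝓝 c)) (h1 : 1 < β → Tendsto (deriv f) (𝓝[>] 0) (𝓝 0)) :
    rl β (caputo β f) t = f t - c := by
  rw [rl_caputo hβ ht hi, rl_iteratedDeriv hβ hβ2 ht hf hi h0 h1]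

lemma continuousOn_iteratedDeriv_Ioi {f : ℝ → ℝ} {n : ℕ} (hf : ContDiffOn ℝ n f (Ioi 0)) :
    ContinuousOn (iteratedDeriv n f) (Ioi 0) :=
  (hf.continuousOn_iteratedDerivWithin le_rfl (uniqueDiffOn_Ioi 0)).congr fun _ ht =>
    (iteratedDerivWithin_of_isOpen isOpen_Ioi ht).symm

lemma intervalIntegrable_rpow_mul_one_sub_rpow {γ α : ℝ} (hγ : γ < 1) (hα : 0 < α) :
    IntervalIntegrable (fun σ : ℝ => σ ^ (-γ) * (1 - σ) ^ (α - 1)) volume 0 1 := by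
  have h := (Complex.betaIntegral_convergent (u := ((1 - γ : ℝ) : ℂ)) (v := α)
    (by simpa using hγ) (by simpa using hα)).norm
  rw [intervalIntegrable_iff_integrableOn_Ioo_of_le zero_le_one] at h ⊢
  refine h.congr_fun (fun σ hσ => ?_) measurableSet_Ioo
  simp only [norm_mul]
  have e : (1 : ℂ) - σ = ((1 - σ : ℝ) : ℂ) := by push_cast; rfl
  rw [e, Complex.norm_cpow_eq_rpow_re_of_pos hσ.1,
    Complex.norm_cpow_eq_rpow_re_of_pos (sub_pos.2 hσ.2)]
  simp

/-- Continuity of a fractional integral, seen after rescaling the domain of integration to the unit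
interval. -/
lemma continuousOn_rl {α γ : ℝ} (hα : 0 < α) (hα1 : α ≤ 1) (hγ0 : 0 ≤ γ) (hγ : γ < 1) {h : ℝ → ℝ}
    (hc : ContinuousOn h (Ioi 0))
    (hb : ∀ T : ℝ, 0 < T → ∃ C, ∀ τ ∈ Ioc 0 T, |h τ| ≤ C * τ ^ (-γ)) :
    ContinuousOn (rl α h) (Ioi 0) := by
  have e : ∀ t ∈ Ioi (0 : ℝ), rl α h t =
      t * ∫ σ in (0 : ℝ)..1, h (t * σ) * powKernel α (t - t * σ) := by
    intro t ht
    rw [intervalIntegral.integral_comp_mul_left (fun τ => h τ * powKernel α (t - τ)) (ne_of_gt ht),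
      mul_zero, mul_one, smul_eq_mul, mul_inv_cancel_left₀ (ne_of_gt ht)]
    rfl
  refine ContinuousOn.congr (continuousOn_id.mul ?_) e
  intro t ht
  rw [mem_Ioi] at ht
  refine ContinuousAt.continuousWithinAt ?_
  obtain ⟨C, hC⟩ := hb (2 * t) (by linarith)
  have hC0 : 0 ≤ C := by
    have := (abs_nonneg _).trans (hC t ⟨ht, by linarith⟩)
    exact nonneg_of_mul_nonneg_left this (Real.rpow_pos_of_pos ht _)
  have hnear : ∀ᶠ t' in 𝓝 t, t / 2 < t' ∧ t' < 2 * t :=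
    (lt_mem_nhds (by linarith)).and (gt_mem_nhds (by linarith))
  refine intervalIntegral.continuousAt_of_dominated_interval
    (bound := fun σ => (C * (t / 2) ^ (-γ) * ((t / 2) ^ (α - 1) / Real.Gamma α)) *
      (σ ^ (-γ) * (1 - σ) ^ (α - 1))) ?_ ?_ ?_ ?_
  · filter_upwards [hnear] with t' ht'
    rw [uIoc_of_le zero_le_one]
    refine AEStronglyMeasurable.mul ?_ ?_
    · refine ContinuousOn.aestronglyMeasurable ?_ measurableSet_Ioc
      refine hc.comp (by fun_prop) fun σ hσ => ?_
      exact mul_pos (by linarith [ht'.1]) hσ.1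
    · exact ((measurable_powKernel α).comp (by fun_prop)).aestronglyMeasurable
  · filter_upwards [hnear] with t' ht'
    have hne : ∀ᵐ σ : ℝ, σ ≠ 1 := by simp [ae_iff]
    filter_upwards [hne] with σ hσ1 hσ
    rw [uIoc_of_le zero_le_one] at hσ
    have hσ1' : 0 < 1 - σ := sub_pos.2 (lt_of_le_of_ne hσ.2 hσ1)
    have ht0 : 0 < t' := by linarith [ht'.1]
    rw [norm_mul]
    have b1 : ‖h (t' * σ)‖ ≤ C * (t / 2) ^ (-γ) * σ ^ (-γ) := by
      refine (hC _ ⟨mul_pos ht0 hσ.1, ?_⟩).trans ?_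
      · nlinarith [hσ.1, hσ.2, ht'.2]
      · rw [Real.mul_rpow ht0.le hσ.1.le, mul_assoc]
        have : t' ^ (-γ) ≤ (t / 2) ^ (-γ) :=
          Real.rpow_le_rpow_of_nonpos (by linarith) ht'.1.le (by linarith)
        have h2 := Real.rpow_nonneg hσ.1.le (-γ)
        gcongr
    have b2 : ‖powKernel α (t' - t' * σ)‖ ≤ (t / 2) ^ (α - 1) / Real.Gamma α *
        (1 - σ) ^ (α - 1) := by
      have e : t' - t' * σ = t' * (1 - σ) := by ring
      rw [e, Real.norm_eq_abs, abs_of_nonneg (powKernel_nonneg hα (by positivity)), powKernel,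
        Real.mul_rpow ht0.le hσ1'.le, div_mul_eq_mul_div]
      have : t' ^ (α - 1) ≤ (t / 2) ^ (α - 1) :=
        Real.rpow_le_rpow_of_nonpos (by linarith) ht'.1.le (by linarith)
      gcongr
    refine (mul_le_mul b1 b2 (norm_nonneg _) ((norm_nonneg _).trans b1)).trans (le_of_eq ?_)
    ring
  · exact (intervalIntegrable_rpow_mul_one_sub_rpow hγ hα).const_mul _
  · have hne : ∀ᵐ σ : ℝ, σ ≠ 1 := by simp [ae_iff]
    filter_upwards [hne] with σ hσ1 hσ
    rw [uIoc_of_le zero_le_one] at hσ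
    have hσ1' : 0 < 1 - σ := sub_pos.2 (lt_of_le_of_ne hσ.2 hσ1)
    refine ContinuousAt.mul ?_ ?_
    · exact ContinuousAt.comp (f := fun t' => t' * σ)
        (hc.continuousAt (Ioi_mem_nhds (mul_pos ht hσ.1))) (by fun_prop)
    · unfold powKernel
      refine ContinuousAt.div_const (ContinuousAt.rpow_const (by fun_prop) (Or.inl ?_)) _
      have : t - t * σ = t * (1 - σ) := by ring
      rw [this]; positivity

/-- A Caputo derivative can be identified through its Laplace transform. -/
lemma caputo_eq_of_hasLaplace {β γ σ : ℝ} (hγ0 : 0 ≤ γ) (hγ : γ < 1) (hβ : 0 < β)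
    (hσ : 0 < σ) {f ψ : ℝ → ℝ} (hf : ContDiffOn ℝ (⌈β⌉₊ : ℕ) f (Ioi 0))
    (hb : ∀ T : ℝ, 0 < T → ∃ C, ∀ τ ∈ Ioc 0 T, |iteratedDeriv ⌈β⌉₊ f τ| ≤ C * τ ^ (-γ))
    (hψ : ContinuousOn ψ (Ioi 0))
    (hL : ∀ s : ℂ, s.re = σ → ∃ A, HasLaplace (iteratedDeriv ⌈β⌉₊ f) s A ∧
      HasLaplace ψ s (s ^ (-((⌈β⌉₊ : ℂ) - β)) * A)) {t : ℝ} (ht : 0 < t) :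
    caputo β f t = ψ t := by
  have hc := continuousOn_iteratedDeriv_Ioi hf
  by_cases h : β = (⌈β⌉₊ : ℝ)
  · rw [caputo_eq_iteratedDeriv h]
    refine eqOn_of_hasLaplace (σ := σ) hc hψ (fun s hs => ?_) ht
    obtain ⟨A, h1, h2⟩ := hL s hs
    have h3 : ((⌈β⌉₊ : ℂ) - β) = 0 := by
      rw [sub_eq_zero]
      exact_mod_cast h.symm
    refine ⟨A, h1, ?_⟩
    rwa [h3, neg_zero, Complex.cpow_zero, one_mul] at h2
  · have h1 : 0 < ⌈β⌉₊ - β := sub_pos.2 (lt_of_le_of_ne (Nat.le_ceil β) h)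
    have h2 : ⌈β⌉₊ - β ≤ 1 := by linarith [Nat.ceil_lt_add_one hβ.le]
    rw [caputo_eq_rl h f ht]
    refine eqOn_of_hasLaplace (σ := σ) (continuousOn_rl h1 h2 hγ0 hγ hc hb) hψ (fun s hs => ?_) ht
    obtain ⟨A, h3, h4⟩ := hL s hs
    refine ⟨_, hasLaplace_rl h1 (hs ▸ hσ) h3, ?_⟩
    push_cast
    exact h4

/-! ### The kernel as an integral over a Hankel contour -/

/-- The half-opening `π / (1 + ν)` of the contour: beyond `π / 2`, while `ν` times it stays below
`π / 2`. -/
def ang (ν : ℝ) : ℝ := Real.pi / (1 + ν)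

/-- The integrand `p ^ (-μ) e ^ (p t - x p ^ ν) dp` in the logarithmic coordinate `w = log p`,
where it is entire. -/
def ray (ν μ : ℝ) (x : ℂ) (t : ℝ) (w : ℂ) : ℂ :=
  Complex.exp ((1 - μ) * w + t * Complex.exp w - x * Complex.exp (ν * w))

/-- The inverse Laplace transform of `s ^ (-μ) e ^ (-x s ^ ν)`, as an integral over the Hankel
contour `|arg p| = ang ν`, whose two sides are complex conjugate; it is extended by `0` to
`t ≤ 0`. -/
def waveKernel (ν μ x t : ℝ) : ℝ :=
  if 0 < t then 1 / Real.pi * (∫ ρ : ℝ, ray ν μ x t (ρ + ang ν * Complex.I)).im else 0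

section angle
variable {ν : ℝ} (h0 : 0 < ν) (h1 : ν < 1)
include h0 h1

lemma ang_gt : Real.pi / 2 < ang ν := by
  unfold ang; gcongr; linarith

lemma ang_lt : ang ν < Real.pi := by
  unfold ang; rw [div_lt_iff₀ (by linarith)]; nlinarith [Real.pi_pos]

lemma mul_ang_lt : ν * ang ν < Real.pi / 2 := by
  unfold ang; rw [mul_div_assoc', div_lt_div_iff₀ (by linarith) two_pos]; nlinarith [Real.pi_pos]

lemma ang_pos : 0 < ang ν := by linarith [ang_gt h0 h1, Real.pi_pos]

lemma cos_ang_neg : 0 < -Real.cos (ang ν) := by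
  rw [neg_pos]
  exact Real.cos_neg_of_pi_div_two_lt_of_lt (ang_gt h0 h1) (by linarith [ang_lt h0 h1, Real.pi_pos])

lemma cos_mul_ang_pos : 0 < Real.cos (ν * ang ν) :=
  Real.cos_pos_of_mem_Ioo ⟨by linarith [mul_pos h0 (ang_pos h0 h1), Real.pi_pos],
    mul_ang_lt h0 h1⟩

lemma cos_mul_ang_le {y : ℝ} (hy : |y| ≤ ang ν) : Real.cos (ν * ang ν) ≤ Real.cos (ν * y) := by
  rw [← Real.cos_abs (ν * y), abs_mul, abs_of_pos h0]
  refine Real.cos_le_cos_of_nonneg_of_le_pi (by positivity) ?_ ?_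
  · linarith [mul_ang_lt h0 h1, Real.pi_pos]
  · gcongr

end angle

lemma exp_line (ρ y : ℝ) : Complex.exp (ρ + y * Complex.I) =
    Real.exp ρ * (Real.cos y + Real.sin y * Complex.I) := by
  rw [Complex.exp_add, Complex.exp_mul_I]; push_cast; rfl

lemma norm_ray (ν μ x t ρ y : ℝ) : ‖ray ν μ x t (ρ + y * Complex.I)‖ =
    Real.exp ((1 - μ) * ρ + t * Real.cos y * Real.exp ρ -
      x * Real.cos (ν * y) * Real.exp (ν * ρ)) := by
  have e : (ν : ℂ) * (ρ + y * Complex.I) = (ν * ρ : ℝ) + (ν * y : ℝ) * Complex.I := by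
    push_cast; ring
  rw [ray, Complex.norm_exp, e, exp_line, exp_line]
  congr 1
  simp [-Complex.ofReal_exp, -Complex.ofReal_cos, -Complex.ofReal_sin, -Complex.ofReal_mul]
  ring

lemma continuous_ray_line (ν μ t y : ℝ) (x : ℂ) :
    Continuous fun ρ : ℝ => ray ν μ x t (ρ + y * Complex.I) := by
  unfold ray; fun_prop

lemma abs_waveKernel_le_integral {ν μ x t : ℝ} (ht : 0 < t) :
    |waveKernel ν μ x t| ≤ ∫ ρ : ℝ, ‖ray ν μ x t (ρ + ang ν * Complex.I)‖ := by
  rw [waveKernel, if_pos ht, abs_mul, abs_of_pos (by positivity)]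
  have e1 : |(∫ ρ : ℝ, ray ν μ x t (ρ + ang ν * Complex.I)).im| ≤
      ∫ ρ : ℝ, ‖ray ν μ x t (ρ + ang ν * Complex.I)‖ :=
    (Complex.abs_im_le_norm _).trans (norm_integral_le_integral_norm _)
  have e2 : 1 / Real.pi ≤ 1 := by
    rw [div_le_one Real.pi_pos]; linarith [Real.pi_gt_three]
  exact (mul_le_mul e2 e1 (abs_nonneg _) zero_le_one).trans (one_mul _).le

section bounds
variable {ν μ : ℝ} (h0 : 0 < ν) (h1 : ν < 1)
include h0 h1

lemma norm_ray_le_time {x t t' : ℝ} (hx : 0 ≤ x) (ht : t ≤ t') (ρ : ℝ) :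
    ‖ray ν μ x t' (ρ + ang ν * Complex.I)‖ ≤
      Real.exp ((1 - μ) * ρ - -Real.cos (ang ν) * t * Real.exp (1 * ρ)) := by
  rw [norm_ray]
  refine Real.exp_le_exp.2 ?_
  have e1 := cos_ang_neg h0 h1
  have e2 := mul_nonneg (mul_nonneg hx (cos_mul_ang_pos h0 h1).le) (Real.exp_pos (ν * ρ)).le
  have e3 := mul_le_mul_of_nonneg_left (mul_le_mul_of_nonneg_right ht (Real.exp_pos ρ).le) e1.le
  rw [one_mul]
  linarith

lemma norm_ray_le_space {x x' t : ℝ} (hx : x ≤ x') (ht : 0 ≤ t) (ρ : ℝ) :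
    ‖ray ν μ x' t (ρ + ang ν * Complex.I)‖ ≤
      Real.exp ((1 - μ) * ρ - Real.cos (ν * ang ν) * x * Real.exp (ν * ρ)) := by
  rw [norm_ray]
  refine Real.exp_le_exp.2 ?_
  have e1 := cos_mul_ang_pos h0 h1
  have e2 := mul_nonneg (mul_nonneg ht (cos_ang_neg h0 h1).le) (Real.exp_pos ρ).le
  have e3 := mul_le_mul_of_nonneg_left (mul_le_mul_of_nonneg_right hx (Real.exp_pos (ν * ρ)).le)
    e1.le
  linarith

variable (hμ : μ < 1)
include hμ

lemma integrable_time_bound {t : ℝ} (ht : 0 < t) : Integrable fun ρ : ℝ =>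
    Real.exp ((1 - μ) * ρ - -Real.cos (ang ν) * t * Real.exp (1 * ρ)) :=
  integrable_exp_sub_exp (by linarith) (mul_pos (cos_ang_neg h0 h1) ht) one_pos

lemma integrable_space_bound {x : ℝ} (hx : 0 < x) : Integrable fun ρ : ℝ =>
    Real.exp ((1 - μ) * ρ - Real.cos (ν * ang ν) * x * Real.exp (ν * ρ)) :=
  integrable_exp_sub_exp (by linarith) (mul_pos (cos_mul_ang_pos h0 h1) hx) h0

lemma integrable_ray {x t : ℝ} (hx : 0 ≤ x) (ht : 0 < t) :
    Integrable fun ρ : ℝ => ray ν μ x t (ρ + ang ν * Complex.I) :=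
  (integrable_time_bound h0 h1 hμ ht).mono' (continuous_ray_line _ _ _ _ _).aestronglyMeasurable
    (ae_of_all _ fun ρ => norm_ray_le_time h0 h1 hx le_rfl ρ)

lemma exists_abs_waveKernel_le_time : ∃ C : ℝ, 0 ≤ C ∧ ∀ x t : ℝ, 0 ≤ x → 0 < t →
    |waveKernel ν μ x t| ≤ C * t ^ (μ - 1) := by
  refine ⟨(-Real.cos (ang ν)) ^ (-(1 - μ) / 1) *
    ∫ ρ : ℝ, Real.exp ((1 - μ) * ρ - Real.exp (1 * ρ)), ?_, fun x t hx ht => ?_⟩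
  · have := cos_ang_neg h0 h1
    exact mul_nonneg (Real.rpow_nonneg this.le _) (integral_nonneg fun ρ => (Real.exp_pos _).le)
  · refine (abs_waveKernel_le_integral ht).trans ?_
    refine (integral_mono (integrable_ray h0 h1 hμ hx ht).norm
      (integrable_time_bound h0 h1 hμ ht) (norm_ray_le_time h0 h1 hx le_rfl)).trans ?_
    rw [integral_exp_sub_exp_scale _ _ (mul_pos (cos_ang_neg h0 h1) ht) one_pos,
      Real.mul_rpow (cos_ang_neg h0 h1).le ht.le]
    refine le_of_eq ?_
    rw [show -(1 - μ) / 1 = μ - 1 by ring]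
    ring

lemma exists_abs_waveKernel_le_space_zero : ∃ C : ℝ, 0 ≤ C ∧ ∀ x t : ℝ, 0 < x → 0 < t →
    |waveKernel ν μ x t| ≤ C * x ^ (-(1 - μ) / ν) := by
  refine ⟨Real.cos (ν * ang ν) ^ (-(1 - μ) / ν) *
    ∫ ρ : ℝ, Real.exp ((1 - μ) * ρ - Real.exp (ν * ρ)), ?_, fun x t hx ht => ?_⟩
  · have := cos_mul_ang_pos h0 h1
    exact mul_nonneg (Real.rpow_nonneg this.le _) (integral_nonneg fun ρ => (Real.exp_pos _).le)
  · refine (abs_waveKernel_le_integral ht).trans ?_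
    refine (integral_mono (integrable_ray h0 h1 hμ hx.le ht).norm
      (integrable_space_bound h0 h1 hμ hx) (norm_ray_le_space h0 h1 le_rfl ht.le)).trans ?_
    rw [integral_exp_sub_exp_scale _ _ (mul_pos (cos_mul_ang_pos h0 h1) hx) h0,
      Real.mul_rpow (cos_mul_ang_pos h0 h1).le hx.le]
    refine le_of_eq ?_
    ring

/-- For `x > 0` the contour integral at `t = 0` is real: by Cauchy's theorem it agrees with its
complex conjugate. -/
lemma im_integral_ray_zero {x : ℝ} (hx : 0 < x) :
    (∫ ρ : ℝ, ray ν μ x 0 (ρ + ang ν * Complex.I)).im = 0 := by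
  have hconj : ∀ ρ : ℝ, ray ν μ x 0 (ρ + (-ang ν : ℝ) * Complex.I) =
      (starRingEnd ℂ) (ray ν μ x 0 (ρ + ang ν * Complex.I)) := by
    intro ρ
    simp [ray, ← Complex.exp_conj]
  have h := integral_line_eq (f := ray ν μ x 0) (y₁ := -ang ν) (y₂ := ang ν)
    (B := fun ρ => Real.exp ((1 - μ) * ρ - Real.cos (ν * ang ν) * x * Real.exp (ν * ρ)))
    (by unfold ray; fun_prop) ?_ (integrable_space_bound h0 h1 hμ hx)
    (tendsto_exp_sub_exp_atTop _ (mul_pos (cos_mul_ang_pos h0 h1) hx) h0)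
    (tendsto_exp_sub_exp_atBot _ (by linarith) (mul_pos (cos_mul_ang_pos h0 h1) hx).le)
  · simp_rw [hconj] at h
    rw [integral_conj] at h
    exact Complex.conj_eq_iff_im.1 h
  · intro ρ y hy
    rw [uIcc_of_le (by linarith [ang_pos h0 h1])] at hy
    have := cos_mul_ang_le h0 h1 (abs_le.2 hy)
    have e := norm_ray ν μ x 0 ρ y
    rw [e]
    refine Real.exp_le_exp.2 ?_
    have := mul_le_mul_of_nonneg_right this (mul_pos hx (Real.exp_pos (ν * ρ))).le
    linarith

lemma tendsto_waveKernel_zero {x : ℝ} (hx : 0 < x) :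
    Tendsto (waveKernel ν μ x) (𝓝[>] 0) (𝓝 0) := by
  have h : Tendsto (fun t : ℝ => ∫ ρ : ℝ, ray ν μ x t (ρ + ang ν * Complex.I)) (𝓝[>] 0)
      (𝓝 (∫ ρ : ℝ, ray ν μ x 0 (ρ + ang ν * Complex.I))) := by
    refine tendsto_integral_filter_of_dominated_convergence
      (fun ρ => Real.exp ((1 - μ) * ρ - Real.cos (ν * ang ν) * x * Real.exp (ν * ρ)))
      (Eventually.of_forall fun t => (continuous_ray_line _ _ _ _ _).aestronglyMeasurable) ?_
      (integrable_space_bound h0 h1 hμ hx) (ae_of_all _ fun ρ => ?_)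
    · filter_upwards [self_mem_nhdsWithin] with t ht
      exact ae_of_all _ fun ρ => norm_ray_le_space h0 h1 le_rfl (le_of_lt ht) ρ
    · refine Tendsto.mono_left (Continuous.tendsto ?_ 0) nhdsWithin_le_nhds
      unfold ray; fun_prop
  have h2 := ((Complex.continuous_im.tendsto _).comp h).const_mul (1 / Real.pi)
  rw [im_integral_ray_zero h0 h1 hμ hx, mul_zero] at h2
  refine h2.congr' ?_
  filter_upwards [self_mem_nhdsWithin] with t ht
  rw [waveKernel, if_pos (mem_Ioi.1 ht)]
  rfl

lemma hasDerivAt_waveKernel_time_of_pos {x t : ℝ} (hx : 0 ≤ x) (ht : 0 < t) :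
    HasDerivAt (waveKernel ν μ x) (waveKernel ν (μ - 1) x t) t := by
  have hder : ∀ (t' ρ : ℝ), HasDerivAt (fun t' : ℝ => ray ν μ x t' (ρ + ang ν * Complex.I))
      (ray ν (μ - 1) x t' (ρ + ang ν * Complex.I)) t' := by
    intro t' ρ
    unfold ray
    have h2 := (((Complex.ofRealCLM.hasDerivAt (x := t')).mul_const
      (Complex.exp (ρ + ang ν * Complex.I))).const_add
      ((1 - μ) * (ρ + ang ν * Complex.I))).sub_const
      (x * Complex.exp (ν * (ρ + ang ν * Complex.I)))
    refine h2.cexp.congr_deriv ?_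
    simp only [Complex.ofRealCLM_apply, Complex.ofReal_one, one_mul]
    rw [← Complex.exp_add]
    congr 1
    push_cast
    ring
  have h := (hasDerivAt_integral_of_dominated_loc_of_deriv_le (μ := volume)
    (F := fun (t' : ℝ) (ρ : ℝ) => ray ν μ x t' (ρ + ang ν * Complex.I))
    (F' := fun (t' : ℝ) (ρ : ℝ) => ray ν (μ - 1) x t' (ρ + ang ν * Complex.I)) (x₀ := t)
    (s := Ioi (t / 2))
    (bound := fun ρ =>
      Real.exp ((1 - (μ - 1)) * ρ - -Real.cos (ang ν) * (t / 2) * Real.exp (1 * ρ)))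
    (Ioi_mem_nhds (by linarith))
    (Eventually.of_forall fun t => (continuous_ray_line _ _ _ _ _).aestronglyMeasurable)
    (integrable_ray h0 h1 hμ hx ht) (continuous_ray_line _ _ _ _ _).aestronglyMeasurable
    (ae_of_all _ fun ρ t' ht' => norm_ray_le_time h0 h1 hx (le_of_lt ht') ρ)
    (integrable_time_bound h0 h1 (by linarith) (by linarith))
    (ae_of_all _ fun ρ t' _ => hder t' ρ)).2
  have h2 := ((Complex.imCLM.hasFDerivAt.comp_hasDerivAt t h)).const_mul (1 / Real.pi)
  rw [waveKernel, if_pos ht]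
  refine h2.congr_of_eventuallyEq ?_
  filter_upwards [Ioi_mem_nhds ht] with t' ht'
  rw [waveKernel, if_pos (mem_Ioi.1 ht')]
  rfl

lemma hasDerivAt_waveKernel_space {x : ℝ} (t : ℝ) (hx : 0 < x) :
    HasDerivAt (fun x => waveKernel ν μ x t) (-waveKernel ν (μ - ν) x t) x := by
  rcases le_or_gt t 0 with ht | ht
  · simp only [waveKernel, if_neg ht.not_gt, neg_zero]
    exact hasDerivAt_const _ _
  have hder : ∀ (x' ρ : ℝ), HasDerivAt (fun x' : ℝ => ray ν μ x' t (ρ + ang ν * Complex.I))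
      (-ray ν (μ - ν) x' t (ρ + ang ν * Complex.I)) x' := by
    intro x' ρ
    unfold ray
    have h2 := ((Complex.ofRealCLM.hasDerivAt (x := x')).mul_const
      (Complex.exp (ν * (ρ + ang ν * Complex.I)))).const_sub
      ((1 - μ) * (ρ + ang ν * Complex.I) + t * Complex.exp (ρ + ang ν * Complex.I))
    refine h2.cexp.congr_deriv ?_
    simp only [Complex.ofRealCLM_apply, Complex.ofReal_one, one_mul]
    rw [mul_neg, ← Complex.exp_add]
    congr 2
    push_cast
    ring
  have h := (hasDerivAt_integral_of_dominated_loc_of_deriv_le (μ := volume)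
    (F := fun (x' : ℝ) (ρ : ℝ) => ray ν μ x' t (ρ + ang ν * Complex.I))
    (F' := fun (x' : ℝ) (ρ : ℝ) => -ray ν (μ - ν) x' t (ρ + ang ν * Complex.I)) (x₀ := x)
    (s := Ioi 0)
    (bound := fun ρ => Real.exp ((1 - (μ - ν)) * ρ - -Real.cos (ang ν) * t * Real.exp (1 * ρ)))
    (Ioi_mem_nhds hx)
    (Eventually.of_forall fun t => (continuous_ray_line _ _ _ _ _).aestronglyMeasurable)
    (integrable_ray h0 h1 hμ hx.le ht) (continuous_ray_line _ _ _ _ _).neg.aestronglyMeasurable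
    (ae_of_all _ fun ρ x' hx' => by
      rw [norm_neg]; exact norm_ray_le_time h0 h1 (le_of_lt hx') le_rfl ρ)
    (integrable_time_bound h0 h1 (by linarith) ht)
    (ae_of_all _ fun ρ x' _ => hder x' ρ)).2
  have h2 := ((Complex.imCLM.hasFDerivAt.comp_hasDerivAt x h)).const_mul (1 / Real.pi)
  simp only [waveKernel, if_pos ht]
  refine h2.congr_deriv ?_
  simp [integral_neg]

/-- Repeated integration from the vanishing limit at `t = 0⁺` turns the bound in `x` into bounds
with any power of `t`. -/
lemma exists_abs_waveKernel_le (N : ℕ) : ∃ C : ℝ, 0 ≤ C ∧ ∀ x t : ℝ, 0 < x → 0 < t →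
    |waveKernel ν μ x t| ≤ C * t ^ N * x ^ (-(N + 1 - μ) / ν) := by
  induction N generalizing μ with
  | zero =>
    obtain ⟨C, hC, h⟩ := exists_abs_waveKernel_le_space_zero h0 h1 hμ
    exact ⟨C, hC, fun x t hx ht => by simpa using h x t hx ht⟩
  | succ N ih =>
    obtain ⟨C, hC, h⟩ := ih (μ := μ - 1) (by linarith)
    refine ⟨C, hC, fun x t hx ht => ?_⟩
    set P := x ^ (-((N + 1 : ℕ) + 1 - μ) / ν) with hP
    have hd : ∀ τ ∈ Ioc 0 t, |waveKernel ν (μ - 1) x τ| ≤ C * t ^ N * P := by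
      intro τ hτ
      refine (h x τ hx hτ.1).trans ?_
      have e : x ^ (-((N : ℝ) + 1 - (μ - 1)) / ν) = P := by
        rw [hP]; congr 2; push_cast; ring
      rw [e]
      have := pow_le_pow_left₀ hτ.1.le hτ.2 N
      gcongr
    have hε : ∀ᶠ ε in 𝓝[>] (0 : ℝ), |waveKernel ν μ x t - waveKernel ν μ x ε| ≤
        C * t ^ N * P * (t - ε) := by
      filter_upwards [Ioo_mem_nhdsGT ht] with ε hε
      have := Convex.norm_image_sub_le_of_norm_hasDerivWithin_le (s := Icc ε t)
        (f := waveKernel ν μ x) (f' := waveKernel ν (μ - 1) x) (C := C * t ^ N * P)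
        (x := ε) (y := t)
        (fun τ hτ => (hasDerivAt_waveKernel_time_of_pos h0 h1 hμ hx.le
          (hε.1.trans_le hτ.1)).hasDerivWithinAt)
        (fun τ hτ => hd τ ⟨hε.1.trans_le hτ.1, hτ.2⟩) (convex_Icc _ _)
        (left_mem_Icc.2 hε.2.le) (right_mem_Icc.2 hε.2.le)
      rwa [Real.norm_eq_abs, Real.norm_eq_abs, abs_of_nonneg (sub_nonneg.2 hε.2.le)] at this
    have hl1 : Tendsto (fun ε => |waveKernel ν μ x t - waveKernel ν μ x ε|) (𝓝[>] 0)
        (𝓝 |waveKernel ν μ x t - 0|) :=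
      (tendsto_const_nhds.sub (tendsto_waveKernel_zero h0 h1 hμ hx)).abs
    have hl2 : Tendsto (fun ε : ℝ => C * t ^ N * P * (t - ε)) (𝓝[>] 0)
        (𝓝 (C * t ^ N * P * (t - 0))) :=
      (Continuous.tendsto (by fun_prop) 0).mono_left nhdsWithin_le_nhds
    have := le_of_tendsto_of_tendsto hl1 hl2 hε
    rw [sub_zero, sub_zero] at this
    refine this.trans (le_of_eq ?_)
    rw [pow_succ]
    ring

lemma hasDerivAt_waveKernel_time {x : ℝ} (t : ℝ) (hx : 0 < x) :
    HasDerivAt (waveKernel ν μ x) (waveKernel ν (μ - 1) x t) t := by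
  rcases lt_trichotomy t 0 with ht | rfl | ht
  · rw [waveKernel, if_neg ht.not_gt]
    refine (hasDerivAt_const t (0 : ℝ)).congr_of_eventuallyEq ?_
    filter_upwards [Iio_mem_nhds ht] with t' ht'
    rw [waveKernel, if_neg (not_lt.2 (le_of_lt ht'))]
  · obtain ⟨C, hC, h⟩ := exists_abs_waveKernel_le h0 h1 hμ 2
    have hz : ∀ μ, waveKernel ν μ x 0 = 0 := fun μ => by simp [waveKernel]
    rw [hz]
    set P := x ^ (-((2 : ℕ) + 1 - μ) / ν) with hP
    have hb : ∀ t : ℝ, |waveKernel ν μ x t| ≤ C * P * t ^ 2 := by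
      intro t
      rcases le_or_gt t 0 with ht | ht
      · rw [waveKernel, if_neg ht.not_gt, abs_zero]; positivity
      · refine (h x t hx ht).trans (le_of_eq (by ring))
    rw [hasDerivAt_iff_isLittleO_nhds_zero]
    simp only [zero_add, hz, sub_zero, smul_zero]
    have h2 : (fun t : ℝ => t ^ 2) =o[𝓝 0] fun t : ℝ => t := by
      simpa using Asymptotics.isLittleO_pow_pow (𝕜 := ℝ) (m := 1) (n := 2) one_lt_two
    refine Asymptotics.IsBigO.trans_isLittleO ?_ h2
    refine Asymptotics.IsBigO.of_bound (C * P) (Eventually.of_forall fun t => ?_)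
    rw [Real.norm_eq_abs, Real.norm_eq_abs, abs_of_nonneg (sq_nonneg t)]
    exact hb t
  · exact hasDerivAt_waveKernel_time_of_pos h0 h1 hμ hx.le ht

lemma continuousOn_waveKernel :
    ContinuousOn (fun p : ℝ × ℝ => waveKernel ν μ p.1 p.2) (Ici 0 ×ˢ Ioi 0) := by
  rintro ⟨x, t⟩ ⟨hx, ht⟩
  simp only [mem_Ici, mem_Ioi] at hx ht
  have hev : ∀ᶠ p : ℝ × ℝ in 𝓝[Ici 0 ×ˢ Ioi 0] (x, t), 0 ≤ p.1 ∧ t / 2 < p.2 := by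
    have e1 : ∀ᶠ p : ℝ × ℝ in 𝓝[Ici 0 ×ˢ Ioi 0] (x, t), t / 2 < p.2 :=
      (continuous_snd.tendsto (x, t)).mono_left nhdsWithin_le_nhds
        |>.eventually (lt_mem_nhds (by simp only; linarith))
    filter_upwards [e1, self_mem_nhdsWithin] with p hp hp'
    exact ⟨hp'.1, hp⟩
  have h : Tendsto (fun p : ℝ × ℝ => ∫ ρ : ℝ, ray ν μ p.1 p.2 (ρ + ang ν * Complex.I))
      (𝓝[Ici 0 ×ˢ Ioi 0] (x, t)) (𝓝 (∫ ρ : ℝ, ray ν μ x t (ρ + ang ν * Complex.I))) := by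
    refine tendsto_integral_filter_of_dominated_convergence
      (fun ρ => Real.exp ((1 - μ) * ρ - -Real.cos (ang ν) * (t / 2) * Real.exp (1 * ρ)))
      (Eventually.of_forall fun t => (continuous_ray_line _ _ _ _ _).aestronglyMeasurable) ?_
      (integrable_time_bound h0 h1 hμ (by linarith)) (ae_of_all _ fun ρ => ?_)
    · filter_upwards [hev] with p hp
      exact ae_of_all _ fun ρ => norm_ray_le_time h0 h1 hp.1 hp.2.le ρ
    · refine Tendsto.mono_left (Continuous.tendsto ?_ (x, t)) nhdsWithin_le_nhds
      unfold ray; fun_prop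
  have h2 := ((Complex.continuous_im.tendsto _).comp h).const_mul (1 / Real.pi)
  show Tendsto _ _ (𝓝 (waveKernel ν μ x t))
  rw [waveKernel, if_pos ht]
  refine h2.congr' ?_
  filter_upwards [hev] with p hp
  rw [waveKernel, if_pos (by linarith [hp.2])]
  rfl

/-- Away from `x = 0` the kernel, extended by `0` to `t ≤ 0`, is jointly continuous. -/
lemma continuousOn_waveKernel_extend :
    ContinuousOn (fun p : ℝ × ℝ => waveKernel ν μ p.1 p.2) (Ioi 0 ×ˢ univ) := by
  rintro ⟨x, t⟩ ⟨hx, -⟩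
  simp only [mem_Ioi] at hx
  refine ContinuousAt.continuousWithinAt ?_
  rcases lt_or_ge 0 t with ht | ht
  · exact (continuousOn_waveKernel h0 h1 hμ).continuousAt
      (prod_mem_nhds (Ici_mem_nhds hx) (Ioi_mem_nhds ht))
  · obtain ⟨C, hC, h⟩ := exists_abs_waveKernel_le h0 h1 hμ 1
    have hb : ∀ p : ℝ × ℝ, 0 < p.1 → |waveKernel ν μ p.1 p.2| ≤
        C * max p.2 0 * p.1 ^ (-((1 : ℕ) + 1 - μ) / ν) := by
      intro p hp
      rcases le_or_gt p.2 0 with hp2 | hp2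
      · rw [waveKernel, if_neg hp2.not_gt, abs_zero]
        have := Real.rpow_nonneg hp.le (-((1 : ℕ) + 1 - μ) / ν)
        positivity
      · have := h p.1 p.2 hp hp2
        rw [pow_one] at this
        rwa [max_eq_left hp2.le]

    have hz : waveKernel ν μ x t = 0 := by rw [waveKernel, if_neg ht.not_gt]
    show Tendsto _ _ (𝓝 (waveKernel ν μ x t))
    rw [hz]
    have hlim : ContinuousAt (fun p : ℝ × ℝ => C * max p.2 0 *
        p.1 ^ (-((1 : ℕ) + 1 - μ) / ν)) (x, t) := by
      refine ContinuousAt.mul (by fun_prop) ?_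
      exact continuousAt_fst.rpow_const (Or.inl hx.ne')
    have hlim' := hlim.tendsto
    simp only [max_eq_right ht, mul_zero, zero_mul] at hlim'
    refine squeeze_zero_norm' ?_ hlim'
    have : ∀ᶠ p : ℝ × ℝ in 𝓝 (x, t), 0 < p.1 :=
      (continuous_fst.tendsto (x, t)).eventually (lt_mem_nhds hx)
    filter_upwards [this] with p hp
    simpa using hb p hp

end bounds

/-! ### Series expansion of the kernel -/

lemma hasSum_cexp (z : ℂ) : HasSum (fun n : ℕ => z ^ n / (n.factorial : ℂ)) (Complex.exp z) := by
  rw [Complex.exp_eq_exp_ℂ]; exact NormedSpace.expSeries_div_hasSum_exp z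

lemma hasSum_rexp (z : ℝ) : HasSum (fun n : ℕ => z ^ n / (n.factorial : ℝ)) (Real.exp z) := by
  rw [Real.exp_eq_exp_ℝ]; exact NormedSpace.expSeries_div_hasSum_exp z

/-- As `ν < 1`, the growth of `r ^ ν` is dominated by any multiple of `r`. -/
lemma exists_mul_rpow_le {ν : ℝ} (h0 : 0 < ν) (h1 : ν < 1) {a ε : ℝ} (ha : 0 ≤ a) (hε : 0 < ε) :
    ∃ K : ℝ, ∀ ρ : ℝ, a * Real.exp (ν * ρ) ≤ ε * Real.exp ρ + K := by
  have h1' : 0 < 1 - ν := by linarith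
  set K := (a * ε ^ (-ν)) ^ (1 - ν)⁻¹ with hK
  have hb : 0 ≤ a * ε ^ (-ν) := mul_nonneg ha (Real.rpow_nonneg hε.le _)
  have hK0 : 0 ≤ K := Real.rpow_nonneg hb _
  refine ⟨K, fun ρ => ?_⟩
  have h := Real.geom_mean_le_arith_mean2_weighted h0.le h1'.le
    (mul_nonneg hε.le (Real.exp_pos ρ).le) hK0 (by ring)
  rw [hK, ← Real.rpow_mul hb, inv_mul_cancel₀ h1'.ne', Real.rpow_one, ← hK,
    Real.mul_rpow hε.le (Real.exp_pos ρ).le, ← Real.exp_mul] at h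
  have e : ε ^ ν * Real.exp (ρ * ν) * (a * ε ^ (-ν)) = a * Real.exp (ν * ρ) := by
    rw [Real.rpow_neg hε.le, mul_comm ρ ν]
    have := (Real.rpow_pos_of_pos hε ν).ne'
    field_simp
  rw [e] at h
  have := mul_pos hε (Real.exp_pos ρ)
  nlinarith

section series
variable {ν : ℝ} (h0 : 0 < ν) (h1 : ν < 1)
include h0 h1

/-- Hankel's formula for the reciprocal Gamma function. -/
lemma integral_ray_zero_space {b t : ℝ} (hb : 0 < b) (ht : 0 < t) :
    ∫ ρ : ℝ, Complex.exp (b * (ρ + ang ν * Complex.I) +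
      t * Complex.exp (ρ + ang ν * Complex.I)) =
      Complex.exp ((Real.pi * b : ℝ) * Complex.I) * ((t ^ (-b) * Real.Gamma b : ℝ) : ℂ) := by
  set w₀ : ℂ := (Real.log t : ℝ) + (ang ν - Real.pi : ℝ) * Complex.I with hw
  have him : w₀.im = ang ν - Real.pi := by
    simp only [hw, Complex.add_im, Complex.ofReal_im, Complex.mul_im, Complex.ofReal_re,
      Complex.I_im, Complex.I_re]
    ring
  have h := integral_exp_sub_exp_line hb (w₀ := w₀) (by
    rw [him, abs_lt]
    constructor <;> linarith [ang_gt h0 h1, ang_lt h0 h1, Real.pi_pos])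
  have e : ∀ ρ : ℝ, Complex.exp (b * (ρ + ang ν * Complex.I) +
      t * Complex.exp (ρ + ang ν * Complex.I)) =
      Complex.exp ((Real.pi * b : ℝ) * Complex.I) * ((t ^ (-b) : ℝ) : ℂ) *
      Complex.exp (b * (ρ + w₀) - Complex.exp (ρ + w₀)) := by
    intro ρ
    have e1 : Complex.exp (ρ + w₀) = -(t * Complex.exp (ρ + ang ν * Complex.I)) := by
      have : (ρ : ℂ) + w₀ = (Real.log t : ℝ) + (ρ + ang ν * Complex.I) - Real.pi * Complex.I := by
        rw [hw]; push_cast; ring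
      rw [this, Complex.exp_sub, Complex.exp_pi_mul_I, Complex.exp_add, ← Complex.ofReal_exp,
        Real.exp_log ht]
      ring
    rw [e1, Real.rpow_def_of_pos ht, Complex.ofReal_exp, ← Complex.exp_add, ← Complex.exp_add, hw]
    congr 1
    push_cast
    ring
  simp_rw [e]
  rw [integral_const_mul, h, Complex.Gamma_ofReal]
  push_cast
  ring

lemma hasSum_integral_ray {μ : ℝ} (hμ : μ < 1) (z : ℂ) {t : ℝ} (ht : 0 < t) :
    HasSum (fun n : ℕ => (-z) ^ n / (n.factorial : ℂ) *
      (Complex.exp ((Real.pi * (ν * n + 1 - μ) : ℝ) * Complex.I) *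
        ((t ^ (-(ν * n + 1 - μ)) * Real.Gamma (ν * n + 1 - μ) : ℝ) : ℂ)))
      (∫ ρ : ℝ, ray ν μ z t (ρ + ang ν * Complex.I)) := by
  have hb : ∀ n : ℕ, 0 < ν * n + 1 - μ := fun n => by
    have := mul_nonneg h0.le (Nat.cast_nonneg (α := ℝ) n)
    linarith
  set c := -Real.cos (ang ν) with hc
  have hc0 : 0 < c := cos_ang_neg h0 h1
  have key := hasSum_integral_of_dominated_convergence (μ := (volume : Measure ℝ))
    (F := fun (n : ℕ) (ρ : ℝ) => (-z) ^ n / (n.factorial : ℂ) *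
      Complex.exp ((ν * n + 1 - μ : ℝ) * (ρ + ang ν * Complex.I) +
      t * Complex.exp (ρ + ang ν * Complex.I)))
    (f := fun ρ : ℝ => ray ν μ z t (ρ + ang ν * Complex.I))
    (bound := fun n ρ => (‖z‖ * Real.exp (ν * ρ)) ^ n / (n.factorial : ℝ) *
      Real.exp ((1 - μ) * ρ - c * t * Real.exp ρ))
    (fun n => Continuous.aestronglyMeasurable (by fun_prop)) ?_ ?_ ?_ ?_
  · simp only [integral_const_mul, integral_ray_zero_space h0 h1 (hb _) ht] at key
    exact key
  · refine fun n => ae_of_all _ fun ρ => le_of_eq ?_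
    have e := norm_ray ν (1 - (ν * n + 1 - μ)) 0 t ρ (ang ν)
    rw [ray] at e
    rw [norm_mul, norm_div, norm_pow, norm_neg, Complex.norm_natCast]
    have e2 : ((ν * n + 1 - μ : ℝ) : ℂ) * (ρ + ang ν * Complex.I) +
      t * Complex.exp (ρ + ang ν * Complex.I) =
      (1 - ((1 - (ν * n + 1 - μ) : ℝ) : ℂ)) * (ρ + ang ν * Complex.I) +
      t * Complex.exp (ρ + ang ν * Complex.I) - (0 : ℝ) *
        Complex.exp (ν * (ρ + ang ν * Complex.I)) := by
      push_cast; ring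
    rw [e2, e, mul_pow, ← Real.exp_nat_mul, mul_div_right_comm, mul_assoc (_ / _),
      ← Real.exp_add, hc]
    congr 2
    ring
  · refine ae_of_all _ fun ρ => ((hasSum_rexp _).mul_right _).summable
  · simp_rw [fun ρ : ℝ => ((hasSum_rexp (‖z‖ * Real.exp (ν * ρ))).mul_right
      (Real.exp ((1 - μ) * ρ - c * t * Real.exp ρ))).tsum_eq]
    obtain ⟨K, hK⟩ := exists_mul_rpow_le h0 h1 (norm_nonneg z)
      (show 0 < c * t / 2 by positivity)
    refine ((integrable_exp_sub_exp (a := 1 - μ) (b := c * t / 2) (κ := 1) (by linarith)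
      (by positivity) one_pos).const_mul (Real.exp K)).mono'
      (Continuous.aestronglyMeasurable (by fun_prop)) (ae_of_all _ fun ρ => ?_)
    rw [Real.norm_eq_abs, abs_of_pos (by positivity), ← Real.exp_add, ← Real.exp_add]
    refine Real.exp_le_exp.2 ?_
    rw [one_mul]
    linarith [hK ρ]
  · refine ae_of_all _ fun ρ => ?_
    have := (hasSum_cexp (-z * Complex.exp (ν * (ρ + ang ν * Complex.I)))).mul_right
      (Complex.exp ((1 - μ) * (ρ + ang ν * Complex.I) + t * Complex.exp (ρ + ang ν * Complex.I)))
    have e1 : ∀ n : ℕ, (-z) ^ n / (n.factorial : ℂ) *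
        Complex.exp ((ν * n + 1 - μ : ℝ) * (ρ + ang ν * Complex.I) +
          t * Complex.exp (ρ + ang ν * Complex.I)) =
        (-z * Complex.exp (ν * (ρ + ang ν * Complex.I))) ^ n / (n.factorial : ℂ) *
        Complex.exp ((1 - μ) * (ρ + ang ν * Complex.I) +
          t * Complex.exp (ρ + ang ν * Complex.I)) := by
      intro n
      rw [mul_pow, ← Complex.exp_nat_mul, mul_div_right_comm, mul_assoc (_ / _),
        ← Complex.exp_add]
      congr 2
      push_cast
      ring
    have e2 : ray ν μ z t (ρ + ang ν * Complex.I) =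
        Complex.exp (-z * Complex.exp (ν * (ρ + ang ν * Complex.I))) *
        Complex.exp ((1 - μ) * (ρ + ang ν * Complex.I) +
          t * Complex.exp (ρ + ang ν * Complex.I)) := by
      rw [ray, ← Complex.exp_add]
      congr 1
      ring
    simp only [e1, e2]
    exact this

omit h1 in
/-- The reflection formula, in the form that holds at the poles as well. -/
lemma inv_Gamma_eq {μ : ℝ} (hμ : μ < 1) (n : ℕ) :
    (Complex.Gamma (((-ν : ℝ) : ℂ) * n + μ))⁻¹ =
      ((Real.sin (Real.pi * (ν * n + 1 - μ)) * Real.Gamma (ν * n + 1 - μ) / Real.pi : ℝ) : ℂ) := by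
  have hb : 0 < ν * n + 1 - μ := by
    have := mul_nonneg h0.le (Nat.cast_nonneg (α := ℝ) n)
    linarith
  have h := congrArg (·⁻¹) (Complex.Gamma_mul_Gamma_one_sub ((ν * n + 1 - μ : ℝ) : ℂ))
  have e : (1 : ℂ) - ((ν * n + 1 - μ : ℝ) : ℂ) = ((-ν : ℝ) : ℂ) * n + μ := by push_cast; ring
  simp only [e, mul_inv, inv_div] at h
  have hΓ : Complex.Gamma ((ν * n + 1 - μ : ℝ) : ℂ) ≠ 0 := by
    rw [Complex.Gamma_ofReal]; exact_mod_cast (Real.Gamma_pos_of_pos hb).ne'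
  rw [inv_mul_eq_iff_eq_mul₀ hΓ] at h
  rw [h, Complex.Gamma_ofReal]
  push_cast
  ring

lemma summable_wright {μ : ℝ} (hμ : μ < 1) (z : ℂ) : Summable fun n : ℕ =>
    (-z) ^ n / ((n.factorial : ℂ) * Complex.Gamma (((-ν : ℝ) : ℂ) * n + μ)) := by
  have h := (hasSum_integral_ray h0 h1 hμ z one_pos).summable.norm
  refine Summable.of_norm_bounded h fun n => ?_
  have hb : 0 < ν * n + 1 - μ := by
    have := mul_nonneg h0.le (Nat.cast_nonneg (α := ℝ) n)
    linarith
  have hΓ := Real.Gamma_pos_of_pos hb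
  rw [div_mul_eq_div_div, div_eq_mul_inv _ (Complex.Gamma _), inv_Gamma_eq h0 hμ, norm_mul,
    norm_mul, norm_mul, Complex.norm_exp_ofReal_mul_I, one_mul, Real.one_rpow, one_mul,
    Complex.norm_real, Complex.norm_real, Real.norm_eq_abs, Real.norm_eq_abs, abs_of_pos hΓ]
  refine mul_le_mul_of_nonneg_left ?_ (norm_nonneg _)
  rw [abs_div, abs_mul, abs_of_pos hΓ, abs_of_pos Real.pi_pos, div_le_iff₀ Real.pi_pos, mul_comm]
  have := Real.abs_sin_le_one (Real.pi * (ν * n + 1 - μ))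
  gcongr
  linarith [Real.pi_gt_three]

/-- The kernel in terms of the Wright function. -/
lemma waveKernel_eq_wright {μ : ℝ} (hμ : μ < 1) (x : ℝ) {t : ℝ} (ht : 0 < t) :
    (waveKernel ν μ x t : ℂ) =
      ((t ^ (μ - 1) : ℝ) : ℂ) * wright (-ν) μ (-((x * t ^ (-ν) : ℝ) : ℂ)) := by
  have h := (Complex.hasSum_iff _ _).1 (hasSum_integral_ray h0 h1 hμ x ht)
  have h2 := h.2.mul_left (1 / Real.pi)
  have h3 : HasSum _ (waveKernel ν μ x t : ℂ) := Complex.hasSum_ofReal.2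
    (show HasSum _ (waveKernel ν μ x t) by rw [waveKernel, if_pos ht]; exact h2)
  rw [← h3.tsum_eq, wright, ← tsum_mul_left]
  congr 1
  ext n
  rw [div_mul_eq_div_div, div_eq_mul_inv _ (Complex.Gamma _), inv_Gamma_eq h0 hμ]
  have e1 : (-(x : ℂ)) ^ n / (n.factorial : ℂ) = (((-x) ^ n / n.factorial : ℝ) : ℂ) := by
    push_cast; rfl
  have e2 : t ^ (-(ν * n + 1 - μ)) = t ^ (μ - 1) * (t ^ (-ν)) ^ n := by
    rw [← Real.rpow_natCast, ← Real.rpow_mul ht.le, ← Real.rpow_add ht]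
    congr 1
    ring
  have e3 : (-((x * t ^ (-ν) : ℝ) : ℂ)) ^ n = (((-x) ^ n * (t ^ (-ν)) ^ n : ℝ) : ℂ) := by
    rw [← mul_pow]; push_cast; ring
  rw [e1, e2, e3, Complex.im_ofReal_mul, Complex.im_mul_ofReal, Complex.exp_ofReal_mul_I_im]
  push_cast
  ring

lemma wrightF_eq_mul_wrightM (z : ℂ) : wrightF ν z = ν * z * wrightM ν z := by
  have hM := summable_wright h0 h1 (μ := 1 - ν) (by linarith) z
  have hΓ : ∀ n : ℕ, Complex.Gamma (((-ν : ℝ) : ℂ) * n + ((1 - ν : ℝ) : ℂ)) =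
      -(ν * (n + 1)) * Complex.Gamma (((-ν : ℝ) : ℂ) * (n + 1 : ℕ) + 0) := by
    intro n
    have h : ((-ν : ℝ) : ℂ) * (n + 1 : ℕ) + 0 ≠ 0 := by
      rw [add_zero, mul_ne_zero_iff]
      exact ⟨by simpa using h0.ne', Nat.cast_ne_zero.2 (by simp)⟩
    have := Complex.Gamma_add_one _ h
    rw [show (((-ν : ℝ) : ℂ) * n + ((1 - ν : ℝ) : ℂ)) =
      ((-ν : ℝ) : ℂ) * (n + 1 : ℕ) + 0 + 1 by push_cast; ring, this]
    push_cast
    ring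
  have hterm : ∀ n : ℕ, (-z) ^ (n + 1) / (((n + 1).factorial : ℂ) *
      Complex.Gamma (((-ν : ℝ) : ℂ) * (n + 1 : ℕ) + 0)) =
      ν * z * ((-z) ^ n / ((n.factorial : ℂ) *
        Complex.Gamma (((-ν : ℝ) : ℂ) * n + ((1 - ν : ℝ) : ℂ)))) := by
    intro n
    have hν : (ν : ℂ) ≠ 0 := by exact_mod_cast h0.ne'
    rw [hΓ, Nat.factorial_succ]
    set g := Complex.Gamma (((-ν : ℝ) : ℂ) * (n + 1 : ℕ) + 0)
    rcases eq_or_ne g 0 with hg | hg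
    · simp [hg]
    · push_cast
      field_simp
      ring
  have hF := (hasSum_nat_add_iff' (f := fun n : ℕ => (-z) ^ n / ((n.factorial : ℂ) *
    Complex.Gamma (((-ν : ℝ) : ℂ) * n + 0))) 1).1 (by
      simp only [hterm, Finset.range_one, Finset.sum_singleton]
      simpa using hM.hasSum.mul_left (ν * z : ℂ))
  rw [wrightF, wright, hF.tsum_eq, wrightM, wright]
  push_cast
  simp only [neg_mul]

/-- The reciprocity relation between the kernels with transforms `e ^ (-x s ^ ν)` and
`s ^ (ν - 1) e ^ (-x s ^ ν)`. -/
lemma waveKernel_reciprocity (x : ℝ) {t : ℝ} (ht : 0 < t) :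
    t * waveKernel ν 0 x t = ν * x * waveKernel ν (1 - ν) x t := by
  have e1 := waveKernel_eq_wright h0 h1 (μ := 0) zero_lt_one x ht
  have e2 := waveKernel_eq_wright h0 h1 (μ := 1 - ν) (by linarith) x ht
  have e3 := wrightF_eq_mul_wrightM h0 h1 ((x * t ^ (-ν) : ℝ) : ℂ)
  rw [wrightF, wrightM] at e3
  rw [Complex.ofReal_zero, e3] at e1
  have e4 : (((1 - ν : ℝ) : ℂ)) = 1 - (ν : ℂ) := by push_cast; rfl
  rw [e4] at e2
  have e5 : t ^ (1 - ν - 1) = t ^ (-ν) := by congr 1; ring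
  have e6 : t * t ^ ((0 : ℝ) - 1) = 1 := by
    rw [zero_sub, Real.rpow_neg_one, mul_inv_cancel₀ ht.ne']
  have : ((t * waveKernel ν 0 x t : ℝ) : ℂ) = ((ν * x * waveKernel ν (1 - ν) x t : ℝ) : ℂ) := by
    push_cast
    rw [e1, e2, e5, ← mul_assoc, ← Complex.ofReal_mul t, e6]
    push_cast
    ring
  exact_mod_cast this

end series

/-! ### Laplace transform of the kernel -/

/-- The contour integral of `p ^ (-μ) e ^ (-x p ^ ν) / (s - p)` along the ray `arg p = y`. -/
def contourQ (ν μ x : ℝ) (s : ℂ) (y : ℝ) : ℂ :=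
  ∫ ρ : ℝ, ray ν μ x 0 (ρ + y * Complex.I) / (s - Complex.exp (ρ + y * Complex.I))

lemma ray_eq_mul (ν μ x t : ℝ) (w : ℂ) :
    ray ν μ x t w = ray ν μ x 0 w * Complex.exp (t * Complex.exp w) := by
  rw [ray, ray, ← Complex.exp_add]; congr 1; push_cast; ring

lemma re_sub_exp (s : ℂ) (ρ y : ℝ) : (s - Complex.exp (ρ + y * Complex.I)).re =
    s.re - Real.cos y * Real.exp ρ := by
  rw [Complex.sub_re, exp_line, Complex.re_ofReal_mul]
  simp [-Complex.ofReal_exp, -Complex.ofReal_cos, -Complex.ofReal_sin]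
  ring

section laplace
variable {ν : ℝ} (h0 : 0 < ν) (h1 : ν < 1)
include h0 h1

omit h1 in
lemma cos_of_eq_ang {y : ℝ} (hy : |y| = ang ν) :
    Real.cos y = Real.cos (ang ν) ∧ Real.cos (ν * y) = Real.cos (ν * ang ν) := by
  rw [← hy, Real.cos_abs]
  refine ⟨rfl, ?_⟩
  rw [← Real.cos_abs (ν * y), abs_mul, abs_of_pos h0]

lemma integrable_laplace_ray {μ x y : ℝ} (hy : |y| = ang ν) {s : ℂ} (hs : 0 < s.re)
    (hΦ : Integrable fun ρ : ℝ => Real.exp ((1 - μ) * ρ - x * Real.cos (ν * ang ν) *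
      Real.exp (ν * ρ)) / (s.re + -Real.cos (ang ν) * Real.exp ρ)) :
    Integrable (Function.uncurry fun t ρ : ℝ => Complex.exp (-s * t) *
      ray ν μ x t (ρ + y * Complex.I)) ((volume.restrict (Ioi 0)).prod volume) := by
  have hc := cos_ang_neg h0 h1
  obtain ⟨hy1, hy2⟩ := cos_of_eq_ang h0 hy
  have hre : ∀ ρ : ℝ, 0 < s.re + -Real.cos (ang ν) * Real.exp ρ := fun ρ => by positivity
  have hm : Continuous (Function.uncurry fun t ρ : ℝ => Complex.exp (-s * t) *
      ray ν μ x t (ρ + y * Complex.I)) := by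
    unfold ray Function.uncurry; fun_prop
  have hn : ∀ t ρ : ℝ, ‖Complex.exp (-s * t) * ray ν μ x t (ρ + y * Complex.I)‖ =
      Real.exp ((1 - μ) * ρ - x * Real.cos (ν * ang ν) * Real.exp (ν * ρ)) *
      Real.exp (-(s.re + -Real.cos (ang ν) * Real.exp ρ) * t) := by
    intro t ρ
    rw [norm_mul, norm_exp_neg_mul_ofReal, norm_ray, hy1, hy2, ← Real.exp_add, ← Real.exp_add]
    congr 1
    ring
  rw [integrable_prod_iff' hm.aestronglyMeasurable]
  constructor
  · refine ae_of_all _ fun ρ => ?_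
    rw [← integrable_norm_iff (by exact (hm.comp (by fun_prop : Continuous fun t : ℝ =>
      (t, ρ))).aestronglyMeasurable)]
    simp only [Function.uncurry_apply_pair, hn]
    exact (integrableOn_exp_mul_Ioi (neg_lt_zero.2 (hre ρ)) 0).const_mul _
  · refine hΦ.congr (ae_of_all _ fun ρ => ?_)
    simp only [Function.uncurry_apply_pair, hn]
    rw [integral_const_mul, integral_exp_mul_Ioi (neg_lt_zero.2 (hre ρ))]
    rw [mul_zero, Real.exp_zero, neg_div_neg_eq, mul_one_div]

lemma integrable_contourQ {μ x y : ℝ} (hy : |y| = ang ν) {s : ℂ} (hs : 0 < s.re)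
    (hΦ : Integrable fun ρ : ℝ => Real.exp ((1 - μ) * ρ - x * Real.cos (ν * ang ν) *
      Real.exp (ν * ρ)) / (s.re + -Real.cos (ang ν) * Real.exp ρ)) :
    Integrable fun ρ : ℝ => ray ν μ x 0 (ρ + y * Complex.I) /
      (s - Complex.exp (ρ + y * Complex.I)) := by
  have hc := cos_ang_neg h0 h1
  obtain ⟨hy1, hy2⟩ := cos_of_eq_ang h0 hy
  have hre : ∀ ρ : ℝ, 0 < s.re + -Real.cos (ang ν) * Real.exp ρ := fun ρ => by positivity
  have hre' : ∀ ρ : ℝ, (s - Complex.exp (ρ + y * Complex.I)).re =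
      s.re + -Real.cos (ang ν) * Real.exp ρ := fun ρ => by rw [re_sub_exp, hy1]; ring
  refine hΦ.mono' (Continuous.aestronglyMeasurable ?_) (ae_of_all _ fun ρ => ?_)
  · refine (continuous_ray_line _ _ _ _ _).div (by fun_prop) fun ρ => ?_
    exact ne_zero_of_re_pos (by rw [hre']; exact hre ρ)
  · rw [norm_div, norm_ray, hy2]
    have e : (1 - μ) * ρ + 0 * Real.cos y * Real.exp ρ -
        x * Real.cos (ν * ang ν) * Real.exp (ν * ρ) =
        (1 - μ) * ρ - x * Real.cos (ν * ang ν) * Real.exp (ν * ρ) := by ring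
    rw [e]
    refine div_le_div_of_nonneg_left (Real.exp_pos _).le (hre ρ) ?_
    rw [← hre']
    exact Complex.re_le_norm _

lemma hasLaplace_waveKernel_contour {μ x : ℝ} {s : ℂ} (hs : 0 < s.re)
    (hΦ : Integrable fun ρ : ℝ => Real.exp ((1 - μ) * ρ - x * Real.cos (ν * ang ν) *
      Real.exp (ν * ρ)) / (s.re + -Real.cos (ang ν) * Real.exp ρ)) :
    HasLaplace (waveKernel ν μ x) s ((contourQ ν μ x s (ang ν) - contourQ ν μ x s (-ang ν)) /
      (2 * Real.pi * Complex.I)) := by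
  have hθ := ang_pos h0 h1
  have hc := cos_ang_neg h0 h1
  have ha1 : |ang ν| = ang ν := abs_of_pos hθ
  have ha2 : |-ang ν| = ang ν := by rw [abs_neg, ha1]
  have i1 := integrable_laplace_ray h0 h1 ha1 hs hΦ
  have i2 := integrable_laplace_ray h0 h1 ha2 hs hΦ
  have hpt : EqOn (fun t : ℝ => ((∫ ρ : ℝ, Complex.exp (-s * t) *
        ray ν μ x t (ρ + ang ν * Complex.I)) - ∫ ρ : ℝ, Complex.exp (-s * t) *
        ray ν μ x t (ρ + (-ang ν : ℝ) * Complex.I)) / (2 * Real.pi * Complex.I))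
      (fun t : ℝ => Complex.exp (-s * t) * (waveKernel ν μ x t : ℂ)) (Ioi 0) := by
    intro t ht
    have hconj : ∀ ρ : ℝ, ray ν μ x t (ρ + (-ang ν : ℝ) * Complex.I) =
        (starRingEnd ℂ) (ray ν μ x t (ρ + ang ν * Complex.I)) := by
      intro ρ
      simp [ray, ← Complex.exp_conj]
    simp only [integral_const_mul, hconj]
    rw [integral_conj, waveKernel, if_pos (mem_Ioi.1 ht), ← mul_sub, Complex.sub_conj]
    push_cast
    field_simp
  have hval : ∀ y : ℝ, |y| = ang ν → ∫ t in Ioi (0 : ℝ), ∫ ρ : ℝ, Complex.exp (-s * t) *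
      ray ν μ x t (ρ + y * Complex.I) = contourQ ν μ x s y := by
    intro y hy
    rw [integral_integral_swap (integrable_laplace_ray h0 h1 hy hs hΦ), contourQ]
    congr 1 with ρ
    have hre : (-(s - Complex.exp (ρ + y * Complex.I))).re < 0 := by
      rw [Complex.neg_re, re_sub_exp, (cos_of_eq_ang h0 hy).1]
      have := mul_pos hc (Real.exp_pos ρ)
      linarith
    have e : ∀ t : ℝ, Complex.exp (-s * t) * ray ν μ x t (ρ + y * Complex.I) =
        ray ν μ x 0 (ρ + y * Complex.I) *
        Complex.exp (-(s - Complex.exp (ρ + y * Complex.I)) * t) := by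
      intro t
      rw [ray_eq_mul, mul_left_comm, ← Complex.exp_add]
      congr 2
      ring
    simp_rw [e]
    rw [integral_const_mul, integral_exp_mul_complex_Ioi hre, Complex.ofReal_zero, mul_zero,
      Complex.exp_zero, neg_div_neg_eq, mul_one_div]
  refine ⟨?_, ?_⟩
  · refine IntegrableOn.congr_fun ?_ hpt measurableSet_Ioi
    exact (i1.integral_prod_left.sub i2.integral_prod_left).div_const _
  · have e := integral_sub i1.integral_prod_left i2.integral_prod_left
    simp only [Function.uncurry_apply_pair] at e
    rw [← setIntegral_congr_fun measurableSet_Ioi hpt, integral_div, e, hval _ ha1, hval _ ha2]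

lemma waveKernel_zero_space {μ t : ℝ} (hμ : μ < 1) (ht : 0 < t) :
    waveKernel ν μ 0 t = powKernel μ t := by
  have h := waveKernel_eq_wright h0 h1 hμ 0 ht
  have : wright (-ν) μ (-((0 * t ^ (-ν) : ℝ) : ℂ)) = 1 / Complex.Gamma μ := by
    rw [wright, tsum_eq_single 0]
    · simp
    · intro n hn
      simp [hn]
  rw [this, Complex.Gamma_ofReal] at h
  rw [powKernel]
  have h' : (waveKernel ν μ 0 t : ℂ) = ((t ^ (μ - 1) * (1 / Real.Gamma μ) : ℝ) : ℂ) := by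
    rw [h]; push_cast; rfl
  have := Complex.ofReal_injective h'
  rw [this]; ring

end laplace

lemma integrable_exp_half_div {a b : ℝ} (ha : 0 < a) (hb : 0 < b) :
    Integrable fun ρ : ℝ => Real.exp (ρ / 2) / (a + b * Real.exp ρ) := by
  have h := (integrableOn_exp_mul_Ioi (a := -1 / 2) (by norm_num) 0).const_mul b⁻¹
  have h' := (integrableOn_exp_mul_Iic (a := 1 / 2) (by norm_num) 0).const_mul a⁻¹
  have hm : Continuous fun ρ : ℝ => Real.exp (ρ / 2) / (a + b * Real.exp ρ) :=
    Continuous.div (by fun_prop) (by fun_prop) fun ρ => by positivity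
  rw [← integrableOn_univ, ← Iic_union_Ioi (a := (0 : ℝ))]
  refine IntegrableOn.union ?_ ?_
  · refine h'.mono' hm.aestronglyMeasurable (ae_of_all _ fun ρ => ?_)
    rw [Real.norm_eq_abs, abs_of_pos (by positivity), inv_mul_eq_div, one_div, inv_mul_eq_div]
    refine div_le_div_of_nonneg_left (Real.exp_pos _).le ha ?_
    have := mul_pos hb (Real.exp_pos ρ)
    linarith
  · refine h.mono' hm.aestronglyMeasurable (ae_of_all _ fun ρ => ?_)
    have e : b⁻¹ * Real.exp (-1 / 2 * ρ) = Real.exp (ρ / 2) / (b * Real.exp ρ) := by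
      rw [eq_div_iff (by positivity), mul_mul_mul_comm, inv_mul_cancel₀ hb.ne', one_mul,
        ← Real.exp_add]
      congr 1
      ring
    rw [Real.norm_eq_abs, abs_of_pos (by positivity), e]
    refine div_le_div_of_nonneg_left (Real.exp_pos _).le (by positivity) ?_
    linarith

lemma tendsto_exp_half_div_atTop {a b : ℝ} (ha : 0 < a) (hb : 0 < b) :
    Tendsto (fun ρ : ℝ => Real.exp (ρ / 2) / (a + b * Real.exp ρ)) atTop (𝓝 0) := by
  have h : Tendsto (fun ρ : ℝ => b⁻¹ * Real.exp (-(ρ / 2))) atTop (𝓝 (b⁻¹ * 0)) :=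
    (Real.tendsto_exp_neg_atTop_nhds_zero.comp
      (tendsto_id.atTop_div_const two_pos)).const_mul _
  rw [mul_zero] at h
  refine squeeze_zero (fun ρ => by positivity) (fun ρ => ?_) h
  have e : b⁻¹ * Real.exp (-(ρ / 2)) = Real.exp (ρ / 2) / (b * Real.exp ρ) := by
    rw [eq_div_iff (by positivity), mul_mul_mul_comm, inv_mul_cancel₀ hb.ne', one_mul,
      ← Real.exp_add]
    congr 1
    ring
  rw [e]
  refine div_le_div_of_nonneg_left (Real.exp_pos _).le (by positivity) ?_
  linarith

lemma tendsto_exp_half_div_atBot {a b : ℝ} (ha : 0 < a) (hb : 0 < b) :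
    Tendsto (fun ρ : ℝ => Real.exp (ρ / 2) / (a + b * Real.exp ρ)) atBot (𝓝 0) := by
  have h : Tendsto (fun ρ : ℝ => Real.exp (ρ / 2) / a) atBot (𝓝 (0 / a)) :=
    (Real.tendsto_exp_atBot.comp (tendsto_id.atBot_div_const two_pos)).div_const _
  rw [zero_div] at h
  refine squeeze_zero (fun ρ => by positivity) (fun ρ => ?_) h
  refine div_le_div_of_nonneg_left (Real.exp_pos _).le ha ?_
  have := mul_pos hb (Real.exp_pos ρ)
  linarith

/-- Away from the pole, `|s - e ^ w|` is bounded below in terms of `Re w`. -/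
lemma norm_sub_exp_ge {s : ℂ} (hs : s ≠ 0) {w : ℂ}
    (hw : |Real.log (2 * ‖s‖)| + |Real.log (‖s‖ / 2)| ≤ |w.re|) :
    min 1 ‖s‖ / 4 * (1 + Real.exp w.re) ≤ ‖s - Complex.exp w‖ := by
  have hm1 := min_le_left 1 ‖s‖
  have hm2 := min_le_right 1 ‖s‖
  have he := Real.exp_pos w.re
  rcases le_total 0 w.re with h | h
  · rw [abs_of_nonneg h] at hw
    have h1 : 2 * ‖s‖ ≤ Real.exp w.re := by
      rw [← Real.exp_log (show 0 < 2 * ‖s‖ by positivity)]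
      exact Real.exp_le_exp.2 (by
        linarith [le_abs_self (Real.log (2 * ‖s‖)), abs_nonneg (Real.log (‖s‖ / 2))])
    have h2 : 1 ≤ Real.exp w.re := Real.one_le_exp h
    have h3 := norm_sub_norm_le (Complex.exp w) s
    rw [norm_sub_rev, Complex.norm_exp] at h3
    nlinarith
  · rw [abs_of_nonpos h] at hw
    have h1 : Real.exp w.re ≤ ‖s‖ / 2 := by
      rw [← Real.exp_log (show 0 < ‖s‖ / 2 by positivity)]
      exact Real.exp_le_exp.2 (by
        linarith [neg_abs_le (Real.log (‖s‖ / 2)), abs_nonneg (Real.log (2 * ‖s‖))])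
    have h2 : Real.exp w.re ≤ 1 := Real.exp_le_one_iff.2 h
    have h3 := norm_sub_norm_le s (Complex.exp w)
    rw [Complex.norm_exp] at h3
    nlinarith

/-- The value `s ^ (-μ) e ^ (-x s ^ ν)` of the integrand at the pole `p = s`. -/
def poleValue (ν μ x : ℝ) (s : ℂ) : ℂ :=
  Complex.exp (-μ * Complex.log s - x * Complex.exp (ν * Complex.log s))

section pole
variable {ν : ℝ} (h0 : 0 < ν) (h1 : ν < 1)
include h0 h1

lemma integrable_laplace_space {μ x : ℝ} (hμ : μ < 1) (hx : 0 < x) {s : ℂ} (hs : 0 < s.re) :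
    Integrable fun ρ : ℝ => Real.exp ((1 - μ) * ρ - x * Real.cos (ν * ang ν) *
      Real.exp (ν * ρ)) / (s.re + -Real.cos (ang ν) * Real.exp ρ) := by
  have hc := cos_ang_neg h0 h1
  have hpos : ∀ ρ : ℝ, 0 < s.re + -Real.cos (ang ν) * Real.exp ρ := fun ρ => by positivity
  refine ((integrable_space_bound h0 h1 hμ hx).div_const s.re).mono'
    (Continuous.aestronglyMeasurable (Continuous.div (by fun_prop) (by fun_prop)
      fun ρ => (hpos ρ).ne')) (ae_of_all _ fun ρ => ?_)
  rw [Real.norm_eq_abs, abs_of_pos (div_pos (Real.exp_pos _) (hpos ρ)), mul_comm x]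
  refine div_le_div_of_nonneg_left (Real.exp_pos _).le hs ?_
  have := mul_pos hc (Real.exp_pos ρ)
  linarith

lemma integrable_laplace_half {s : ℂ} (hs : 0 < s.re) :
    Integrable fun ρ : ℝ => Real.exp ((1 - 1 / 2) * ρ - 0 * Real.cos (ν * ang ν) *
      Real.exp (ν * ρ)) / (s.re + -Real.cos (ang ν) * Real.exp ρ) := by
  refine (integrable_exp_half_div hs (cos_ang_neg h0 h1)).congr (ae_of_all _ fun ρ => ?_)
  simp only
  congr 2
  ring

/-- Subtracting from `p ^ (-μ) e ^ (-x p ^ ν)` the multiple of `p ^ (-1/2)` with the same value at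
`s` removes the pole, so that the difference of the two contour integrals vanishes. -/
lemma contourQ_sub_contourQ {μ x : ℝ} (hμ : μ < 1) (hx : 0 < x) {s : ℂ} (hs : 0 < s.re) :
    contourQ ν μ x s (ang ν) - contourQ ν μ x s (-ang ν) =
      poleValue ν μ x s * Complex.exp (Complex.log s / 2) *
        (contourQ ν (1 / 2) 0 s (ang ν) - contourQ ν (1 / 2) 0 s (-ang ν)) := by
  have hs0 := ne_zero_of_re_pos hs
  have hθ := ang_pos h0 h1
  have hc2 := cos_mul_ang_pos h0 h1
  set w₀ := Complex.log s with hw₀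
  have hw₀i : |w₀.im| < Real.pi / 2 := cpow_log_line hs
  have hexp : Complex.exp w₀ = s := Complex.exp_log hs0
  set A := poleValue ν μ x s with hA
  set N : ℂ → ℂ := fun w => Complex.exp (-μ * w - x * Complex.exp (ν * w)) -
    A * Complex.exp ((w₀ - w) / 2) with hN
  have hN0 : N w₀ = 0 := by
    simp only [hN, hA, poleValue, ← hw₀]
    simp
  set R : ℂ → ℂ := fun w => -(Complex.exp w * dslope N w₀ w / dslope Complex.exp w₀ w) with hR
  -- `e ^ w = s` has the single solution `w₀` in the strip
  have hinj : ∀ w : ℂ, |w.im| ≤ ang ν → w ≠ w₀ → Complex.exp w ≠ s := by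
    intro w hw hne h
    rw [← hexp, Complex.exp_eq_exp_iff_exists_int] at h
    obtain ⟨n, hn⟩ := h
    have him : w.im - w₀.im = n * (2 * Real.pi) := by
      rw [hn]; simp
    have h2 := ang_lt h0 h1
    have habs : |(n : ℝ) * (2 * Real.pi)| < 2 * Real.pi := by
      rw [← him]
      refine (abs_sub _ _).trans_lt ?_
      linarith [Real.pi_pos]
    rw [abs_mul, abs_of_pos Real.two_pi_pos, mul_lt_iff_lt_one_left Real.two_pi_pos] at habs
    have : n = 0 := by
      rw [← Int.abs_lt_one_iff]
      exact_mod_cast habs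
    rw [this] at hn
    exact hne (by simpa using hn)
  have hRne : ∀ w : ℂ, |w.im| ≤ ang ν → w ≠ w₀ →
      R w = Complex.exp w * N w / (s - Complex.exp w) := by
    intro w hw hne
    have h2 : Complex.exp w - s ≠ 0 := sub_ne_zero.2 (hinj w hw hne)
    have h3 : s - Complex.exp w ≠ 0 := sub_ne_zero.2 (hinj w hw hne).symm
    simp only [hR]
    rw [dslope_of_ne _ hne, dslope_of_ne _ hne, slope_def_field, slope_def_field, hN0, hexp,
      sub_zero]
    field_simp
    ring
  have hdN : Differentiable ℂ N := by simp only [hN]; fun_prop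
  have hd1 : Differentiable ℂ (dslope N w₀) := by
    rw [← differentiableOn_univ] at hdN ⊢
    exact (Complex.differentiableOn_dslope univ_mem).2 hdN
  have hd2 : Differentiable ℂ (dslope Complex.exp w₀) := by
    rw [← differentiableOn_univ]
    exact (Complex.differentiableOn_dslope univ_mem).2 Complex.differentiable_exp.differentiableOn
  have hdne : ∀ w : ℂ, |w.im| ≤ ang ν → dslope Complex.exp w₀ w ≠ 0 := by
    intro w hw
    rcases eq_or_ne w w₀ with rfl | hne
    · rw [dslope_same, Complex.deriv_exp]; exact Complex.exp_ne_zero _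
    · rw [dslope_of_ne _ hne, slope_def_field, hexp]
      exact div_ne_zero (sub_ne_zero.2 (hinj w hw hne)) (sub_ne_zero.2 hne)
  have hdR : DifferentiableOn ℂ R {w | |w.im| ≤ ang ν} := by
    refine DifferentiableOn.neg (DifferentiableOn.div ?_ hd2.differentiableOn hdne)
    exact (Complex.differentiable_exp.mul hd1).differentiableOn
  have hstrip : ∀ y ∈ uIcc (-ang ν) (ang ν), |y| ≤ ang ν := by
    intro y hy
    rw [uIcc_of_le (by linarith)] at hy
    exact abs_le.2 hy
  set ρ₀ := |Real.log (2 * ‖s‖)| + |Real.log (‖s‖ / 2)| with hρ₀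
  -- boundedness near the pole, by compactness
  obtain ⟨M, hM⟩ : ∃ M, ∀ w ∈ Icc (-ρ₀) ρ₀ ×ℂ Icc (-ang ν) (ang ν), ‖R w‖ ≤ M := by
    refine (isCompact_Icc.reProdIm isCompact_Icc).exists_bound_of_continuousOn
      (hdR.continuousOn.mono fun w hw => ?_)
    exact abs_le.2 hw.2
  set δ := min 1 ‖s‖ / 4 with hδ
  have hδ0 : 0 < δ := by have := norm_pos_iff.2 hs0; positivity
  set A' := ‖A‖ * Real.exp (w₀.re / 2) with hA'
  set E : ℝ → ℝ := fun ρ => δ⁻¹ * Real.exp ((1 - μ) * ρ -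
    Real.cos (ν * ang ν) * x * Real.exp (ν * ρ)) +
    A' * δ⁻¹ * (Real.exp (ρ / 2) / (1 + 1 * Real.exp ρ)) with hE
  have hE0 : ∀ ρ, 0 ≤ E ρ := fun ρ => by simp only [hE]; positivity
  have hEi : Integrable E := ((integrable_space_bound h0 h1 hμ hx).const_mul _).add
    ((integrable_exp_half_div one_pos one_pos).const_mul _)
  have hEt : Tendsto E atTop (𝓝 0) := by
    have := ((tendsto_exp_sub_exp_atTop (1 - μ) (mul_pos hc2 hx) h0).const_mul δ⁻¹).add
      ((tendsto_exp_half_div_atTop one_pos one_pos).const_mul (A' * δ⁻¹))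
    simpa only [mul_zero, add_zero] using this
  have hEb : Tendsto E atBot (𝓝 0) := by
    have := ((tendsto_exp_sub_exp_atBot ν (show 0 < 1 - μ by linarith)
      (mul_pos hc2 hx).le).const_mul δ⁻¹).add
      ((tendsto_exp_half_div_atBot one_pos one_pos).const_mul (A' * δ⁻¹))
    simpa only [mul_zero, add_zero] using this
  have hout : ∀ ρ y : ℝ, |y| ≤ ang ν → ρ₀ < |ρ| → ‖R (ρ + y * Complex.I)‖ ≤ E ρ := by
    intro ρ y hy hρ
    set w : ℂ := ρ + y * Complex.I with hw
    have hwre : w.re = ρ := by simp [hw]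
    have hwim : w.im = y := by simp [hw]
    have hlow := norm_sub_exp_ge hs0 (w := w) (by rw [hwre]; exact hρ.le)
    rw [hwre, ← hδ] at hlow
    have hlow0 : 0 < δ * (1 + Real.exp ρ) := by positivity
    have hne : w ≠ w₀ := by
      rintro h
      rw [h, hexp, sub_self, norm_zero] at hlow
      linarith
    rw [hRne w (by rwa [hwim]) hne, norm_div]
    have hnum : ‖Complex.exp w * N w‖ ≤ Real.exp ((1 - μ) * ρ -
        Real.cos (ν * ang ν) * x * Real.exp (ν * ρ)) + A' * Real.exp (ρ / 2) := by
      simp only [hN]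
      rw [mul_sub]
      refine (norm_sub_le _ _).trans (add_le_add ?_ ?_)
      · have e : Complex.exp w * Complex.exp (-μ * w - x * Complex.exp (ν * w)) =
            ray ν μ x 0 w := by
          rw [ray, ← Complex.exp_add]; congr 1; push_cast; ring
        rw [e, hw, norm_ray]
        refine Real.exp_le_exp.2 ?_
        have := mul_le_mul_of_nonneg_right (cos_mul_ang_le h0 h1 hy)
          (mul_pos hx (Real.exp_pos (ν * ρ))).le
        linarith
      · rw [mul_left_comm, ← Complex.exp_add, norm_mul, Complex.norm_exp, hA', mul_assoc,
          ← Real.exp_add]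
        refine le_of_eq ?_
        congr 2
        have : (w + (w₀ - w) / 2) = ((1 / 2 : ℝ) : ℂ) * (w + w₀) := by push_cast; ring
        rw [this, Complex.re_ofReal_mul, Complex.add_re, hwre]
        ring
    refine (div_le_div₀ ((norm_nonneg _).trans hnum) hnum hlow0 hlow).trans ?_
    simp only [hE]
    rw [add_div, one_mul]
    refine add_le_add ?_ (le_of_eq (by field_simp))
    rw [inv_mul_eq_div]
    refine div_le_div_of_nonneg_left (Real.exp_pos _).le hδ0 ?_
    nlinarith [Real.exp_pos ρ]
  have hline := integral_line_eq (f := R) (y₁ := -ang ν) (y₂ := ang ν)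
    (B := fun ρ => (Icc (-ρ₀) ρ₀).indicator (fun _ => |M|) ρ + E ρ)
    (hdR.mono fun w hw => hstrip _ hw) ?_ ?_ ?_ ?_
  rotate_left
  · intro ρ y hy
    by_cases hρ : ρ ∈ Icc (-ρ₀) ρ₀
    · rw [indicator_of_mem hρ]
      have : ‖R (ρ + y * Complex.I)‖ ≤ M := by
        refine hM _ ⟨?_, ?_⟩
        · simpa using hρ
        · have := abs_le.1 (hstrip y hy)
          simpa using this
      linarith [le_abs_self M, hE0 ρ]
    · rw [indicator_of_notMem hρ, zero_add]
      refine hout ρ y (hstrip y hy) ?_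
      by_contra h
      exact hρ (abs_le.1 (not_lt.1 h))
  · refine Integrable.add ?_ hEi
    rw [integrable_indicator_iff measurableSet_Icc]
    exact integrableOn_const (by simp)
  · refine hEt.congr' ?_
    filter_upwards [eventually_gt_atTop ρ₀] with ρ hρ
    rw [indicator_of_notMem (fun h => by linarith [h.2]), zero_add]
  · refine hEb.congr' ?_
    filter_upwards [eventually_lt_atBot (-ρ₀)] with ρ hρ
    rw [indicator_of_notMem (fun h => by linarith [h.1]), zero_add]
  have hΦ1 := integrable_laplace_space h0 h1 hμ hx hs
  have hΦ2 := integrable_laplace_half h0 h1 hs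
  have hsplit : ∀ y : ℝ, |y| = ang ν → ∫ ρ : ℝ, R (ρ + y * Complex.I) =
      contourQ ν μ x s y - A * Complex.exp (w₀ / 2) * contourQ ν (1 / 2) 0 s y := by
    intro y hy
    rw [contourQ, contourQ, ← integral_const_mul, ← integral_sub
      (integrable_contourQ h0 h1 hy hs hΦ1)
      ((integrable_contourQ h0 h1 hy hs hΦ2).const_mul _)]
    congr 1 with ρ
    rw [hRne]
    · have e1 : Complex.exp (ρ + y * Complex.I) * Complex.exp (-μ * (ρ + y * Complex.I) -
          x * Complex.exp (ν * (ρ + y * Complex.I))) = ray ν μ x 0 (ρ + y * Complex.I) := by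
        rw [ray, ← Complex.exp_add]; congr 1; push_cast; ring
      have e2 : Complex.exp (ρ + y * Complex.I) * Complex.exp ((w₀ - (ρ + y * Complex.I)) / 2) =
          Complex.exp (w₀ / 2) * ray ν (1 / 2) (0 : ℝ) 0 (ρ + y * Complex.I) := by
        rw [ray, ← Complex.exp_add, ← Complex.exp_add]; congr 1; push_cast; ring
      rw [mul_sub, e1, mul_left_comm, e2]
      ring
    · simpa using hy.le
    · intro h
      have := ang_gt h0 h1
      have h2 : |w₀.im| = ang ν := by rw [← h]; simpa using hy
      linarith
  rw [hsplit _ (by rw [abs_neg, abs_of_pos hθ]), hsplit _ (abs_of_pos hθ)] at hline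
  linear_combination -hline

/-- The Laplace transform of the kernel for `x > 0`. -/
lemma hasLaplace_waveKernel {μ x : ℝ} (hμ : μ < 1) (hx : 0 < x) {s : ℂ} (hs : 0 < s.re) :
    HasLaplace (waveKernel ν μ x) s (s ^ (-μ : ℂ) * Complex.exp (-x * s ^ (ν : ℂ))) := by
  have hs0 := ne_zero_of_re_pos hs
  have h := hasLaplace_waveKernel_contour h0 h1 hs (integrable_laplace_space h0 h1 hμ hx hs)
  have hhalf := hasLaplace_waveKernel_contour h0 h1 hs (integrable_laplace_half h0 h1 hs)
  have hhalf' := (hasLaplace_powKernel (β := 1 / 2) (by norm_num) hs).congr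
    fun t ht => (waveKernel_zero_space h0 h1 (by norm_num) ht).symm
  have e := hhalf.unique hhalf'
  rw [contourQ_sub_contourQ h0 h1 hμ hx hs, mul_div_assoc, e] at h
  convert h using 1
  rw [poleValue, Complex.cpow_def_of_ne_zero hs0, Complex.cpow_def_of_ne_zero hs0,
    Complex.cpow_def_of_ne_zero hs0, ← Complex.exp_add, ← Complex.exp_add, ← Complex.exp_add,
    mul_comm (Complex.log s) ν]
  congr 1
  push_cast
  ring

end pole

/-! ### Convolution with a Schwartz function -/

lemma schwartz_bounded (f : SchwartzMap ℝ ℝ) : ∃ C, 0 ≤ C ∧ ∀ x, |f x| ≤ C := by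
  obtain ⟨C, hC⟩ := f.decay 0 0
  refine ⟨C, hC.1.le, fun x => ?_⟩
  simpa using hC.2 x

/-- The derivative of a Schwartz function. -/
def sderiv (f : SchwartzMap ℝ ℝ) : SchwartzMap ℝ ℝ := SchwartzMap.derivCLM ℝ ℝ f

lemma hasDerivAt_schwartz (f : SchwartzMap ℝ ℝ) (x : ℝ) : HasDerivAt f (sderiv f x) x := by
  rw [sderiv, SchwartzMap.derivCLM_apply]
  exact f.differentiableAt.hasDerivAt

/-- Differentiation in `r` of `∫ P(y) f(a(y) + r b(y)) dy`, for `P` and `P b` integrable: this covers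
both the translates (`b = 1`) and the dilates (`b = -y`) of a convolution with `f`. -/
lemma hasDerivAt_integral_mul_schwartz {P a b : ℝ → ℝ} (f : SchwartzMap ℝ ℝ) (hP : Integrable P)
    (hPb : Integrable fun y => P y * b y) (ha : Measurable a) (hb : Measurable b) (r : ℝ) :
    HasDerivAt (fun r => ∫ y, P y * f (a y + r * b y))
      (∫ y, P y * b y * sderiv f (a y + r * b y)) r := by
  obtain ⟨C, hC0, hC⟩ := schwartz_bounded f
  obtain ⟨C', hC0', hC'⟩ := schwartz_bounded (sderiv f)
  have hm : ∀ (g : SchwartzMap ℝ ℝ) (r : ℝ), Measurable fun y => g (a y + r * b y) := fun g r =>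
    g.continuous.measurable.comp (ha.add (hb.const_mul r))
  refine (hasDerivAt_integral_of_dominated_loc_of_deriv_le (μ := volume) (s := univ)
    (F := fun r y => P y * f (a y + r * b y))
    (F' := fun r y => P y * b y * sderiv f (a y + r * b y))
    (bound := fun y => ‖P y * b y‖ * C') univ_mem
    (Eventually.of_forall fun r => hP.1.mul (hm f r).aestronglyMeasurable)
    (hP.mul_bdd (hm f r).aestronglyMeasurable (ae_of_all _ fun y => hC _))
    (hPb.1.mul (hm _ r).aestronglyMeasurable)
    (ae_of_all _ fun y r _ => ?_) (hPb.norm.mul_const _) (ae_of_all _ fun y r _ => ?_)).2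
  · rw [norm_mul]
    exact mul_le_mul_of_nonneg_left (hC' _) (norm_nonneg _)
  · have h1 : HasDerivAt (fun r => a y + r * b y) (b y) r := by
      simpa using ((hasDerivAt_id r).mul_const (b y)).const_add (a y)
    have := ((hasDerivAt_schwartz f (a y + r * b y)).comp r h1).const_mul (P y)
    refine this.congr_deriv ?_
    ring

lemma continuous_integral_mul_schwartz {P : ℝ → ℝ} (f : SchwartzMap ℝ ℝ) (hP : Integrable P) :
    Continuous fun p : ℝ × ℝ => ∫ y, P y * f (p.1 - p.2 * y) := by
  obtain ⟨C, hC0, hC⟩ := schwartz_bounded f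
  refine continuous_of_dominated (bound := fun y => ‖P y‖ * C) (fun p => ?_)
    (fun p => ae_of_all _ fun y => ?_) (hP.norm.mul_const _) (ae_of_all _ fun y => ?_)
  · exact hP.1.mul (Continuous.aestronglyMeasurable (f.continuous.comp (by fun_prop)))
  · rw [norm_mul]
    exact mul_le_mul_of_nonneg_left (hC _) (norm_nonneg _)
  · exact continuous_const.mul (f.continuous.comp (by fun_prop))

lemma abs_integral_mul_schwartz_le {P a : ℝ → ℝ} {f : SchwartzMap ℝ ℝ} {C : ℝ}
    (hC : ∀ x, |f x| ≤ C) (hP : Integrable P) :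
    |∫ y, P y * f (a y)| ≤ (∫ y, |P y|) * C := by
  rw [← integral_mul_const, ← Real.norm_eq_abs]
  refine norm_integral_le_of_norm_le (hP.norm.mul_const C) (ae_of_all _ fun y => ?_)
  rw [norm_mul]
  exact mul_le_mul_of_nonneg_left (hC _) (norm_nonneg _)

lemma hasDerivAt_schwartz_conv {P : ℝ → ℝ} (f : SchwartzMap ℝ ℝ) (hP : Integrable P) (x : ℝ) :
    HasDerivAt (fun x => ∫ ξ, P ξ * f (x - ξ)) (∫ ξ, P ξ * sderiv f (x - ξ)) x := by
  have := hasDerivAt_integral_mul_schwartz (a := fun y => -y) (b := fun _ => 1) f hP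
    (by simpa using hP) (by fun_prop) (by fun_prop) x
  simpa only [mul_one, neg_add_eq_sub] using this

lemma contDiff_schwartz_conv {P : ℝ → ℝ} (hP : Integrable P) (n : ℕ) : ∀ f : SchwartzMap ℝ ℝ,
    ContDiff ℝ n fun x => ∫ ξ, P ξ * f (x - ξ) := by
  induction n with
  | zero =>
    intro f
    rw [Nat.cast_zero, contDiff_zero]
    exact continuous_iff_continuousAt.2 fun x => (hasDerivAt_schwartz_conv f hP x).continuousAt
  | succ n ih =>
    intro f
    rw [Nat.cast_succ, contDiff_succ_iff_deriv]
    refine ⟨fun x => (hasDerivAt_schwartz_conv f hP x).differentiableAt, by simp, ?_⟩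
    rw [funext fun x => (hasDerivAt_schwartz_conv f hP x).deriv]
    exact ih _

lemma iteratedDeriv_two_schwartz_conv {P : ℝ → ℝ} (f : SchwartzMap ℝ ℝ) (hP : Integrable P)
    (x : ℝ) : iteratedDeriv 2 (fun x => ∫ ξ, P ξ * f (x - ξ)) x =
      ∫ ξ, P ξ * sderiv (sderiv f) (x - ξ) := by
  rw [iteratedDeriv_succ, iteratedDeriv_one,
    funext fun x => (hasDerivAt_schwartz_conv f hP x).deriv,
    (hasDerivAt_schwartz_conv _ hP x).deriv]

lemma tendsto_schwartz_conv {P : ℝ → ℝ} (f : SchwartzMap ℝ ℝ) (hP : Integrable P) {l : Filter ℝ}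
    [l.IsCountablyGenerated] (hl : ∀ ξ : ℝ, Tendsto (fun x => x - ξ) l (cocompact ℝ)) :
    Tendsto (fun x => ∫ ξ, P ξ * f (x - ξ)) l (𝓝 0) := by
  obtain ⟨C, hC0, hC⟩ := schwartz_bounded f
  have := tendsto_integral_filter_of_dominated_convergence (μ := volume) (l := l)
    (F := fun x ξ => P ξ * f (x - ξ)) (f := fun _ => 0) (fun ξ => ‖P ξ‖ * C)
    (Eventually.of_forall fun x => hP.1.mul
      (Continuous.aestronglyMeasurable (f.continuous.comp (by fun_prop))))
    (Eventually.of_forall fun x => ae_of_all _ fun ξ => by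
      rw [norm_mul]; exact mul_le_mul_of_nonneg_left (hC _) (norm_nonneg _))
    (hP.norm.mul_const _) (ae_of_all _ fun ξ => by
      simpa using ((zero_at_infty f).comp (hl ξ)).const_mul (P ξ))
  simpa using this

lemma integrable_cexp_mul {μ : Measure ℝ} {F : ℝ → ℝ → ℝ} {s : ℂ}
    (hF : Integrable (fun p : ℝ × ℝ => Real.exp (-s.re * p.2) * F p.1 p.2)
      (μ.prod (volume.restrict (Ioi 0)))) :
    Integrable (fun p : ℝ × ℝ => Complex.exp (-s * p.2) * F p.1 p.2)
      (μ.prod (volume.restrict (Ioi 0))) := by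
  have h2 := (hF.ofReal (𝕜 := ℂ)).bdd_mul (c := 1)
    (f := fun p : ℝ × ℝ => Complex.exp (-(s.im * Complex.I) * p.2))
    (Continuous.aestronglyMeasurable (by fun_prop))
    (ae_of_all _ fun p => by rw [norm_exp_neg_mul_ofReal]; simp)
  refine h2.congr (ae_of_all _ fun p => ?_)
  have e : Complex.exp (-s * p.2) = Complex.exp (-(s.im * Complex.I) * p.2) *
      Complex.exp (-(s.re : ℂ) * p.2) := by
    rw [← Complex.exp_add]
    congr 1
    conv_lhs => rw [← Complex.re_add_im s]
    ring
  simp only [RCLike.ofReal_eq_complex_ofReal]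
  rw [e]
  push_cast
  ring

/-- The Laplace transform commutes with integration over a parameter. -/
lemma hasLaplace_integral {μ : Measure ℝ} [SFinite μ] {F : ℝ → ℝ → ℝ} {s : ℂ}
    (hF : Integrable (fun p : ℝ × ℝ => Real.exp (-s.re * p.2) * F p.1 p.2)
      (μ.prod (volume.restrict (Ioi 0)))) :
    HasLaplace (fun t => ∫ y, F y t ∂μ) s
      (∫ y, (∫ t in Ioi (0 : ℝ), Complex.exp (-s * t) * F y t) ∂μ) := by
  have hi := integrable_cexp_mul hF
  have e1 : ∀ t : ℝ, Complex.exp (-s * t) * ((∫ y, F y t ∂μ : ℝ) : ℂ) =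
      ∫ y, Complex.exp (-s * t) * F y t ∂μ := fun t => by
    rw [← integral_complex_ofReal, ← integral_const_mul]
  refine ⟨?_, ?_⟩
  · simp_rw [e1]
    exact hi.integral_prod_right
  · simp_rw [e1]
    exact (integral_integral_swap (f := fun y t : ℝ => Complex.exp (-s * t) * F y t) hi).symm

lemma integrable_prod_of_integrableOn {F : ℝ × ℝ → ℝ} (h : IntegrableOn F (univ ×ˢ Ioi 0)) :
    Integrable F ((volume : Measure ℝ).prod (volume.restrict (Ioi 0))) := by
  rwa [IntegrableOn, Measure.volume_eq_prod, ← Measure.prod_restrict, Measure.restrict_univ] at h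

lemma hasLaplace_space_conv {G : ℝ → ℝ → ℝ} {s : ℂ}
    (hG : IntegrableOn (fun p : ℝ × ℝ => Real.exp (-s.re * p.2) * G p.1 p.2) (univ ×ˢ Ioi 0))
    (f : SchwartzMap ℝ ℝ) (x : ℝ) :
    HasLaplace (fun t => ∫ ξ, G ξ t * f (x - ξ)) s
      (∫ ξ, (∫ t in Ioi (0 : ℝ), Complex.exp (-s * t) * G ξ t) * f (x - ξ)) := by
  obtain ⟨C, hC0, hC⟩ := schwartz_bounded f
  have h := hasLaplace_integral (μ := volume) (F := fun ξ t => G ξ t * f (x - ξ)) (s := s) <| by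
    refine ((integrable_prod_of_integrableOn hG).mul_bdd (c := C)
      (g := fun p : ℝ × ℝ => f (x - p.1))
      (f.continuous.comp (by fun_prop)).aestronglyMeasurable (ae_of_all _ fun p => hC _)).congr
        (ae_of_all _ fun p => ?_)
    simp only
    ring
  refine ⟨h.1, h.2.trans ?_⟩
  congr 1 with ξ
  rw [← integral_mul_const]
  congr 1 with t
  push_cast
  ring

/-! ### The resolvent kernel of the second derivative -/

/-- Two integrations by parts on a half-line; the sign `ε` chooses its direction. -/
lemma integral_Ioi_exp_mul_schwartz (φ : SchwartzMap ℝ ℝ) {l : ℂ} (hl : 0 < l.re) (ε x : ℝ)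
    (hε : ε ^ 2 = 1) :
    IntegrableOn (fun ξ : ℝ => Complex.exp (-l * ξ) *
      ((sderiv (sderiv φ) (x + ε * ξ) : ℂ) - l ^ 2 * φ (x + ε * ξ))) (Ioi 0) ∧
    ∫ ξ in Ioi (0 : ℝ), Complex.exp (-l * ξ) *
      ((sderiv (sderiv φ) (x + ε * ξ) : ℂ) - l ^ 2 * φ (x + ε * ξ)) =
      -(ε * sderiv φ x + l * φ x) := by
  have hre : (-l).re < 0 := by simpa using hl
  have hbd : ∀ g : SchwartzMap ℝ ℝ, IntegrableOn (fun ξ : ℝ => Complex.exp (-l * ξ) *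
      (g (x + ε * ξ) : ℂ)) (Ioi 0) ∧
      Tendsto (fun ξ : ℝ => Complex.exp (-l * ξ) * (g (x + ε * ξ) : ℂ)) atTop (𝓝 0) := by
    intro g
    obtain ⟨C, hC0, hC⟩ := schwartz_bounded g
    refine ⟨(integrableOn_exp_mul_complex_Ioi hre 0).mul_bdd (c := C) ?_ ?_, ?_⟩
    · exact (Complex.continuous_ofReal.comp (g.continuous.comp (by fun_prop))).aestronglyMeasurable
    · exact ae_of_all _ fun ξ => by rw [Complex.norm_real]; exact hC _
    · have h1 : Tendsto (fun ξ : ℝ => Real.exp (-l.re * ξ) * C) atTop (𝓝 (0 * C)) :=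
        (Real.tendsto_exp_atBot.comp (tendsto_id.const_mul_atTop_of_neg
          (by linarith))).mul_const C
      rw [zero_mul] at h1
      refine squeeze_zero_norm (fun ξ => ?_) h1
      rw [norm_mul, norm_exp_neg_mul_ofReal, Complex.norm_real]
      exact mul_le_mul_of_nonneg_left (hC _) (Real.exp_pos _).le
  have hi : IntegrableOn (fun ξ : ℝ => Complex.exp (-l * ξ) *
      ((sderiv (sderiv φ) (x + ε * ξ) : ℂ) - l ^ 2 * φ (x + ε * ξ))) (Ioi 0) := by
    refine ((hbd (sderiv (sderiv φ))).1.sub ((hbd φ).1.const_mul (l ^ 2))).congr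
      (ae_of_all _ fun ξ => ?_)
    simp only [Pi.sub_apply]
    ring
  refine ⟨hi, ?_⟩
  have hd : ∀ (g : SchwartzMap ℝ ℝ) (ξ : ℝ), HasDerivAt (fun ξ : ℝ => (g (x + ε * ξ) : ℂ))
      (ε * sderiv g (x + ε * ξ)) ξ := by
    intro g ξ
    have h1 : HasDerivAt (fun ξ => x + ε * ξ) ε ξ := by
      simpa using ((hasDerivAt_id ξ).const_mul ε).const_add x
    have := ((hasDerivAt_schwartz g (x + ε * ξ)).comp ξ h1).ofReal_comp
    refine this.congr_deriv ?_
    push_cast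
    ring
  have hder : ∀ ξ : ℝ, HasDerivAt (fun ξ : ℝ => Complex.exp (-l * ξ) *
      (ε * (sderiv φ (x + ε * ξ) : ℂ) + l * φ (x + ε * ξ)))
      (Complex.exp (-l * ξ) * ((sderiv (sderiv φ) (x + ε * ξ) : ℂ) - l ^ 2 * φ (x + ε * ξ))) ξ := by
    intro ξ
    have h1 : HasDerivAt (fun ξ : ℝ => Complex.exp (-l * ξ)) (Complex.exp (-l * ξ) * (-l)) ξ := by
      have := ((Complex.ofRealCLM.hasDerivAt (x := ξ)).const_mul (-l)).cexp
      simpa using this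
    refine (h1.mul (((hd (sderiv φ) ξ).const_mul (ε : ℂ)).add ((hd φ ξ).const_mul l))).congr_deriv
      ?_
    have hε' : (ε : ℂ) ^ 2 = 1 := by exact_mod_cast hε
    simp only [Pi.add_apply]
    linear_combination (Complex.exp (-l * ξ) * sderiv (sderiv φ) (x + ε * ξ)) * hε'
  have ht : Tendsto (fun ξ : ℝ => Complex.exp (-l * ξ) *
      (ε * (sderiv φ (x + ε * ξ) : ℂ) + l * φ (x + ε * ξ))) atTop (𝓝 0) := by
    have := ((hbd (sderiv φ)).2.const_mul (ε : ℂ)).add ((hbd φ).2.const_mul l)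
    rw [mul_zero, mul_zero, add_zero] at this
    refine this.congr fun ξ => by ring
  have := integral_Ioi_of_hasDerivAt_of_tendsto (hder 0).continuousAt.continuousWithinAt
    (fun ξ _ => hder ξ) hi ht
  rw [this]
  simp

/-- `e ^ (-l |ξ|) / (2 l)` is the fundamental solution of `l² - d²/dξ²`. -/
lemma integral_exp_abs_mul_schwartz (φ : SchwartzMap ℝ ℝ) {l : ℂ} (hl : 0 < l.re) (x : ℝ) :
    ∫ ξ : ℝ, Complex.exp (-l * (|ξ| : ℝ)) *
      ((sderiv (sderiv φ) (x - ξ) : ℂ) - l ^ 2 * φ (x - ξ)) = -(2 * l * φ x) := by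
  obtain ⟨i1, e1⟩ := integral_Ioi_exp_mul_schwartz φ hl (-1) x (by norm_num)
  obtain ⟨i2, e2⟩ := integral_Ioi_exp_mul_schwartz φ hl 1 x (by norm_num)
  set F : ℝ → ℂ := fun ξ => Complex.exp (-l * (|ξ| : ℝ)) *
      ((sderiv (sderiv φ) (x - ξ) : ℂ) - l ^ 2 * φ (x - ξ)) with hF
  have c1 : EqOn (fun ξ : ℝ => Complex.exp (-l * ξ) *
      ((sderiv (sderiv φ) (x + -1 * ξ) : ℂ) - l ^ 2 * φ (x + -1 * ξ))) F (Ioi 0) := by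
    intro ξ hξ
    simp only [hF, abs_of_pos (mem_Ioi.1 hξ), neg_one_mul, ← sub_eq_add_neg]
  have c2 : EqOn (fun ξ : ℝ => Complex.exp (-l * ξ) *
      ((sderiv (sderiv φ) (x + 1 * ξ) : ℂ) - l ^ 2 * φ (x + 1 * ξ))) (fun ξ => F (-ξ)) (Ioi 0) := by
    intro ξ hξ
    simp only [hF, abs_neg, abs_of_pos (mem_Ioi.1 hξ), one_mul, sub_neg_eq_add]
  rw [setIntegral_congr_fun measurableSet_Ioi c1] at e1
  rw [setIntegral_congr_fun measurableSet_Ioi c2, integral_comp_neg_Ioi, neg_zero] at e2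
  have j1 : IntegrableOn F (Ioi 0) := i1.congr_fun c1 measurableSet_Ioi
  have j2 : IntegrableOn F (Iic 0) := by
    have := i2.congr_fun c2 measurableSet_Ioi
    rw [integrableOn_Iic_iff_integrableOn_Iio]
    refine ((Measure.measurePreserving_neg (volume : Measure ℝ)).integrableOn_comp_preimage
      (MeasurableEquiv.neg ℝ).measurableEmbedding).1 ?_
    simpa [Function.comp_def] using this
  rw [← intervalIntegral.integral_Iic_add_Ioi j2 j1, e1, e2]
  push_cast
  ring

/-! ### Assembling solutions -/

lemma contDiffOn_one_of_hasDerivAt {S : Set ℝ} (hS : IsOpen S) {f f₁ : ℝ → ℝ}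
    (h1 : ∀ t ∈ S, HasDerivAt f (f₁ t) t) (hc : ContinuousOn f₁ S) :
    ContDiffOn ℝ (1 : ℕ) f S := by
  have h : ContDiffOn ℝ (0 + 1) f S := by
    rw [contDiffOn_succ_iff_deriv_of_isOpen hS]
    refine ⟨fun t ht => (h1 t ht).differentiableAt.differentiableWithinAt, by simp, ?_⟩
    exact (contDiffOn_zero.2 hc).congr fun t ht => (h1 t ht).deriv
  simpa using h

lemma contDiffOn_two_of_hasDerivAt {S : Set ℝ} (hS : IsOpen S) {f f₁ f₂ : ℝ → ℝ}
    (h1 : ∀ t ∈ S, HasDerivAt f (f₁ t) t) (h2 : ∀ t ∈ S, HasDerivAt f₁ (f₂ t) t)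
    (hc : ContinuousOn f₂ S) : ContDiffOn ℝ (2 : ℕ) f S := by
  have h : ContDiffOn ℝ (1 + 1) f S := by
    rw [contDiffOn_succ_iff_deriv_of_isOpen hS]
    refine ⟨fun t ht => (h1 t ht).differentiableAt.differentiableWithinAt, by simp, ?_⟩
    exact_mod_cast (contDiffOn_one_of_hasDerivAt hS h2 hc).congr fun t ht => (h1 t ht).deriv
  exact_mod_cast h

lemma iteratedDeriv_two_of_hasDerivAt {S : Set ℝ} (hS : IsOpen S) {f f₁ f₂ : ℝ → ℝ}
    (h1 : ∀ t ∈ S, HasDerivAt f (f₁ t) t) (h2 : ∀ t ∈ S, HasDerivAt f₁ (f₂ t) t) {t : ℝ}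
    (ht : t ∈ S) : iteratedDeriv 2 f t = f₂ t := by
  rw [iteratedDeriv_succ, iteratedDeriv_one]
  refine (HasDerivAt.congr_of_eventuallyEq (h2 t ht) ?_).deriv
  filter_upwards [hS.mem_nhds ht] with t' ht' using (h1 t' ht').deriv

/-- The derivative of order `⌈β⌉` for `0 < β < 2`, out of the first and the second one. -/
def orderDeriv (β : ℝ) (f₁ f₂ : ℝ → ℝ) : ℝ → ℝ := if β ≤ 1 then f₁ else f₂

lemma contDiffOn_ceil {β : ℝ} (hβ : 0 < β) (hβ2 : β < 2) {f f₁ f₂ : ℝ → ℝ}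
    (h1 : ∀ t ∈ Ioi (0 : ℝ), HasDerivAt f (f₁ t) t)
    (h2 : ∀ t ∈ Ioi (0 : ℝ), HasDerivAt f₁ (f₂ t) t) (hc : ContinuousOn f₂ (Ioi 0)) :
    ContDiffOn ℝ (⌈β⌉₊ : ℕ) f (Ioi 0) ∧
      EqOn (iteratedDeriv ⌈β⌉₊ f) (orderDeriv β f₁ f₂) (Ioi 0) := by
  rcases ceil_eq_one_or_two hβ hβ2 with ⟨hb, hm⟩ | ⟨hb, hm⟩
  · rw [hm, orderDeriv, if_pos hb]
    refine ⟨contDiffOn_one_of_hasDerivAt isOpen_Ioi h1 fun t ht =>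
      (h2 t ht).continuousAt.continuousWithinAt, fun t ht => ?_⟩
    rw [iteratedDeriv_one, (h1 t ht).deriv]
  · rw [hm, orderDeriv, if_neg hb.not_ge]
    exact ⟨contDiffOn_two_of_hasDerivAt isOpen_Ioi h1 h2 hc, fun t ht =>
      iteratedDeriv_two_of_hasDerivAt isOpen_Ioi h1 h2 ht⟩

/-- A function with continuous time derivatives whose derivative of order `⌈β⌉` has at most an
integrable power singularity at `t = 0` is a solution once it satisfies the equation. -/
lemma isSolution_of_hasDerivAt {β D γ : ℝ} (hβ : 0 < β) (hβ2 : β < 2) (hγ : γ < 1) {X : Set ℝ}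
    {u u₁ u₂ : ℝ → ℝ → ℝ} (h1 : ∀ x ∈ X, ∀ t ∈ Ioi (0 : ℝ), HasDerivAt (u x) (u₁ x t) t)
    (h2 : ∀ x ∈ X, ∀ t ∈ Ioi (0 : ℝ), HasDerivAt (u₁ x) (u₂ x t) t)
    (hc1 : ContinuousOn (fun p : ℝ × ℝ => u₁ p.1 p.2) (X ×ˢ Ioi 0))
    (hc2 : ContinuousOn (fun p : ℝ × ℝ => u₂ p.1 p.2) (X ×ˢ Ioi 0))
    (hb : ∀ K ⊆ X, IsCompact K → ∀ T : ℝ, 0 < T → ∃ C, ∀ x ∈ K, ∀ t ∈ Ioc 0 T,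
      |orderDeriv β (u₁ x) (u₂ x) t| ≤ C * t ^ (-γ))
    (hs : ∀ t : ℝ, 0 < t → ContDiffOn ℝ 2 (fun x => u x t) X)
    (he : ∀ x ∈ X, ∀ t : ℝ, 0 < t → caputo β (u x) t = D * iteratedDeriv 2 (fun y => u y t) x) :
    IsSolution β D X u := by
  have hc2' : ∀ x ∈ X, ContinuousOn (u₂ x) (Ioi 0) := fun x hx =>
    hc2.comp (f := fun t => (x, t)) (by fun_prop) fun t ht => ⟨hx, ht⟩
  have hcd := fun x hx => contDiffOn_ceil hβ hβ2 (h1 x hx) (h2 x hx) (hc2' x hx)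
  have hpow : ∀ T : ℝ, 0 < T → IntegrableOn (fun t : ℝ => t ^ (-γ)) (Ioc 0 T) := by
    intro T hT
    have := intervalIntegral.intervalIntegrable_rpow' (a := 0) (b := T) (r := -γ) (by linarith)
    rwa [intervalIntegrable_iff_integrableOn_Ioc_of_le hT.le] at this
  refine ⟨fun x hx => (hcd x hx).1, fun x hx T hT => ?_, fun K hKX hK T hT => ?_, hs, he⟩
  · obtain ⟨C, hC⟩ := hb {x} (by simpa using hx) isCompact_singleton T hT
    refine ((hpow T hT).const_mul C).mono' ?_ ?_
    · exact ((continuousOn_iteratedDeriv_Ioi (hcd x hx).1).mono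
        Ioc_subset_Ioi_self).aestronglyMeasurable measurableSet_Ioc
    · refine (ae_restrict_iff' measurableSet_Ioc).2 (ae_of_all _ fun t ht => ?_)
      rw [(hcd x hx).2 ht.1]
      exact hC x rfl t ht
  · obtain ⟨C, hC⟩ := hb K hKX hK T hT
    have hms : MeasurableSet (K ×ˢ Ioc (0 : ℝ) T) := hK.measurableSet.prod measurableSet_Ioc
    have heq : EqOn (fun p : ℝ × ℝ => orderDeriv β (u₁ p.1) (u₂ p.1) p.2)
        (fun p : ℝ × ℝ => iteratedDeriv ⌈β⌉₊ (u p.1) p.2) (K ×ˢ Ioc 0 T) := fun p hp =>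
      ((hcd p.1 (hKX hp.1)).2 hp.2.1).symm
    refine IntegrableOn.congr_fun ?_ heq hms
    have hcont : ContinuousOn (fun p : ℝ × ℝ => orderDeriv β (u₁ p.1) (u₂ p.1) p.2)
        (X ×ˢ Ioi 0) := by
      unfold orderDeriv
      split_ifs
      exacts [hc1, hc2]
    have hint : IntegrableOn (fun p : ℝ × ℝ => C * p.2 ^ (-γ)) (K ×ˢ Ioc 0 T) := by
      rw [IntegrableOn, Measure.volume_eq_prod, ← Measure.prod_restrict]
      have := Integrable.mul_prod (f := fun _ : ℝ => C) (g := fun t : ℝ => t ^ (-γ))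
        (μ := volume.restrict K) (ν := volume.restrict (Ioc 0 T))
        (integrableOn_const hK.measure_lt_top.ne) (hpow T hT)
      exact this
    refine Integrable.mono' hint ?_ ?_
    · exact (hcont.mono (prod_mono hKX Ioc_subset_Ioi_self)).aestronglyMeasurable hms
    · exact (ae_restrict_iff' hms).2 (ae_of_all _ fun p hp => hC p.1 hp.1 p.2 hp.2)

/-! ### The Cauchy kernel -/

section cauchy
variable {ν : ℝ} (h0 : 0 < ν) (h1 : ν < 1)
include h0 h1

/-- Self-similarity of the wave kernels. -/
lemma waveKernel_scale {μ : ℝ} (hμ : μ < 1) (x : ℝ) {t : ℝ} (ht : 0 < t) :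
    waveKernel ν μ x t = t ^ (μ - 1) * waveKernel ν μ (x * t ^ (-ν)) 1 := by
  have e1 := waveKernel_eq_wright h0 h1 hμ x ht
  have e2 := waveKernel_eq_wright h0 h1 hμ (x * t ^ (-ν)) one_pos
  simp only [Real.one_rpow, mul_one, Complex.ofReal_one, one_mul] at e2
  rw [← e2] at e1
  exact_mod_cast e1

lemma hasLaplace_waveKernel_of_nonneg {μ x : ℝ} (hμ0 : 0 < μ) (hμ : μ < 1) (hx : 0 ≤ x) {s : ℂ}
    (hs : 0 < s.re) :
    HasLaplace (waveKernel ν μ x) s (s ^ (-μ : ℂ) * Complex.exp (-x * s ^ (ν : ℂ))) := by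
  rcases hx.eq_or_lt with rfl | hx
  · simpa using (hasLaplace_powKernel hμ0 hs).congr fun t ht =>
      (waveKernel_zero_space h0 h1 hμ ht).symm
  · exact hasLaplace_waveKernel h0 h1 hμ hx hs

end cauchy

/-- The Green function of the Cauchy problem at time `1` for `D = 1`, that is `M_ν(|y|) / 2`. -/
def profile (ν y : ℝ) : ℝ := waveKernel ν (1 - ν) |y| 1 / 2

lemma profile_neg (ν y : ℝ) : profile ν (-y) = profile ν y := by simp [profile]

/-- The Green function of the Cauchy problem, through the kernel with Laplace transform
`s ^ (ν - 1) e ^ (-x s ^ ν)`. -/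
def cauchyKernel (ν D x t : ℝ) : ℝ := (2 * √D)⁻¹ * waveKernel ν (1 - ν) (|x| / √D) t

/-- The integral `∫ P(y) f(x - r y) dy`: the convolution of `f` with the kernel `P` stretched by the
factor `r`. For `r = √D t ^ ν` and `P` the profile it is the solution of the Cauchy problem. -/
def dilateConv (P : ℝ → ℝ) (f : SchwartzMap ℝ ℝ) (x r : ℝ) : ℝ := ∫ y, P y * f (x - r * y)

lemma hasDerivAt_dilateConv {P : ℝ → ℝ} (f : SchwartzMap ℝ ℝ) (hP : Integrable P)
    (hP1 : Integrable fun y => y * P y) (x r : ℝ) :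
    HasDerivAt (dilateConv P f x) (-dilateConv (fun y => y * P y) (sderiv f) x r) r := by
  have := hasDerivAt_integral_mul_schwartz (a := fun _ => x) (b := fun y => -y) f hP
    (hP1.neg.congr (ae_of_all _ fun y => by simp [mul_comm])) (by fun_prop) (by fun_prop) r
  simp only [mul_neg, ← sub_eq_add_neg] at this
  refine this.congr_deriv ?_
  rw [dilateConv, ← integral_neg]
  congr 1 with y
  ring

section cauchy
variable {ν D : ℝ} (h0 : 0 < ν) (h1 : ν < 1) (hD : 0 < D)
include h0 h1

lemma continuous_profile : Continuous (profile ν) := by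
  have hc := continuousOn_waveKernel h0 h1 (μ := 1 - ν) (by linarith)
  have : Continuous fun y : ℝ => waveKernel ν (1 - ν) |y| 1 := by
    rw [← continuousOn_univ]
    exact hc.comp (f := fun y : ℝ => (|y|, (1 : ℝ))) (by fun_prop) fun y _ =>
      ⟨abs_nonneg y, by simp⟩
  exact this.div_const 2

/-- The decay of order four comes from the bounds on the kernel in `x`; it makes the second moment of
the profile finite. -/
lemma exists_abs_profile_le : ∃ C : ℝ, ∀ y, |profile ν y| * (1 + y ^ 2) ^ 2 ≤ C := by
  have hμ : 1 - ν < 1 := by linarith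
  obtain ⟨C, hC0, hC⟩ := exists_abs_waveKernel_le_time h0 h1 hμ
  obtain ⟨B, hB0, hB⟩ := exists_abs_waveKernel_le h0 h1 hμ 3
  refine ⟨2 * C + 2 * B, fun y => ?_⟩
  rw [profile, abs_div, abs_two]
  rcases le_or_gt |y| 1 with hy | hy
  · have h2 := hC |y| 1 (abs_nonneg y) one_pos
    rw [Real.one_rpow, mul_one] at h2
    have h3 : y ^ 2 ≤ 1 := by rw [← sq_abs]; exact pow_le_one₀ (abs_nonneg y) hy
    have h4 : (1 + y ^ 2) ^ 2 ≤ 4 := by nlinarith [sq_nonneg y]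
    have h5 : |waveKernel ν (1 - ν) |y| 1| / 2 ≤ C / 2 := by linarith
    calc _ ≤ C / 2 * 4 := mul_le_mul h5 h4 (by positivity) (by positivity)
      _ ≤ _ := by linarith
  · have hy0 : 0 < |y| := by linarith
    have h2 := hB |y| 1 hy0 one_pos
    rw [one_pow, mul_one] at h2
    have h3 : |y| ^ (-((3 : ℕ) + 1 - (1 - ν)) / ν) ≤ |y| ^ (-4 : ℝ) := by
      refine Real.rpow_le_rpow_of_exponent_le hy.le ?_
      rw [div_le_iff₀ h0]
      push_cast
      linarith
    have h4 : |y| ^ (-4 : ℝ) * |y| ^ 4 = 1 := by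
      rw [Real.rpow_neg hy0.le]
      norm_cast
      exact inv_mul_cancel₀ (by positivity)
    have h5 : (1 + y ^ 2) ^ 2 ≤ 4 * |y| ^ 4 := by
      have : 1 ≤ |y| ^ 2 := one_le_pow₀ hy.le
      rw [← sq_abs y]
      nlinarith [sq_nonneg |y|]
    have h6 : |waveKernel ν (1 - ν) |y| 1| / 2 ≤ B * |y| ^ (-4 : ℝ) / 2 := by
      have := mul_le_mul_of_nonneg_left h3 hB0
      linarith
    calc _ ≤ B * |y| ^ (-4 : ℝ) / 2 * (4 * |y| ^ 4) :=
          mul_le_mul h6 h5 (by positivity) (by positivity)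
      _ = 2 * B * (|y| ^ (-4 : ℝ) * |y| ^ 4) := by ring
      _ ≤ _ := by rw [h4]; linarith

lemma integrable_profile_mul {a : ℝ → ℝ} (ha : Continuous a) (hb : ∀ y, |a y| ≤ 1 + y ^ 2) :
    Integrable fun y => a y * profile ν y := by
  obtain ⟨C, hC⟩ := exists_abs_profile_le h0 h1
  refine (integrable_inv_one_add_sq.const_mul C).mono'
    (ha.mul (continuous_profile h0 h1)).aestronglyMeasurable (ae_of_all _ fun y => ?_)
  have hp : 0 < 1 + y ^ 2 := by positivity
  rw [norm_mul, Real.norm_eq_abs, Real.norm_eq_abs, ← div_eq_mul_inv, le_div_iff₀ hp]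
  calc |a y| * |profile ν y| * (1 + y ^ 2) ≤ (1 + y ^ 2) * |profile ν y| * (1 + y ^ 2) := by
        gcongr; exact hb y
    _ = |profile ν y| * (1 + y ^ 2) ^ 2 := by ring
    _ ≤ C := hC y

lemma integrable_profile : Integrable (profile ν) := by
  simpa using integrable_profile_mul h0 h1 (a := fun _ => 1) continuous_const
    (fun y => by rw [abs_one]; nlinarith [sq_nonneg y])

lemma integrable_mul_profile : Integrable fun y => y * profile ν y :=
  integrable_profile_mul h0 h1 continuous_id fun y => by
    rw [abs_le]; constructor <;> nlinarith [sq_nonneg (y - 1), sq_nonneg (y + 1)]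

lemma integrable_mul_mul_profile : Integrable fun y => y * (y * profile ν y) := by
  have := integrable_profile_mul h0 h1 (a := fun y => y ^ 2) (by fun_prop) fun y => by
    rw [abs_of_nonneg (sq_nonneg y)]; linarith
  refine this.congr (ae_of_all _ fun y => ?_)
  simp only
  ring

omit h0 h1 in
lemma integral_mul_profile : ∫ y, y * profile ν y = 0 := by
  have h := integral_neg_eq_self (fun y => y * profile ν y) volume
  simp only [profile_neg, neg_mul, integral_neg] at h
  linarith

include hD

lemma cauchyKernel_eq_profile (x : ℝ) {t : ℝ} (ht : 0 < t) :
    cauchyKernel ν D x t = (√D * t ^ ν)⁻¹ * profile ν (x / (√D * t ^ ν)) := by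
  have hs : 0 < √D := Real.sqrt_pos.2 hD
  have hp : 0 < t ^ ν := Real.rpow_pos_of_pos ht ν
  rw [cauchyKernel, profile, waveKernel_scale h0 h1 (by linarith) _ ht, abs_div,
    abs_of_pos (mul_pos hs hp)]
  have e1 : 1 - ν - 1 = -ν := by ring
  have e2 : |x| / √D * t ^ (-ν) = |x| / (√D * t ^ ν) := by
    rw [Real.rpow_neg ht.le]; field_simp
  rw [e1, e2, Real.rpow_neg ht.le]
  field_simp

lemma integral_cauchyKernel_mul (F : ℝ → ℝ) {t : ℝ} (ht : 0 < t) :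
    ∫ ξ, cauchyKernel ν D ξ t * F ξ = ∫ y, profile ν y * F (√D * t ^ ν * y) := by
  have hc : 0 < √D * t ^ ν := mul_pos (Real.sqrt_pos.2 hD) (Real.rpow_pos_of_pos ht ν)
  have h := Measure.integral_comp_mul_left
    (fun ξ => profile ν (ξ / (√D * t ^ ν)) * F ξ) (√D * t ^ ν)
  simp only [mul_div_cancel_left₀ _ hc.ne'] at h
  rw [h, abs_of_pos (inv_pos.2 hc), smul_eq_mul, ← integral_const_mul]
  congr 1 with ξ
  rw [cauchyKernel_eq_profile h0 h1 hD ξ ht]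
  ring

lemma integrable_cauchyKernel {t : ℝ} (ht : 0 < t) : Integrable fun x => cauchyKernel ν D x t := by
  have hc : 0 < √D * t ^ ν := mul_pos (Real.sqrt_pos.2 hD) (Real.rpow_pos_of_pos ht ν)
  simp_rw [cauchyKernel_eq_profile h0 h1 hD _ ht]
  exact ((integrable_profile h0 h1).comp_div hc.ne').const_mul _

lemma integral_abs_cauchyKernel {t : ℝ} (ht : 0 < t) :
    ∫ x, |cauchyKernel ν D x t| = ∫ y, |profile ν y| := by
  have hc : 0 < √D * t ^ ν := mul_pos (Real.sqrt_pos.2 hD) (Real.rpow_pos_of_pos ht ν)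
  simp_rw [cauchyKernel_eq_profile h0 h1 hD _ ht, abs_mul, integral_const_mul]
  rw [Measure.integral_comp_div (fun y => |profile ν y|), smul_eq_mul, abs_of_pos hc,
    abs_of_pos (inv_pos.2 hc), inv_mul_cancel_left₀ hc.ne']

omit hD in
lemma continuousOn_cauchyKernel :
    ContinuousOn (fun p : ℝ × ℝ => cauchyKernel ν D p.1 p.2) (univ ×ˢ Ioi 0) := by
  have hc := continuousOn_waveKernel h0 h1 (μ := 1 - ν) (by linarith)
  exact continuousOn_const.mul (hc.comp (f := fun p : ℝ × ℝ => (|p.1| / √D, p.2))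
    (by fun_prop) fun p hp => ⟨by simp only [mem_Ici]; positivity, hp.2⟩)

omit hD in
lemma hasLaplace_cauchyKernel (x : ℝ) {s : ℂ} (hs : 0 < s.re) :
    HasLaplace (cauchyKernel ν D x) s (((2 * √D)⁻¹ : ℝ) *
      (s ^ (-(1 - ν : ℝ) : ℂ) * Complex.exp (-(|x| / √D : ℝ) * s ^ (ν : ℂ)))) :=
  (hasLaplace_waveKernel_of_nonneg h0 h1 (by linarith) (by linarith) (by positivity)
    hs).const_mul _

lemma integrable_exp_mul_cauchyKernel {σ : ℝ} (hσ : 0 < σ) :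
    Integrable (fun p : ℝ × ℝ => Real.exp (-σ * p.2) * cauchyKernel ν D p.1 p.2)
      (volume.prod (volume.restrict (Ioi 0))) := by
  have hm : AEStronglyMeasurable (fun p : ℝ × ℝ => Real.exp (-σ * p.2) * cauchyKernel ν D p.1 p.2)
      ((volume : Measure ℝ).prod (volume.restrict (Ioi 0))) := by
    have : ContinuousOn (fun p : ℝ × ℝ => Real.exp (-σ * p.2) * cauchyKernel ν D p.1 p.2)
        (univ ×ˢ Ioi 0) := ContinuousOn.mul (by fun_prop) (continuousOn_cauchyKernel h0 h1)
    have := this.aestronglyMeasurable (μ := (volume : Measure ℝ).prod volume)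
      (MeasurableSet.univ.prod measurableSet_Ioi)
    rwa [← Measure.prod_restrict, Measure.restrict_univ] at this
  rw [integrable_prod_iff' hm]
  refine ⟨(ae_restrict_iff' measurableSet_Ioi).2 (ae_of_all _ fun t ht =>
    (integrable_cauchyKernel h0 h1 hD ht).const_mul (Real.exp (-σ * t))), ?_⟩
  have : IntegrableOn (fun t => Real.exp (-σ * t) * ∫ y, |profile ν y|) (Ioi 0) :=
    (integrableOn_exp_mul_Ioi (by linarith) 0).mul_const _
  refine this.congr_fun (fun t ht => ?_) measurableSet_Ioi
  simp only [norm_mul, Real.norm_eq_abs, Real.abs_exp, integral_const_mul]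
  rw [integral_abs_cauchyKernel h0 h1 hD ht]

lemma integrableOn_exp_mul_cauchyKernel {σ : ℝ} (hσ : 0 < σ) :
    IntegrableOn (fun p : ℝ × ℝ => Real.exp (-σ * p.2) * cauchyKernel ν D p.1 p.2)
      (univ ×ˢ Ioi 0) := by
  rw [IntegrableOn, Measure.volume_eq_prod, ← Measure.prod_restrict, Measure.restrict_univ]
  exact integrable_exp_mul_cauchyKernel h0 h1 hD hσ

omit hD in
/-- The kernel has total mass one: its double integral against `e ^ (-t)` is computed in both
orders. -/
lemma integral_profile : ∫ y, profile ν y = 1 := by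
  have hi := integrable_exp_mul_cauchyKernel h0 h1 one_pos one_pos
  have h := integral_integral_swap (f := fun x t : ℝ => Real.exp (-1 * t) * cauchyKernel ν 1 x t) hi
  have e1 : ∀ x : ℝ, ∫ t in Ioi (0 : ℝ), Real.exp (-1 * t) * cauchyKernel ν 1 x t =
      2⁻¹ * Real.exp (-|x|) := by
    intro x
    have h2 := (hasLaplace_cauchyKernel h0 h1 (D := 1) x (s := 1) (by simp)).2
    rw [← Complex.ofReal_inj, ← integral_complex_ofReal]
    push_cast
    simpa using h2
  have e2 : ∫ t in Ioi (0 : ℝ), ∫ x, Real.exp (-1 * t) * cauchyKernel ν 1 x t =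
      ∫ t in Ioi (0 : ℝ), Real.exp (-1 * t) * ∫ y, profile ν y := by
    refine setIntegral_congr_fun measurableSet_Ioi fun t ht => ?_
    have := integral_cauchyKernel_mul h0 h1 one_pos (fun _ => 1) (mem_Ioi.1 ht)
    simp only [mul_one] at this
    simp only [integral_const_mul, this]
  have e3 : ∫ t in Ioi (0 : ℝ), Real.exp (-1 * t) = 1 := by
    simpa using integral_exp_neg_Ioi_zero
  rw [funext e1, e2, integral_mul_const, e3, one_mul, integral_const_mul,
    integral_comp_abs (f := fun x => Real.exp (-x)), integral_exp_neg_Ioi_zero] at h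
  linarith

omit hD in
/-- As the first moment of the profile vanishes, the convolution is `O(r)`. This is what makes the
time derivatives of the solution integrable, and `u_t` vanish, at `t = 0⁺`. -/
lemma abs_dilateConv_mul_profile_le {f : SchwartzMap ℝ ℝ} {C : ℝ} (hC : ∀ x, |sderiv f x| ≤ C)
    (x : ℝ) {r : ℝ} (hr : 0 ≤ r) : |dilateConv (fun y => y * profile ν y) f x r| ≤
      (∫ y, |y * (y * profile ν y)|) * C * r := by
  have hd := hasDerivAt_dilateConv f (integrable_mul_profile h0 h1)
    (integrable_mul_mul_profile h0 h1) x
  have h := convex_univ.norm_image_sub_le_of_norm_hasDerivWithin_le (s := univ)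
    (f := dilateConv (fun y => y * profile ν y) f x) (x := 0) (y := r)
    (C := (∫ y, |y * (y * profile ν y)|) * C) (fun r _ => (hd r).hasDerivWithinAt)
    (fun r _ => by
      rw [norm_neg]
      exact abs_integral_mul_schwartz_le hC (integrable_mul_mul_profile h0 h1))
    (mem_univ _) (mem_univ _)
  have e : dilateConv (fun y => y * profile ν y) f x 0 = 0 := by
    simp only [dilateConv, zero_mul, sub_zero, integral_mul_const, integral_mul_profile]
  rwa [e, sub_zero, sub_zero, Real.norm_eq_abs, Real.norm_eq_abs, abs_of_nonneg hr] at h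

end cauchy

/-! ### Solution of the Cauchy problem -/

lemma hasDerivAt_spread (D ν : ℝ) {t : ℝ} (ht : 0 < t) :
    HasDerivAt (fun t => √D * t ^ ν) (√D * (ν * t ^ (ν - 1))) t :=
  (Real.hasDerivAt_rpow_const (Or.inl ht.ne')).const_mul _

/-- A function of at most power growth `t ^ (-γ)` with `γ < 1` has a Laplace transform. -/
lemma exists_hasLaplace_of_le_rpow {f : ℝ → ℝ} {γ C : ℝ} (hγ : γ < 1) {s : ℂ} (hs : 0 < s.re)
    (hf : ContinuousOn f (Ioi 0)) (hb : ∀ t ∈ Ioi (0 : ℝ), |f t| ≤ C * t ^ (-γ)) :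
    ∃ A, HasLaplace f s A := by
  refine ⟨_, hasLaplace_of_integrableOn ?_⟩
  have hi : IntegrableOn (fun t : ℝ => t ^ (-γ) * Real.exp (-s.re * t ^ (1 : ℝ))) (Ioi 0) :=
    integrableOn_rpow_mul_exp_neg_mul_rpow (by linarith) one_pos hs
  refine Integrable.mono' (hi.const_mul C) (ContinuousOn.aestronglyMeasurable
    (ContinuousOn.mul (by fun_prop) hf) measurableSet_Ioi)
    ((ae_restrict_iff' measurableSet_Ioi).2 (ae_of_all _ fun t ht => ?_))
  rw [norm_mul, Real.norm_eq_abs, Real.norm_eq_abs, Real.abs_exp, Real.rpow_one]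
  have := mul_le_mul_of_nonneg_left (hb t ht) (Real.exp_pos (-s.re * t)).le
  linarith

lemma caputo_congr_iteratedDeriv {β : ℝ} {f g : ℝ → ℝ} {t : ℝ} (ht : 0 < t)
    (h : ∀ τ ∈ Ioc 0 t, iteratedDeriv ⌈β⌉₊ f τ = iteratedDeriv ⌈β⌉₊ g τ) :
    caputo β f t = caputo β g t := by
  by_cases hβ : β = (⌈β⌉₊ : ℝ)
  · rw [caputo_eq_iteratedDeriv hβ, caputo_eq_iteratedDeriv hβ, h t ⟨ht, le_rfl⟩]
  · rw [caputo_eq_rl hβ _ ht, caputo_eq_rl hβ _ ht]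
    exact rl_congr ht h

/-- The Caputo derivative only depends on the values at positive times. -/
lemma caputo_congr {β : ℝ} {f g : ℝ → ℝ} (h : EqOn f g (Ioi 0)) {t : ℝ} (ht : 0 < t) :
    caputo β f t = caputo β g t :=
  caputo_congr_iteratedDeriv ht fun _ hτ => h.iteratedDeriv_of_isOpen isOpen_Ioi _ hτ.1

lemma re_cpow_pos {ν : ℝ} (h0 : 0 < ν) (h1 : ν < 1) {s : ℂ} (hs : 0 < s.re) :
    0 < (s ^ (ν : ℂ)).re := by
  rw [Complex.cpow_def_of_ne_zero (ne_zero_of_re_pos hs), Complex.exp_re]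
  refine mul_pos (Real.exp_pos _) (Real.cos_pos_of_mem_Ioo ?_)
  have h := abs_lt.1 (cpow_log_line hs)
  rw [Complex.im_mul_ofReal]
  constructor <;> nlinarith [Real.pi_pos]

lemma mul_sq_cpow_div_sqrt (ν : ℝ) {D : ℝ} (hD : 0 < D) {s : ℂ} (hs : s ≠ 0) :
    D * (s ^ (ν : ℂ) / (√D : ℝ)) ^ 2 = s ^ ((2 * ν : ℝ) : ℂ) := by
  have hrr : ((√D : ℝ) : ℂ) * ((√D : ℝ) : ℂ) = D := by exact_mod_cast Real.mul_self_sqrt hD.le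
  rw [div_pow, sq, sq, hrr, mul_div_cancel₀ _ (by exact_mod_cast hD.ne'),
    ← Complex.cpow_add _ _ hs]
  congr 1
  push_cast
  ring

lemma integrable_exp_neg_mul_abs {a : ℝ} (ha : 0 < a) :
    Integrable fun ξ : ℝ => Real.exp (-a * |ξ|) := by
  have h1 : IntegrableOn (fun ξ : ℝ => Real.exp (-a * |ξ|)) (Ioi 0) :=
    (integrableOn_exp_mul_Ioi (by linarith : -a < 0) 0).congr_fun
      (fun ξ hξ => by simp only [abs_of_pos (mem_Ioi.1 hξ)]) measurableSet_Ioi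
  have h2 : IntegrableOn (fun ξ : ℝ => Real.exp (-a * |ξ|)) (Iic 0) :=
    (integrableOn_exp_mul_Iic ha 0).congr_fun
      (fun ξ hξ => by simp only [abs_of_nonpos (mem_Iic.1 hξ), neg_mul_neg]) measurableSet_Iic
  rw [← integrableOn_univ, ← Iic_union_Ioi (a := (0 : ℝ))]
  exact h2.union h1

section cauchy
variable {ν D : ℝ} (h0 : 0 < ν) (h1 : ν < 1) (hD : 0 < D)

/-- The first time derivative of the solution of the Cauchy problem. -/
def cauchyDeriv₁ (ν D : ℝ) (f : SchwartzMap ℝ ℝ) (x t : ℝ) : ℝ :=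
  -dilateConv (fun y => y * profile ν y) (sderiv f) x (√D * t ^ ν) * (√D * (ν * t ^ (ν - 1)))

/-- The second time derivative of the solution of the Cauchy problem. -/
def cauchyDeriv₂ (ν D : ℝ) (f : SchwartzMap ℝ ℝ) (x t : ℝ) : ℝ :=
  dilateConv (fun y => y * (y * profile ν y)) (sderiv (sderiv f)) x (√D * t ^ ν) *
      (√D * (ν * t ^ (ν - 1))) ^ 2 -
    dilateConv (fun y => y * profile ν y) (sderiv f) x (√D * t ^ ν) *
      (√D * (ν * ((ν - 1) * t ^ (ν - 2))))

include h0 h1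

lemma hasDerivAt_cauchy₁ (f : SchwartzMap ℝ ℝ) (x : ℝ) {t : ℝ} (ht : 0 < t) :
    HasDerivAt (fun t => dilateConv (profile ν) f x (√D * t ^ ν)) (cauchyDeriv₁ ν D f x t) t :=
  (hasDerivAt_dilateConv f (integrable_profile h0 h1) (integrable_mul_profile h0 h1) x _).comp t
    (hasDerivAt_spread D ν ht)

lemma hasDerivAt_cauchy₂ (f : SchwartzMap ℝ ℝ) (x : ℝ) {t : ℝ} (ht : 0 < t) :
    HasDerivAt (cauchyDeriv₁ ν D f x) (cauchyDeriv₂ ν D f x t) t := by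
  have ha := ((hasDerivAt_dilateConv (sderiv f) (integrable_mul_profile h0 h1)
    (integrable_mul_mul_profile h0 h1) x _).comp t (hasDerivAt_spread D ν ht)).neg
  have hb : HasDerivAt (fun t => √D * (ν * t ^ (ν - 1)))
      (√D * (ν * ((ν - 1) * t ^ (ν - 1 - 1)))) t :=
    ((Real.hasDerivAt_rpow_const (Or.inl ht.ne')).const_mul _).const_mul _
  refine (ha.mul hb).congr_deriv ?_
  have e : ν - 1 - 1 = ν - 2 := by ring
  rw [e, cauchyDeriv₂]
  simp only [Function.comp_apply, Pi.neg_apply]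
  ring

omit h1 in
lemma continuousOn_dilateConv_spread {P : ℝ → ℝ} (f : SchwartzMap ℝ ℝ) (hP : Integrable P) :
    ContinuousOn (fun p : ℝ × ℝ => dilateConv P f p.1 (√D * p.2 ^ ν)) (univ ×ˢ Ioi 0) :=
  (continuous_integral_mul_schwartz f hP).comp_continuousOn
    (f := fun p : ℝ × ℝ => (p.1, √D * p.2 ^ ν)) <| ContinuousOn.prodMk (by fun_prop) <|
      continuousOn_const.mul fun _ _ => ContinuousAt.continuousWithinAt <|
        ContinuousAt.rpow_const (by fun_prop) (Or.inr h0.le)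

omit h0 h1 in
lemma continuousOn_rpow_snd (a : ℝ) :
    ContinuousOn (fun p : ℝ × ℝ => p.2 ^ a) (univ ×ˢ Ioi 0) := fun p hp =>
  ContinuousAt.continuousWithinAt <|
    ContinuousAt.rpow_const (by fun_prop) (Or.inl (ne_of_gt hp.2))

lemma continuousOn_cauchyDeriv₁ (f : SchwartzMap ℝ ℝ) :
    ContinuousOn (fun p : ℝ × ℝ => cauchyDeriv₁ ν D f p.1 p.2) (univ ×ˢ Ioi 0) :=
  (continuousOn_dilateConv_spread h0 _ (integrable_mul_profile h0 h1)).neg.mul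
    (continuousOn_const.mul (continuousOn_const.mul (continuousOn_rpow_snd _)))

lemma continuousOn_cauchyDeriv₂ (f : SchwartzMap ℝ ℝ) :
    ContinuousOn (fun p : ℝ × ℝ => cauchyDeriv₂ ν D f p.1 p.2) (univ ×ˢ Ioi 0) :=
  ((continuousOn_dilateConv_spread h0 _ (integrable_mul_mul_profile h0 h1)).mul
    ((continuousOn_const.mul (continuousOn_const.mul (continuousOn_rpow_snd _))).pow 2)).sub
  ((continuousOn_dilateConv_spread h0 _ (integrable_mul_profile h0 h1)).mul
    (continuousOn_const.mul (continuousOn_const.mul (continuousOn_const.mul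
      (continuousOn_rpow_snd _)))))

include hD

/-- The singularities at `t = 0⁺` of the time derivatives: they grow like `t ^ (2 ν - j)`, so that the
derivative of order `⌈2 ν⌉` is integrable. -/
lemma exists_abs_cauchyDeriv_le (f : SchwartzMap ℝ ℝ) : ∃ C : ℝ, ∀ x t : ℝ, 0 < t →
    |cauchyDeriv₁ ν D f x t| ≤ C * t ^ (2 * ν - 1) ∧
      |cauchyDeriv₂ ν D f x t| ≤ C * t ^ (2 * ν - 2) := by
  obtain ⟨B, hB0, hB⟩ := schwartz_bounded (sderiv (sderiv f))
  set K := (∫ y, |y * (y * profile ν y)|) * B with hK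
  have hK0 : 0 ≤ K := mul_nonneg (integral_nonneg fun y => abs_nonneg _) hB0
  refine ⟨2 * (K * D), fun x t ht => ?_⟩
  have hs : √D * √D = D := Real.mul_self_sqrt hD.le
  have hs0 : 0 ≤ √D := Real.sqrt_nonneg D
  have hp := fun a : ℝ => Real.rpow_pos_of_pos ht a
  have hc : 0 ≤ √D * t ^ ν := mul_nonneg hs0 (hp ν).le
  have b1 := abs_dilateConv_mul_profile_le h0 h1 hB x hc
  have b2 : |dilateConv (fun y => y * (y * profile ν y)) (sderiv (sderiv f)) x (√D * t ^ ν)| ≤ K :=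
    abs_integral_mul_schwartz_le hB (integrable_mul_mul_profile h0 h1)
  rw [← hK] at b1
  have p1 : t ^ ν * t ^ (ν - 1) = t ^ (2 * ν - 1) := by
    rw [← Real.rpow_add ht]; congr 1; ring
  have p2 : t ^ ν * t ^ (ν - 2) = t ^ (2 * ν - 2) := by
    rw [← Real.rpow_add ht]; congr 1; ring
  have p3 : t ^ (ν - 1) * t ^ (ν - 1) = t ^ (2 * ν - 2) := by
    rw [← Real.rpow_add ht]; congr 1; ring
  have q1 : |√D * (ν * t ^ (ν - 1))| ≤ √D * t ^ (ν - 1) := by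
    rw [abs_of_nonneg (mul_nonneg hs0 (mul_nonneg h0.le (hp _).le))]
    gcongr
    exact mul_le_of_le_one_left (hp _).le h1.le
  have q2 : |√D * (ν * ((ν - 1) * t ^ (ν - 2)))| ≤ √D * t ^ (ν - 2) := by
    rw [abs_mul, abs_mul, abs_mul, abs_of_nonneg hs0, abs_of_pos h0, abs_of_pos (hp _),
      abs_of_neg (by linarith : ν - 1 < 0)]
    gcongr
    rw [← mul_assoc]
    exact mul_le_of_le_one_left (hp _).le (by nlinarith)
  constructor
  · rw [cauchyDeriv₁, abs_mul, abs_neg]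
    calc _ ≤ K * (√D * t ^ ν) * (√D * t ^ (ν - 1)) := by gcongr
      _ = K * (√D * √D) * (t ^ ν * t ^ (ν - 1)) := by ring
      _ = K * D * t ^ (2 * ν - 1) := by rw [hs, p1]
      _ ≤ _ := by
        have := mul_nonneg (mul_nonneg hK0 hD.le) (hp (2 * ν - 1)).le
        linarith
  · rw [cauchyDeriv₂]
    refine (abs_sub _ _).trans ?_
    rw [abs_mul, abs_mul, abs_pow]
    calc _ ≤ K * (√D * t ^ (ν - 1)) ^ 2 + K * (√D * t ^ ν) * (√D * t ^ (ν - 2)) := by gcongr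
      _ = K * (√D * √D) * (t ^ (ν - 1) * t ^ (ν - 1)) +
          K * (√D * √D) * (t ^ ν * t ^ (ν - 2)) := by ring
      _ = _ := by rw [hs, p2, p3]; ring

/-- In the Laplace domain the convolution with the Cauchy kernel solves
`D U'' = s ^ (2 ν) (U - f / s)`. -/
lemma laplace_cauchy_eq (f : SchwartzMap ℝ ℝ) (x : ℝ) {s : ℂ} (hs : 0 < s.re) {U V : ℂ}
    (hU : HasLaplace (fun t => ∫ ξ, cauchyKernel ν D ξ t * f (x - ξ)) s U)
    (hV : HasLaplace (fun t => ∫ ξ, cauchyKernel ν D ξ t * sderiv (sderiv f) (x - ξ)) s V) :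
    D * V = s ^ ((2 * ν : ℝ) : ℂ) * (U - f x * s⁻¹) := by
  have hs0 := ne_zero_of_re_pos hs
  have hr : 0 < √D := Real.sqrt_pos.2 hD
  have hrr : ((√D : ℝ) : ℂ) * ((√D : ℝ) : ℂ) = D := by exact_mod_cast Real.mul_self_sqrt hD.le
  have hr0 : ((√D : ℝ) : ℂ) ≠ 0 := by exact_mod_cast hr.ne'
  have hi := integrableOn_exp_mul_cauchyKernel h0 h1 hD hs
  have eL : ∀ ξ : ℝ, ∫ t in Ioi (0 : ℝ), Complex.exp (-s * t) * cauchyKernel ν D ξ t =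
      ((2 * √D)⁻¹ : ℝ) * (s ^ (-(1 - ν : ℝ) : ℂ) *
        Complex.exp (-(|ξ| / √D : ℝ) * s ^ (ν : ℂ))) := fun ξ =>
    (hasLaplace_cauchyKernel h0 h1 ξ hs).2
  set l : ℂ := s ^ (ν : ℂ) / (√D : ℝ) with hl
  set κ : ℂ := ((2 * √D)⁻¹ : ℝ) * s ^ (-(1 - ν : ℝ) : ℂ) with hκ
  have eL' : ∀ ξ : ℝ, ∫ t in Ioi (0 : ℝ), Complex.exp (-s * t) * cauchyKernel ν D ξ t =
      κ * Complex.exp (-l * (|ξ| : ℝ)) := by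
    intro ξ
    rw [eL, hκ, hl]
    rw [mul_assoc]
    congr 3
    push_cast
    field_simp
  have hlre : 0 < l.re := by
    rw [hl, Complex.div_ofReal_re]
    exact div_pos (re_cpow_pos h0 h1 hs) hr
  have eU := hU.unique (hasLaplace_space_conv hi f x)
  have eV := hV.unique (hasLaplace_space_conv hi (sderiv (sderiv f)) x)
  have hint : ∀ g : SchwartzMap ℝ ℝ, Integrable fun ξ : ℝ =>
      κ * Complex.exp (-l * (|ξ| : ℝ)) * (g (x - ξ) : ℂ) := by
    intro g
    obtain ⟨C, hC0, hC⟩ := schwartz_bounded (g : SchwartzMap ℝ ℝ)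
    have h2 : Integrable fun ξ : ℝ => ‖κ‖ * (C * Real.exp (-l.re * |ξ|)) :=
      ((integrable_exp_neg_mul_abs hlre).const_mul C).const_mul _
    refine h2.mono' (Continuous.aestronglyMeasurable (Continuous.mul (by fun_prop)
      (Complex.continuous_ofReal.comp (g.continuous.comp (by fun_prop))))) (ae_of_all _ fun ξ => ?_)
    rw [norm_mul, norm_mul, norm_exp_neg_mul_ofReal, Complex.norm_real, mul_assoc]
    refine mul_le_mul_of_nonneg_left ?_ (norm_nonneg _)
    rw [mul_comm C]
    exact mul_le_mul_of_nonneg_left (hC _) (Real.exp_pos _).le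
  have key := integral_exp_abs_mul_schwartz f hlre x
  have key2 : V - l ^ 2 * U = κ * -(2 * l * f x) := by
    rw [← key, eU, eV, ← integral_const_mul, ← integral_const_mul]
    simp only [eL']
    rw [← integral_sub (hint _) ((hint f).const_mul _)]
    congr 1 with ξ
    ring
  have hl2 : D * l ^ 2 = s ^ ((2 * ν : ℝ) : ℂ) := mul_sq_cpow_div_sqrt ν hD hs0
  have hκl : 2 * κ * l * D = s ^ ((2 * ν : ℝ) : ℂ) * s⁻¹ := by
    rw [hκ, hl, ← hrr, ← Complex.cpow_neg_one, ← Complex.cpow_add _ _ hs0]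
    have e : s ^ (((2 * ν : ℝ) : ℂ) + -1) = s ^ (-(1 - ν : ℝ) : ℂ) * s ^ (ν : ℂ) := by
      rw [← Complex.cpow_add _ _ hs0]
      congr 1
      push_cast
      ring
    rw [e]
    push_cast
    field_simp
  linear_combination (D : ℂ) * key2 + U * hl2 - f x * hκl

omit hD in
lemma contDiff_ceil_cauchy (hν2 : 0 < 2 * ν) (f : SchwartzMap ℝ ℝ) (x : ℝ) :
    ContDiffOn ℝ (⌈2 * ν⌉₊ : ℕ) (fun t => dilateConv (profile ν) f x (√D * t ^ ν)) (Ioi 0) ∧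
      EqOn (iteratedDeriv ⌈2 * ν⌉₊ (fun t => dilateConv (profile ν) f x (√D * t ^ ν)))
        (orderDeriv (2 * ν) (cauchyDeriv₁ ν D f x) (cauchyDeriv₂ ν D f x)) (Ioi 0) :=
  contDiffOn_ceil hν2 (by linarith) (fun t ht => hasDerivAt_cauchy₁ h0 h1 f x ht)
    (fun t ht => hasDerivAt_cauchy₂ h0 h1 f x ht)
    ((continuousOn_cauchyDeriv₂ h0 h1 f).comp (f := fun t => (x, t)) (by fun_prop)
      fun t ht => ⟨trivial, ht⟩)

lemma exists_abs_orderDeriv_cauchy_le (f : SchwartzMap ℝ ℝ) : ∃ C : ℝ, ∀ x t : ℝ, 0 < t →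
    |orderDeriv (2 * ν) (cauchyDeriv₁ ν D f x) (cauchyDeriv₂ ν D f x) t| ≤
      C * t ^ (-(⌈2 * ν⌉₊ - 2 * ν : ℝ)) := by
  obtain ⟨C, hC⟩ := exists_abs_cauchyDeriv_le h0 h1 hD f
  refine ⟨C, fun x t ht => ?_⟩
  rw [orderDeriv, neg_sub]
  rcases ceil_eq_one_or_two (by linarith : 0 < 2 * ν) (by linarith) with ⟨hb, hm⟩ | ⟨hb, hm⟩
  · rw [if_pos hb, hm]
    simpa using (hC x t ht).1
  · rw [if_neg hb.not_ge, hm]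
    simpa using (hC x t ht).2

omit hD in
lemma tendsto_cauchy_initial (f : SchwartzMap ℝ ℝ) (x : ℝ) :
    Tendsto (fun t => dilateConv (profile ν) f x (√D * t ^ ν)) (𝓝[>] 0) (𝓝 (f x)) := by
  have hc : Continuous fun t : ℝ => dilateConv (profile ν) f x (√D * t ^ ν) :=
    (continuous_integral_mul_schwartz f (integrable_profile h0 h1)).comp
      (f := fun t : ℝ => (x, √D * t ^ ν))
      (Continuous.prodMk continuous_const (continuous_const.mul
        (Real.continuous_rpow_const h0.le)))
  have := (hc.tendsto 0).mono_left (nhdsWithin_le_nhds (s := Ioi 0))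
  simpa [Real.zero_rpow h0.ne', dilateConv, integral_mul_const, integral_profile h0 h1] using this

lemma tendsto_cauchyDeriv₁ (hν : 1 < 2 * ν) (f : SchwartzMap ℝ ℝ) (x : ℝ) :
    Tendsto (cauchyDeriv₁ ν D f x) (𝓝[>] 0) (𝓝 0) := by
  obtain ⟨C, hC⟩ := exists_abs_cauchyDeriv_le h0 h1 hD f
  have h : Tendsto (fun t : ℝ => C * t ^ (2 * ν - 1)) (𝓝[>] 0) (𝓝 0) := by
    have := ((Real.continuousAt_rpow_const 0 (2 * ν - 1) (Or.inr (by linarith))).tendsto.mono_left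
      (nhdsWithin_le_nhds (s := Ioi 0))).const_mul C
    rwa [Real.zero_rpow (by linarith), mul_zero] at this
  exact squeeze_zero_norm' (eventually_nhdsWithin_of_forall fun t ht => (hC x t ht).1) h

lemma cauchyKernel_conv_eq (f : SchwartzMap ℝ ℝ) (x : ℝ) {t : ℝ} (ht : 0 < t) :
    ∫ ξ, cauchyKernel ν D ξ t * f (x - ξ) = dilateConv (profile ν) f x (√D * t ^ ν) :=
  integral_cauchyKernel_mul h0 h1 hD (fun ξ => f (x - ξ)) ht

/-- The fractional equation for the solution of the Cauchy problem, read off from its Laplace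
transform. -/
lemma caputo_cauchy_eq (f : SchwartzMap ℝ ℝ) (x : ℝ) {t : ℝ} (ht : 0 < t) :
    caputo (2 * ν) (fun t => dilateConv (profile ν) f x (√D * t ^ ν)) t =
      D * dilateConv (profile ν) (sderiv (sderiv f)) x (√D * t ^ ν) := by
  have hβ : 0 < 2 * ν := by linarith
  have hβ2 : 2 * ν < 2 := by linarith
  have hceil : 2 * ν ≤ ⌈2 * ν⌉₊ := Nat.le_ceil _
  have hceil1 : (⌈2 * ν⌉₊ : ℝ) < 2 * ν + 1 := Nat.ceil_lt_add_one hβ.le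
  obtain ⟨hcd, heq⟩ := contDiff_ceil_cauchy h0 h1 (D := D) hβ f x
  obtain ⟨C, hC⟩ := exists_abs_orderDeriv_cauchy_le h0 h1 hD f
  have hb : ∀ t ∈ Ioi (0 : ℝ), |iteratedDeriv ⌈2 * ν⌉₊
      (fun t => dilateConv (profile ν) f x (√D * t ^ ν)) t| ≤
        C * t ^ (-(⌈2 * ν⌉₊ - 2 * ν : ℝ)) := fun t ht => by
    rw [heq ht]; exact hC x t ht
  have hci := continuousOn_iteratedDeriv_Ioi hcd
  refine caputo_eq_of_hasLaplace (γ := ⌈2 * ν⌉₊ - 2 * ν) (σ := 1) (by linarith) (by linarith) hβ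
    one_pos hcd (fun T _ => ⟨C, fun τ hτ => hb τ hτ.1⟩)
    (ψ := fun t => D * dilateConv (profile ν) (sderiv (sderiv f)) x (√D * t ^ ν)) ?_
    (fun s hs => ?_) ht
  · exact continuousOn_const.mul ((continuousOn_dilateConv_spread h0 _
      (integrable_profile h0 h1)).comp (f := fun t => (x, t)) (by fun_prop) fun t ht =>
        ⟨trivial, ht⟩)
  · have hs0 : 0 < s.re := by rw [hs]; exact one_pos
    have hsne := ne_zero_of_re_pos hs0
    obtain ⟨A, hA⟩ := exists_hasLaplace_of_le_rpow (by linarith) hs0 hci hb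
    have hi := integrableOn_exp_mul_cauchyKernel h0 h1 hD hs0
    have hU := hasLaplace_space_conv hi f x
    have hV := hasLaplace_space_conv hi (sderiv (sderiv f)) x
    have key := laplace_cauchy_eq h0 h1 hD f x hs0 hU hV
    have hint : ∀ t : ℝ, 0 < t → IntegrableOn (iteratedDeriv ⌈2 * ν⌉₊
        (fun t => dilateConv (profile ν) f x (√D * t ^ ν))) (Ioc 0 t) := by
      intro t ht
      have hp := intervalIntegral.intervalIntegrable_rpow' (a := 0) (b := t)
        (r := -(⌈2 * ν⌉₊ - 2 * ν : ℝ)) (by linarith)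
      rw [intervalIntegrable_iff_integrableOn_Ioc_of_le ht.le] at hp
      exact (hp.const_mul C).mono' ((hci.mono Ioc_subset_Ioi_self).aestronglyMeasurable
        measurableSet_Ioc) ((ae_restrict_iff' measurableSet_Ioc).2 (ae_of_all _ fun τ hτ =>
          hb τ hτ.1))
    have hm : (0 : ℝ) < ⌈2 * ν⌉₊ := by linarith
    have hsub : HasLaplace (rl ⌈2 * ν⌉₊ (iteratedDeriv ⌈2 * ν⌉₊
        (fun t => dilateConv (profile ν) f x (√D * t ^ ν)))) s (_ - f x * s⁻¹) :=
      (hU.sub ((hasLaplace_one hs0).const_mul (f x))).congr fun t ht => by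
        rw [rl_iteratedDeriv hβ hβ2 ht hcd (hint t ht) (tendsto_cauchy_initial h0 h1 f x)
          fun h => (tendsto_cauchyDeriv₁ h0 h1 hD h f x).congr' (eventually_nhdsWithin_of_forall
            fun t ht => (hasDerivAt_cauchy₁ h0 h1 f x ht).deriv.symm)]
        simp only [mul_one, cauchyKernel_conv_eq h0 h1 hD f x (mem_Ioi.1 ht)]
    have eA := hsub.unique (hasLaplace_rl hm hs0 hA)
    refine ⟨A, hA, ?_⟩
    rw [eA] at key
    have e : s ^ (-((⌈2 * ν⌉₊ : ℂ) - ((2 * ν : ℝ) : ℂ))) * A =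
        D * (∫ ξ, (∫ t in Ioi (0 : ℝ), Complex.exp (-s * t) * cauchyKernel ν D ξ t) *
          sderiv (sderiv f) (x - ξ)) := by
      rw [key, ← mul_assoc, ← Complex.cpow_add _ _ hsne]
      congr 2
      push_cast
      ring
    rw [e]
    exact (hV.const_mul D).congr fun t ht => by
      simp only [cauchyKernel_conv_eq h0 h1 hD _ x (mem_Ioi.1 ht)]

/-- The Cauchy kernel is a Green function of the Cauchy problem. -/
lemma isCauchyGreen_of_eq {G : ℝ → ℝ → ℝ} (hG : ∀ x t, 0 < t → G x t = cauchyKernel ν D x t) :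
    IsCauchyGreen (2 * ν) D G := by
  have hβ : 0 < 2 * ν := by linarith
  have hceil1 : (⌈2 * ν⌉₊ : ℝ) < 2 * ν + 1 := Nat.ceil_lt_add_one hβ.le
  have hGt : ∀ t, 0 < t → (fun x => G x t) = fun x => cauchyKernel ν D x t := fun t ht =>
    funext fun x => hG x t ht
  have hms : MeasurableSet ((univ : Set ℝ) ×ˢ Ioi (0 : ℝ)) :=
    MeasurableSet.univ.prod measurableSet_Ioi
  refine ⟨(continuousOn_cauchyKernel h0 h1).congr fun p hp => hG _ _ hp.2,
    fun t ht => by rw [hGt t ht]; exact integrable_cauchyKernel h0 h1 hD ht,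
    ⟨1, (integrableOn_exp_mul_cauchyKernel h0 h1 hD one_pos).congr_fun (fun p hp => by
      simp only [hG _ _ hp.2]) hms⟩, fun f => ?_⟩
  have hu : ∀ x, ∀ t ∈ Ioi (0 : ℝ), ∫ ξ, G ξ t * f (x - ξ) =
      dilateConv (profile ν) f x (√D * t ^ ν) := fun x t ht => by
    simp only [hG _ _ (mem_Ioi.1 ht)]
    exact cauchyKernel_conv_eq h0 h1 hD f x ht
  have hd : ∀ x, ∀ t ∈ Ioi (0 : ℝ), HasDerivAt (fun t => ∫ ξ, G ξ t * f (x - ξ))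
      (cauchyDeriv₁ ν D f x t) t := fun x t ht =>
    (hasDerivAt_cauchy₁ h0 h1 f x ht).congr_of_eventuallyEq <| by
      filter_upwards [Ioi_mem_nhds ht] with t' ht' using hu x t' ht'
  have hint : ∀ t, 0 < t → Integrable fun ξ => G ξ t := fun t ht => by
    rw [hGt t ht]; exact integrable_cauchyKernel h0 h1 hD ht
  refine ⟨?_, fun x => ?_, fun h x => ?_, fun t ht => ?_, fun t ht => ?_⟩
  · refine isSolution_of_hasDerivAt (γ := ⌈2 * ν⌉₊ - 2 * ν) (u₁ := cauchyDeriv₁ ν D f)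
      (u₂ := cauchyDeriv₂ ν D f) hβ (by linarith) (by linarith) (fun x _ => hd x)
      (fun x _ t ht => hasDerivAt_cauchy₂ h0 h1 f x ht)
      (continuousOn_cauchyDeriv₁ h0 h1 f) (continuousOn_cauchyDeriv₂ h0 h1 f)
      (fun K _ _ T _ => ?_) (fun t ht => ?_) (fun x _ t ht => ?_)
    · obtain ⟨C, hC⟩ := exists_abs_orderDeriv_cauchy_le h0 h1 hD f
      exact ⟨C, fun x _ t ht => hC x t ht.1⟩
    · exact (contDiff_schwartz_conv (hint t ht) 2 f).contDiffOn
    · rw [iteratedDeriv_two_schwartz_conv f (hint t ht)]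
      have e : ∫ ξ, G ξ t * sderiv (sderiv f) (x - ξ) =
          dilateConv (profile ν) (sderiv (sderiv f)) x (√D * t ^ ν) := by
        simp only [hG _ _ ht]
        exact cauchyKernel_conv_eq h0 h1 hD _ x ht
      rw [e, ← caputo_cauchy_eq h0 h1 hD f x ht]
      exact caputo_congr (hu x) ht
  · exact (tendsto_cauchy_initial h0 h1 f x).congr' (eventually_nhdsWithin_of_forall
      fun t ht => (hu x t ht).symm)
  · exact (tendsto_cauchyDeriv₁ h0 h1 hD h f x).congr' (eventually_nhdsWithin_of_forall
      fun t ht => (hd x t ht).deriv.symm)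
  · exact tendsto_schwartz_conv f (hint t ht) fun ξ =>
      (tendsto_atTop_add_const_right _ (-ξ) tendsto_id).mono_right atTop_le_cocompact
  · exact tendsto_schwartz_conv f (hint t ht) fun ξ =>
      (tendsto_atBot_add_const_right _ (-ξ) tendsto_id).mono_right atBot_le_cocompact

end cauchy

/-! ### Convolution in time with a wave kernel -/

/-- The convolution in time of `g` with the kernel `waveKernel ν μ x`. -/
def duhamel (ν μ : ℝ) (g : ℝ → ℝ) (x t : ℝ) : ℝ :=
  ∫ τ in (0 : ℝ)..t, g τ * waveKernel ν μ x (t - τ)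

lemma integral_waveKernel_mul_eq_duhamel (ν μ : ℝ) (g : ℝ → ℝ) (x t : ℝ) :
    ∫ τ in (0 : ℝ)..t, waveKernel ν μ x τ * g (t - τ) = duhamel ν μ g x t := by
  have h := intervalIntegral.integral_comp_sub_left (a := 0) (b := t)
    (fun τ => waveKernel ν μ x τ * g (t - τ)) t
  rw [sub_self, sub_zero] at h
  rw [← h, duhamel]
  simp only [sub_sub_cancel, mul_comm]

lemma waveKernel_of_nonpos (ν μ x : ℝ) {t : ℝ} (ht : t ≤ 0) : waveKernel ν μ x t = 0 :=
  if_neg ht.not_gt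

lemma exists_abs_le_of_continuous {g : ℝ → ℝ} (hg : Continuous g) (T : ℝ) :
    ∃ M, 0 ≤ M ∧ ∀ τ ∈ Icc 0 T, |g τ| ≤ M := by
  obtain ⟨M, hM⟩ := isCompact_Icc.exists_bound_of_continuousOn (hg.continuousOn (s := Icc 0 T))
  exact ⟨|M|, abs_nonneg M, fun τ hτ => (hM τ hτ).trans (le_abs_self M)⟩

section duhamel
variable {ν μ : ℝ} (h0 : 0 < ν) (h1 : ν < 1) (hμ : μ < 1)
include h0 h1 hμ

lemma exists_abs_waveKernel_le_space : ∃ C : ℝ, 0 ≤ C ∧ ∀ x t : ℝ, 0 < x →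
    |waveKernel ν μ x t| ≤ C * x ^ (-(1 - μ) / ν) := by
  obtain ⟨C, hC0, hC⟩ := exists_abs_waveKernel_le_space_zero h0 h1 hμ
  refine ⟨C, hC0, fun x t hx => ?_⟩
  rcases le_or_gt t 0 with ht | ht
  · rw [waveKernel_of_nonpos _ _ _ ht, abs_zero]
    exact mul_nonneg hC0 (Real.rpow_nonneg hx.le _)
  · exact hC x t hx ht

lemma exists_abs_waveKernel_le_of_le {δ : ℝ} (hδ : 0 < δ) : ∃ C : ℝ, 0 ≤ C ∧ ∀ x t : ℝ, δ ≤ x →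
    |waveKernel ν μ x t| ≤ C := by
  obtain ⟨C, hC0, hC⟩ := exists_abs_waveKernel_le_space h0 h1 hμ
  refine ⟨C * δ ^ (-(1 - μ) / ν), mul_nonneg hC0 (Real.rpow_nonneg hδ.le _), fun x t hx => ?_⟩
  refine (hC x t (hδ.trans_le hx)).trans (mul_le_mul_of_nonneg_left ?_ hC0)
  refine Real.rpow_le_rpow_of_nonpos hδ hx ?_
  exact div_nonpos_of_nonpos_of_nonneg (by linarith) h0.le

lemma continuous_waveKernel_time {x : ℝ} (hx : 0 < x) : Continuous (waveKernel ν μ x) := by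
  rw [← continuousOn_univ]
  exact (continuousOn_waveKernel_extend h0 h1 hμ).comp (f := fun t : ℝ => (x, t)) (by fun_prop)
    fun t _ => ⟨hx, trivial⟩

variable {g : ℝ → ℝ} (hg : Continuous g)
include hg

/-- As the kernel vanishes at negative times, the upper limit of the convolution may be raised. -/
lemma duhamel_eq {x t T : ℝ} (hx : 0 < x) (htT : t ≤ T) :
    duhamel ν μ g x t = ∫ τ in (0 : ℝ)..T, g τ * waveKernel ν μ x (t - τ) := by
  have hc : Continuous fun τ => g τ * waveKernel ν μ x (t - τ) :=
    hg.mul ((continuous_waveKernel_time h0 h1 hμ hx).comp (by fun_prop))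
  have h : ∫ τ in t..T, g τ * waveKernel ν μ x (t - τ) = 0 := by
    rw [← intervalIntegral.integral_zero (a := t) (b := T) (μ := volume)]
    refine intervalIntegral.integral_congr fun τ hτ => ?_
    rw [uIcc_of_le htT] at hτ
    simp only [waveKernel_of_nonpos ν μ x (by linarith [hτ.1] : t - τ ≤ 0), mul_zero]
  rw [← intervalIntegral.integral_add_adjacent_intervals (hc.intervalIntegrable 0 t)
    (hc.intervalIntegrable t T), h, add_zero, duhamel]

lemma exists_abs_duhamel_le {δ T : ℝ} (hδ : 0 < δ) : ∃ C, 0 ≤ C ∧ ∀ x t, δ ≤ x → t ∈ Icc 0 T →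
    |duhamel ν μ g x t| ≤ C * t := by
  obtain ⟨M, hM0, hM⟩ := exists_abs_le_of_continuous hg T
  obtain ⟨C, hC0, hC⟩ := exists_abs_waveKernel_le_of_le h0 h1 hμ hδ
  refine ⟨M * C, mul_nonneg hM0 hC0, fun x t hx ht => ?_⟩
  have := intervalIntegral.norm_integral_le_of_norm_le_const (a := 0) (b := t) (C := M * C)
    (f := fun τ => g τ * waveKernel ν μ x (t - τ)) fun τ hτ => by
      rw [uIoc_of_le ht.1] at hτ
      rw [norm_mul]
      exact mul_le_mul (hM τ ⟨hτ.1.le, hτ.2.trans ht.2⟩) (hC x _ hx) (norm_nonneg _) hM0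
  rwa [sub_zero, abs_of_nonneg ht.1] at this

lemma continuousOn_duhamel :
    ContinuousOn (fun p : ℝ × ℝ => duhamel ν μ g p.1 p.2) (Ioi 0 ×ˢ Ioi 0) := by
  rintro ⟨x, t⟩ ⟨hx, ht⟩
  simp only [mem_Ioi] at hx ht
  refine ContinuousAt.continuousWithinAt ?_
  obtain ⟨M, hM0, hM⟩ := exists_abs_le_of_continuous hg (t + 1)
  obtain ⟨C, hC0, hC⟩ := exists_abs_waveKernel_le_of_le h0 h1 hμ (half_pos hx)
  have hN : Ioi (x / 2) ×ˢ Iio (t + 1) ∈ 𝓝 (x, t) :=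
    prod_mem_nhds (Ioi_mem_nhds (by linarith)) (Iio_mem_nhds (by linarith))
  have h : ContinuousAt (fun p : ℝ × ℝ => ∫ τ in (0 : ℝ)..(t + 1),
      g τ * waveKernel ν μ p.1 (p.2 - τ)) (x, t) := by
    refine intervalIntegral.continuousAt_of_dominated_interval (bound := fun _ => M * C) ?_ ?_
      intervalIntegrable_const (ae_of_all _ fun τ _ => ?_)
    · filter_upwards [hN] with p hp
      exact (hg.mul ((continuous_waveKernel_time h0 h1 hμ (by linarith [mem_Ioi.1 hp.1])).comp
        (by fun_prop))).aestronglyMeasurable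
    · filter_upwards [hN] with p hp
      refine ae_of_all _ fun τ hτ => ?_
      rw [uIoc_of_le (by linarith)] at hτ
      rw [norm_mul]
      exact mul_le_mul (hM τ ⟨hτ.1.le, hτ.2⟩) (hC _ _ (mem_Ioi.1 hp.1).le) (norm_nonneg _) hM0
    · refine continuousAt_const.mul (ContinuousAt.comp (f := fun p : ℝ × ℝ => (p.1, p.2 - τ))
        (g := fun p : ℝ × ℝ => waveKernel ν μ p.1 p.2) ?_ (by fun_prop))
      exact (continuousOn_waveKernel_extend h0 h1 hμ).continuousAt
        (prod_mem_nhds (Ioi_mem_nhds hx) univ_mem)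
  refine h.congr ?_
  filter_upwards [hN] with p hp
  exact (duhamel_eq h0 h1 hμ hg (by linarith [mem_Ioi.1 hp.1]) (mem_Iio.1 hp.2).le).symm

lemma hasDerivAt_duhamel_time {x t : ℝ} (hx : 0 < x) :
    HasDerivAt (duhamel ν μ g x) (duhamel ν (μ - 1) g x t) t := by
  have hμ' : μ - 1 < 1 := by linarith
  set T := max (t + 1) 0
  have hT : t + 1 ≤ T := le_max_left _ _
  obtain ⟨M, hM0, hM⟩ := exists_abs_le_of_continuous hg T
  obtain ⟨C, hC0, hC⟩ := exists_abs_waveKernel_le_of_le h0 h1 hμ' hx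
  have hc : ∀ (μ' : ℝ) (_ : μ' < 1) (t : ℝ), Continuous fun τ => g τ * waveKernel ν μ' x (t - τ) :=
    fun μ' h t => hg.mul ((continuous_waveKernel_time h0 h1 h hx).comp (by fun_prop))
  have h := (intervalIntegral.hasDerivAt_integral_of_dominated_loc_of_deriv_le (μ := volume)
    (a := 0) (b := T) (s := univ) (x₀ := t)
    (F := fun t τ => g τ * waveKernel ν μ x (t - τ))
    (F' := fun t τ => g τ * waveKernel ν (μ - 1) x (t - τ)) (bound := fun _ => M * C) univ_mem
    (Eventually.of_forall fun t => (hc μ hμ t).aestronglyMeasurable)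
    ((hc μ hμ t).intervalIntegrable _ _) (hc _ hμ' t).aestronglyMeasurable
    (ae_of_all _ fun τ hτ t _ => by
      rw [uIoc_of_le (le_max_right _ _)] at hτ
      rw [norm_mul]
      exact mul_le_mul (hM τ ⟨hτ.1.le, hτ.2⟩) (hC x _ le_rfl) (norm_nonneg _) hM0)
    intervalIntegrable_const (ae_of_all _ fun τ _ t _ => by
      have := (hasDerivAt_waveKernel_time h0 h1 hμ (t - τ) hx).comp t
        ((hasDerivAt_id t).sub_const τ)
      rw [mul_one] at this
      exact this.const_mul _)).2
  rw [← duhamel_eq h0 h1 hμ' hg hx (by linarith)] at h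
  refine h.congr_of_eventuallyEq ?_
  filter_upwards [Iio_mem_nhds (lt_add_one t)] with t' ht'
  exact duhamel_eq h0 h1 hμ hg hx (ht'.le.trans hT)

lemma hasDerivAt_duhamel_space {x t : ℝ} (hx : 0 < x) (ht : 0 < t) :
    HasDerivAt (fun x => duhamel ν μ g x t) (-duhamel ν (μ - ν) g x t) x := by
  have hμ' : μ - ν < 1 := by linarith
  obtain ⟨M, hM0, hM⟩ := exists_abs_le_of_continuous hg t
  obtain ⟨C, hC0, hC⟩ := exists_abs_waveKernel_le_of_le h0 h1 hμ' (half_pos hx)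
  have hc : ∀ (μ' : ℝ) (_ : μ' < 1) (x : ℝ) (_ : 0 < x),
      Continuous fun τ => g τ * waveKernel ν μ' x (t - τ) :=
    fun μ' h x hx => hg.mul ((continuous_waveKernel_time h0 h1 h hx).comp (by fun_prop))
  have h := (intervalIntegral.hasDerivAt_integral_of_dominated_loc_of_deriv_le (μ := volume)
    (a := 0) (b := t) (s := Ioi (x / 2)) (x₀ := x)
    (F := fun x τ => g τ * waveKernel ν μ x (t - τ))
    (F' := fun x τ => -(g τ * waveKernel ν (μ - ν) x (t - τ))) (bound := fun _ => M * C)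
    (Ioi_mem_nhds (by linarith))
    (by filter_upwards [Ioi_mem_nhds hx] with x hx using (hc μ hμ x hx).aestronglyMeasurable)
    ((hc μ hμ x hx).intervalIntegrable _ _) (hc _ hμ' x hx).neg.aestronglyMeasurable
    (ae_of_all _ fun τ hτ y hy => by
      rw [uIoc_of_le ht.le] at hτ
      rw [norm_neg, norm_mul]
      exact mul_le_mul (hM τ ⟨hτ.1.le, hτ.2⟩) (hC y _ (mem_Ioi.1 hy).le) (norm_nonneg _) hM0)
    intervalIntegrable_const (ae_of_all _ fun τ _ y hy => by
      have := (hasDerivAt_waveKernel_space h0 h1 hμ (t - τ)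
        (by linarith [mem_Ioi.1 hy] : 0 < y)).const_mul (g τ)
      rwa [mul_neg] at this)).2
  rwa [intervalIntegral.integral_neg] at h

end duhamel

section signalling
variable {ν : ℝ} (h0 : 0 < ν) (h1 : ν < 1) {g : ℝ → ℝ} (hg : Continuous g)
include h0 h1 hg

lemma contDiffOn_ceil_duhamel {x : ℝ} (hx : 0 < x) :
    ContDiffOn ℝ (⌈2 * ν⌉₊ : ℕ) (duhamel ν 0 g x) (Ioi 0) ∧
      EqOn (iteratedDeriv ⌈2 * ν⌉₊ (duhamel ν 0 g x)) (duhamel ν (-⌈2 * ν⌉₊) g x) (Ioi 0) := by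
  have e : (-2 : ℝ) = -1 - 1 := by norm_num
  have h := contDiffOn_ceil (by linarith : 0 < 2 * ν) (by linarith)
    (f := duhamel ν 0 g x) (f₁ := duhamel ν (-1) g x) (f₂ := duhamel ν (-2) g x)
    (fun t _ => by simpa using hasDerivAt_duhamel_time h0 h1 zero_lt_one hg hx)
    (fun t _ => by rw [e]; exact hasDerivAt_duhamel_time h0 h1 (by norm_num) hg hx)
    ((continuousOn_duhamel h0 h1 (by norm_num) hg).comp (f := fun t => (x, t)) (by fun_prop)
      fun t ht => ⟨hx, ht⟩)
  refine ⟨h.1, fun t ht => (h.2 ht).trans ?_⟩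
  rw [orderDeriv]
  rcases ceil_eq_one_or_two (by linarith : 0 < 2 * ν) (by linarith) with ⟨hb, hm⟩ | ⟨hb, hm⟩
  · rw [if_pos hb, hm, Nat.cast_one]
  · rw [if_neg hb.not_ge, hm, Nat.cast_two]

lemma hasLaplace_duhamel {μ x : ℝ} (hμ : μ < 1) (hx : 0 < x) {M : ℝ} (hM : ∀ t, |g t| ≤ M) {s : ℂ}
    (hs : 0 < s.re) : HasLaplace (duhamel ν μ g x) s
      ((∫ t in Ioi (0 : ℝ), Complex.exp (-s * t) * g t) *
        (s ^ (-μ : ℂ) * Complex.exp (-x * s ^ (ν : ℂ)))) := by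
  refine HasLaplace.conv (hasLaplace_of_integrableOn ?_) (hasLaplace_waveKernel h0 h1 hμ hx hs)
  exact (integrableOn_exp_mul_Ioi (by linarith : -s.re < 0) 0).mul_bdd
    hg.aestronglyMeasurable (ae_of_all _ hM)

/-- The Caputo derivative of order `2 ν` in time multiplies the Laplace transform by `s ^ (2 ν)`, as
does the passage from the kernel of parameter `0` to the one of parameter `-2 ν`. -/
lemma caputo_duhamel_of_bounded {x : ℝ} (hx : 0 < x) {M : ℝ} (hM : ∀ t, |g t| ≤ M) {t : ℝ}
    (ht : 0 < t) : caputo (2 * ν) (duhamel ν 0 g x) t = duhamel ν (-(2 * ν)) g x t := by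
  have hβ : 0 < 2 * ν := by linarith
  have hm : (-⌈2 * ν⌉₊ : ℝ) < 1 := by
    have : (0 : ℝ) ≤ ⌈2 * ν⌉₊ := by positivity
    linarith
  obtain ⟨hcd, heq⟩ := contDiffOn_ceil_duhamel h0 h1 hg hx
  refine caputo_eq_of_hasLaplace (γ := 0) (σ := 1)
    (ψ := duhamel ν (-(2 * ν)) g x) le_rfl one_pos hβ one_pos hcd (fun T hT => ?_)
    ((continuousOn_duhamel h0 h1 (by linarith) hg).comp (f := fun t => (x, t)) (by fun_prop)
      fun t ht => ⟨hx, ht⟩) (fun s hs => ?_) ht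
  · obtain ⟨C, hC0, hC⟩ := exists_abs_duhamel_le h0 h1 hm hg hx (T := T)
    refine ⟨C * T, fun τ hτ => ?_⟩
    rw [neg_zero, Real.rpow_zero, mul_one, heq hτ.1]
    exact (hC x τ le_rfl ⟨hτ.1.le, hτ.2⟩).trans (mul_le_mul_of_nonneg_left hτ.2 hC0)
  · have hs0 : 0 < s.re := by rw [hs]; exact one_pos
    refine ⟨_, (hasLaplace_duhamel h0 h1 hg hm hx hM hs0).congr heq.symm, ?_⟩
    have := hasLaplace_duhamel h0 h1 hg (by linarith : -(2 * ν) < 1) hx hM hs0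
    convert this using 1
    have e : s ^ (-((-(2 * ν) : ℝ) : ℂ)) = s ^ (-((⌈2 * ν⌉₊ : ℂ) - ((2 * ν : ℝ) : ℂ))) *
        s ^ (-((-⌈2 * ν⌉₊ : ℝ) : ℂ)) := by
      rw [← Complex.cpow_add _ _ (ne_zero_of_re_pos hs0)]
      congr 1
      push_cast
      ring
    rw [e]
    ring

/-- The Caputo derivative in time of the Duhamel integral. Causality allows to cut off `g` beyond
the time `t`, which makes the Laplace transform available. -/
lemma caputo_duhamel {x : ℝ} (hx : 0 < x) {t : ℝ} (ht : 0 < t) :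
    caputo (2 * ν) (duhamel ν 0 g x) t = duhamel ν (-(2 * ν)) g x t := by
  set k : ℝ → ℝ := fun τ => g (max 0 (min τ t)) with hk
  have hkc : Continuous k := hg.comp (by fun_prop)
  obtain ⟨M, hM0, hM⟩ := exists_abs_le_of_continuous hg t
  have hkM : ∀ τ, |k τ| ≤ M := fun τ => hM _ ⟨le_max_left _ _, max_le ht.le (min_le_right _ _)⟩
  have hkg : ∀ (μ : ℝ), ∀ τ ∈ Ioc 0 t, duhamel ν μ g x τ = duhamel ν μ k x τ := by
    intro μ τ hτ
    refine intervalIntegral.integral_congr fun r hr => ?_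
    rw [uIcc_of_le hτ.1.le] at hr
    simp only [hk, min_eq_left (hr.2.trans hτ.2), max_eq_right hr.1]
  rw [hkg _ t ⟨ht, le_rfl⟩, ← caputo_duhamel_of_bounded h0 h1 hkc hx hkM ht]
  refine caputo_congr_iteratedDeriv ht fun τ hτ => ?_
  rw [(contDiffOn_ceil_duhamel h0 h1 hg hx).2 hτ.1, (contDiffOn_ceil_duhamel h0 h1 hkc hx).2 hτ.1,
    hkg _ τ hτ]

end signalling

/-! ### The signalling kernel as an approximate identity -/

section signalling
variable {ν : ℝ} (h0 : 0 < ν) (h1 : ν < 1)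
include h0 h1

/-- Self-similarity of the signalling kernel: for different `x` it differs by a dilation that
preserves the mass. -/
lemma waveKernel_zero_scale {x σ : ℝ} (hx : 0 < x) (hσ : 0 < σ) :
    x ^ ν⁻¹ * waveKernel ν 0 x (x ^ ν⁻¹ * σ) = waveKernel ν 0 1 σ := by
  have hr : 0 < x ^ ν⁻¹ := Real.rpow_pos_of_pos hx _
  rw [waveKernel_scale h0 h1 zero_lt_one x (mul_pos hr hσ),
    waveKernel_scale h0 h1 zero_lt_one 1 hσ]
  have e : x * (x ^ ν⁻¹ * σ) ^ (-ν) = 1 * σ ^ (-ν) := by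
    rw [Real.mul_rpow hr.le hσ.le, ← Real.rpow_mul hx.le, mul_neg, inv_mul_cancel₀ h0.ne',
      Real.rpow_neg_one, ← mul_assoc, mul_inv_cancel₀ hx.ne']
  rw [e, zero_sub, Real.rpow_neg_one, Real.rpow_neg_one]
  field_simp

/-- At infinity the decay `t ^ (-1 - ν)` comes from the reciprocity relation. -/
lemma integrableOn_waveKernel_one : IntegrableOn (waveKernel ν 0 1) (Ioi 0) := by
  have hc := continuous_waveKernel_time h0 h1 zero_lt_one one_pos
  rw [← Ioc_union_Ioi_eq_Ioi zero_le_one]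
  refine IntegrableOn.union (hc.integrableOn_Icc.mono_set Ioc_subset_Icc_self) ?_
  obtain ⟨C, hC0, hC⟩ := exists_abs_waveKernel_le_time h0 h1 (by linarith : 1 - ν < 1)
  refine ((integrableOn_Ioi_rpow_of_lt (by linarith : -ν - 1 < -1) one_pos).const_mul (ν * C)).mono'
    hc.aestronglyMeasurable ((ae_restrict_iff' measurableSet_Ioi).2 (ae_of_all _ fun t ht => ?_))
  have ht0 : 0 < t := one_pos.trans ht
  have e := waveKernel_reciprocity h0 h1 1 ht0
  have e2 : waveKernel ν 0 1 t = ν * waveKernel ν (1 - ν) 1 t * t⁻¹ := by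
    rw [eq_mul_inv_iff_mul_eq₀ ht0.ne']; linarith
  have h := hC 1 t zero_le_one ht0
  rw [e2, Real.norm_eq_abs, abs_mul, abs_mul, abs_of_pos h0, abs_of_pos (inv_pos.2 ht0)]
  calc _ ≤ ν * (C * t ^ (1 - ν - 1)) * t⁻¹ := by gcongr
    _ = _ := by
      rw [← Real.rpow_neg_one t, mul_assoc, mul_assoc, mul_assoc, ← Real.rpow_add ht0]
      ring_nf

/-- The total mass is the limit as `s → 0⁺` of the Laplace transform `e ^ (-s ^ ν)`. -/
lemma integral_waveKernel_one : ∫ t in Ioi (0 : ℝ), waveKernel ν 0 1 t = 1 := by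
  have hi := integrableOn_waveKernel_one h0 h1
  have hL : ∀ s : ℝ, 0 < s → ∫ t in Ioi (0 : ℝ), Real.exp (-s * t) * waveKernel ν 0 1 t =
      Real.exp (-s ^ ν) := by
    intro s hs
    have h := (hasLaplace_waveKernel h0 h1 zero_lt_one one_pos (s := s) (by simpa)).2
    rw [← Complex.ofReal_inj, ← integral_complex_ofReal]
    push_cast
    rw [Complex.ofReal_cpow hs.le]
    simpa using h
  have l1 : Tendsto (fun s : ℝ => Real.exp (-s ^ ν)) (𝓝[>] 0) (𝓝 1) := by
    have : ContinuousAt (fun s : ℝ => Real.exp (-s ^ ν)) 0 :=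
      (Real.continuous_rpow_const h0.le).neg.rexp.continuousAt
    simpa [ContinuousAt, Real.zero_rpow h0.ne'] using
      this.mono_left (nhdsWithin_le_nhds (s := Ioi 0))
  have l2 : Tendsto (fun s : ℝ => ∫ t in Ioi (0 : ℝ), Real.exp (-s * t) * waveKernel ν 0 1 t)
      (𝓝[>] 0) (𝓝 (∫ t in Ioi (0 : ℝ), waveKernel ν 0 1 t)) := by
    refine tendsto_integral_filter_of_dominated_convergence (fun t => ‖waveKernel ν 0 1 t‖)
      (Eventually.of_forall fun s => ?_) (eventually_nhdsWithin_of_forall fun s hs => ?_) hi.norm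
      (ae_of_all _ fun t => ?_)
    · exact Continuous.aestronglyMeasurable (by fun_prop) |>.mul hi.1
    · refine (ae_restrict_iff' measurableSet_Ioi).2 (ae_of_all _ fun t ht => ?_)
      rw [norm_mul, Real.norm_eq_abs, Real.abs_exp]
      refine mul_le_of_le_one_left (norm_nonneg _) (Real.exp_le_one_iff.2 ?_)
      nlinarith [mem_Ioi.1 hs, mem_Ioi.1 ht]
    · have : ContinuousAt (fun s : ℝ => Real.exp (-s * t) * waveKernel ν 0 1 t) 0 := by fun_prop
      simpa [ContinuousAt] using this.mono_left (nhdsWithin_le_nhds (s := Ioi 0))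
  refine tendsto_nhds_unique l2 (l1.congr' (eventually_nhdsWithin_of_forall fun s hs => ?_))
  exact (hL s hs).symm

lemma integral_abs_waveKernel_zero {x : ℝ} (hx : 0 < x) :
    IntegrableOn (waveKernel ν 0 x) (Ioi 0) ∧
      ∫ t in Ioi (0 : ℝ), |waveKernel ν 0 x t| = ∫ t in Ioi (0 : ℝ), |waveKernel ν 0 1 t| := by
  have hr : 0 < x ^ ν⁻¹ := Real.rpow_pos_of_pos hx _
  have e : EqOn (waveKernel ν 0 1) (fun σ => x ^ ν⁻¹ * waveKernel ν 0 x (x ^ ν⁻¹ * σ)) (Ioi 0) :=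
    fun σ hσ => (waveKernel_zero_scale h0 h1 hx hσ).symm
  constructor
  · have := (integrableOn_waveKernel_one h0 h1).congr_fun e measurableSet_Ioi
    have h2 : IntegrableOn (fun σ => waveKernel ν 0 x (x ^ ν⁻¹ * σ)) (Ioi 0) :=
      (this.const_mul (x ^ ν⁻¹)⁻¹).congr (ae_of_all _ fun σ => by
        simp only [inv_mul_cancel_left₀ hr.ne'])
    have h3 := (integrableOn_Ioi_comp_mul_left_iff (waveKernel ν 0 x) 0 hr).1 h2
    rwa [mul_zero] at h3
  · rw [setIntegral_congr_fun measurableSet_Ioi (f := fun t => |waveKernel ν 0 1 t|)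
      (g := fun σ => x ^ ν⁻¹ *
      |waveKernel ν 0 x (x ^ ν⁻¹ * σ)|) fun σ hσ => by
        simp only [e hσ, abs_mul, abs_of_pos hr], integral_const_mul,
      integral_comp_mul_left_Ioi (fun t => |waveKernel ν 0 x t|) 0 hr, mul_zero, smul_eq_mul,
      mul_inv_cancel_left₀ hr.ne']

/-- As `x → 0⁺` the signalling kernel is an approximate identity in `t`. -/
lemma tendsto_duhamel_boundary {g : ℝ → ℝ} (hg : Continuous g) {t : ℝ} (ht : 0 < t) :
    Tendsto (fun x => duhamel ν 0 g x t) (𝓝[>] 0) (𝓝 (g t)) := by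
  obtain ⟨M, hM0, hM⟩ := exists_abs_le_of_continuous hg t
  have hi := integrableOn_waveKernel_one h0 h1
  have hr : Tendsto (fun x : ℝ => x ^ ν⁻¹) (𝓝[>] 0) (𝓝[>] 0) := by
    refine tendsto_nhdsWithin_iff.2 ⟨?_, eventually_nhdsWithin_of_forall fun x hx =>
      Real.rpow_pos_of_pos hx _⟩
    have := (Real.continuous_rpow_const (inv_pos.2 h0).le).continuousAt (x := 0)
    simpa [ContinuousAt, Real.zero_rpow (inv_pos.2 h0).ne'] using
      this.mono_left (nhdsWithin_le_nhds (s := Ioi 0))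
  set F : ℝ → ℝ → ℝ := fun r σ => (Ioc 0 (t / r)).indicator
    (fun σ => waveKernel ν 0 1 σ * g (t - r * σ)) σ with hF
  have e : ∀ x, 0 < x → duhamel ν 0 g x t = ∫ σ in Ioi (0 : ℝ), F (x ^ ν⁻¹) σ := by
    intro x hx
    have hr : 0 < x ^ ν⁻¹ := Real.rpow_pos_of_pos hx _
    have h2 := intervalIntegral.mul_integral_comp_mul_left (a := 0) (b := t / x ^ ν⁻¹)
      (f := fun τ => waveKernel ν 0 x τ * g (t - τ)) (c := x ^ ν⁻¹)
    rw [mul_zero, mul_div_cancel₀ _ hr.ne'] at h2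
    rw [← integral_waveKernel_mul_eq_duhamel, ← h2, ← intervalIntegral.integral_const_mul,
      intervalIntegral.integral_of_le (by positivity), hF]
    simp only
    rw [setIntegral_indicator measurableSet_Ioc, inter_eq_self_of_subset_right Ioc_subset_Ioi_self]
    refine setIntegral_congr_fun measurableSet_Ioc fun σ hσ => ?_
    rw [← mul_assoc, waveKernel_zero_scale h0 h1 hx hσ.1]
  have hlim : Tendsto (fun r => ∫ σ in Ioi (0 : ℝ), F r σ) (𝓝[>] 0)
      (𝓝 (∫ σ in Ioi (0 : ℝ), waveKernel ν 0 1 σ * g t)) := by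
    refine tendsto_integral_filter_of_dominated_convergence (fun σ => ‖waveKernel ν 0 1 σ‖ * M)
      (Eventually.of_forall fun r => ?_) (eventually_nhdsWithin_of_forall fun r hr => ?_)
      (hi.norm.mul_const _) ((ae_restrict_iff' measurableSet_Ioi).2 (ae_of_all _ fun σ hσ => ?_))
    · exact (hi.1.mul (Continuous.aestronglyMeasurable (hg.comp (by fun_prop)))).indicator
        measurableSet_Ioc
    · refine ae_of_all _ fun σ => ?_
      simp only [hF]
      by_cases hσ : σ ∈ Ioc 0 (t / r)
      · rw [indicator_of_mem hσ, norm_mul]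
        have h2 : r * σ ≤ t := by
          have := (le_div_iff₀ (mem_Ioi.1 hr)).1 hσ.2
          linarith
        have h3 : 0 ≤ r * σ := mul_nonneg (mem_Ioi.1 hr).le hσ.1.le
        exact mul_le_mul_of_nonneg_left (hM _ ⟨by linarith, by linarith⟩) (norm_nonneg _)
      · rw [indicator_of_notMem hσ, norm_zero]
        positivity
    · have h2 : ContinuousAt (fun r : ℝ => waveKernel ν 0 1 σ * g (t - r * σ)) 0 :=
        (continuous_const.mul (hg.comp (by fun_prop))).continuousAt
      have h3 : Tendsto (fun r : ℝ => waveKernel ν 0 1 σ * g (t - r * σ)) (𝓝[>] 0)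
          (𝓝 (waveKernel ν 0 1 σ * g t)) := by
        simpa [ContinuousAt] using h2.mono_left (nhdsWithin_le_nhds (s := Ioi 0))
      refine h3.congr' ?_
      have h4 : ∀ᶠ r in 𝓝[>] (0 : ℝ), r < t / σ :=
        nhdsWithin_le_nhds (Iio_mem_nhds (div_pos ht hσ))
      filter_upwards [h4, self_mem_nhdsWithin] with r hr1 hr0
      have : σ ∈ Ioc 0 (t / r) := ⟨hσ, by
        rw [le_div_iff₀ (mem_Ioi.1 hr0), mul_comm]
        exact ((lt_div_iff₀ (mem_Ioi.1 hσ)).1 hr1).le⟩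
      simp only [hF, indicator_of_mem this]
  rw [integral_mul_const, integral_waveKernel_one h0 h1, one_mul] at hlim
  exact (hlim.comp hr).congr' (eventually_nhdsWithin_of_forall fun x hx => (e x hx).symm)

/-- The signalling kernel is a Green function of the signalling problem. -/
lemma isSignallingGreen_of_eq {D : ℝ} (hD : 0 < D) {G : ℝ → ℝ → ℝ}
    (hG : ∀ x t, 0 ≤ x → 0 < t → G x t = waveKernel ν 0 (x / √D) t) :
    IsSignallingGreen (2 * ν) D G := by
  have hβ : 0 < 2 * ν := by linarith
  have hr : 0 < √D := Real.sqrt_pos.2 hD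
  have hxr : ∀ {x : ℝ}, 0 < x → 0 < x / √D := fun hx => div_pos hx hr
  refine ⟨?_, ⟨0, ∫ t in Ioi (0 : ℝ), |waveKernel ν 0 1 t|, fun x hx => ?_⟩, fun g hg => ?_⟩
  · refine ((continuousOn_waveKernel h0 h1 zero_lt_one).comp
      (f := fun p : ℝ × ℝ => (p.1 / √D, p.2)) (by fun_prop) fun p hp =>
        ⟨div_nonneg hp.1 hr.le, hp.2⟩).congr fun p hp => hG _ _ hp.1 hp.2
  · obtain ⟨hi, he⟩ := integral_abs_waveKernel_zero h0 h1 (hxr hx)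
    have e : EqOn (waveKernel ν 0 (x / √D)) (G x) (Ioi 0) := fun t ht => (hG x t hx.le ht).symm
    simp only [neg_zero, zero_mul, Real.exp_zero, one_mul]
    refine ⟨hi.congr_fun e measurableSet_Ioi, le_of_eq ?_⟩
    rw [← he]
    exact setIntegral_congr_fun measurableSet_Ioi fun t ht => by simp only [e ht]
  -- the data is only continuous on `[0, ∞)`; its values at negative times play no role
  set k : ℝ → ℝ := fun τ => g (max τ 0) with hk
  have hkc : Continuous k := hg.comp_continuous (by fun_prop) fun τ => mem_Ici.2 (le_max_right _ _)
  have hu : ∀ x t, 0 < x → 0 < t → ∫ τ in (0 : ℝ)..t, G x τ * g (t - τ) =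
      duhamel ν 0 k (x / √D) t := by
    intro x t hx ht
    rw [← integral_waveKernel_mul_eq_duhamel, intervalIntegral.integral_of_le ht.le,
      intervalIntegral.integral_of_le ht.le]
    refine setIntegral_congr_fun measurableSet_Ioc fun τ hτ => ?_
    simp only [hk, hG x τ hx.le hτ.1, max_eq_left (sub_nonneg.2 hτ.2)]
  have hd1 : ∀ x ∈ Ioi (0 : ℝ), ∀ t ∈ Ioi (0 : ℝ),
      HasDerivAt (fun t => ∫ τ in (0 : ℝ)..t, G x τ * g (t - τ)) (duhamel ν (-1) k (x / √D) t) t :=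
    fun x hx t ht => by
      have h := hasDerivAt_duhamel_time h0 h1 zero_lt_one hkc (hxr hx) (t := t)
      rw [zero_sub] at h
      refine h.congr_of_eventuallyEq ?_
      filter_upwards [Ioi_mem_nhds ht] with t' ht' using hu x t' hx ht'
  have e2 : (-2 : ℝ) = -1 - 1 := by norm_num
  have hd2 : ∀ x ∈ Ioi (0 : ℝ), ∀ t ∈ Ioi (0 : ℝ),
      HasDerivAt (duhamel ν (-1) k (x / √D)) (duhamel ν (-2) k (x / √D) t) t :=
    fun x hx t ht => by
      rw [e2]; exact hasDerivAt_duhamel_time h0 h1 (by norm_num) hkc (hxr hx)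
  have hcont : ∀ μ < 1, ContinuousOn (fun p : ℝ × ℝ => duhamel ν μ k (p.1 / √D) p.2)
      (Ioi 0 ×ˢ Ioi 0) := fun μ hμ => (continuousOn_duhamel h0 h1 hμ hkc).comp
        (f := fun p : ℝ × ℝ => (p.1 / √D, p.2)) (by fun_prop) fun p hp => ⟨hxr hp.1, hp.2⟩
  have hdx : ∀ μ < 1, ∀ t, 0 < t → ∀ x ∈ Ioi (0 : ℝ), HasDerivAt
      (fun x => duhamel ν μ k (x / √D) t) (-duhamel ν (μ - ν) k (x / √D) t / √D) x := by
    intro μ hμ t ht x hx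
    have := (hasDerivAt_duhamel_space h0 h1 hμ hkc (hxr hx) ht).comp x
      ((hasDerivAt_id x).div_const (√D))
    refine this.congr_deriv ?_
    ring
  have hux1 : ∀ t, 0 < t → ∀ x ∈ Ioi (0 : ℝ), HasDerivAt
      (fun x => ∫ τ in (0 : ℝ)..t, G x τ * g (t - τ)) (-duhamel ν (-ν) k (x / √D) t / √D) x := by
    intro t ht x hx
    have h := hdx 0 zero_lt_one t ht x hx
    rw [zero_sub] at h
    refine h.congr_of_eventuallyEq ?_
    filter_upwards [Ioi_mem_nhds hx] with x' hx' using hu x' t hx' ht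
  have hux2 : ∀ t, 0 < t → ∀ x ∈ Ioi (0 : ℝ), HasDerivAt
      (fun x => -duhamel ν (-ν) k (x / √D) t / √D) (duhamel ν (-(2 * ν)) k (x / √D) t / D) x := by
    intro t ht x hx
    have h := (hdx (-ν) (by linarith) t ht x hx).neg.div_const (√D)
    refine h.congr_deriv ?_
    have e : -ν - ν = -(2 * ν) := by ring
    rw [e, neg_div, neg_div, neg_div, neg_neg, div_div, Real.mul_self_sqrt hD.le]
  have hcx : ∀ t, 0 < t → ContinuousOn (fun x => duhamel ν (-(2 * ν)) k (x / √D) t / D) (Ioi 0) :=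
    fun t ht => ((hcont _ (by linarith)).comp (f := fun x => (x, t)) (by fun_prop) fun x hx =>
      ⟨hx, ht⟩).div_const D
  have hsmall : ∀ μ < 1, ∀ x, 0 < x → Tendsto (duhamel ν μ k (x / √D)) (𝓝[>] 0) (𝓝 0) := by
    intro μ hμ x hx
    obtain ⟨C, hC0, hC⟩ := exists_abs_duhamel_le h0 h1 hμ hkc (hxr hx) (T := 1)
    have hl : Tendsto (fun t : ℝ => C * t) (𝓝[>] 0) (𝓝 0) := by
      have : ContinuousAt (fun t : ℝ => C * t) 0 := by fun_prop
      simpa [ContinuousAt] using this.mono_left (nhdsWithin_le_nhds (s := Ioi 0))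
    refine squeeze_zero_norm' ?_ hl
    filter_upwards [Ioc_mem_nhdsGT one_pos] with t ht using hC _ t le_rfl ⟨ht.1.le, ht.2⟩
  refine ⟨?_, fun x hx => ?_, fun h x hx => ?_, fun t ht => ?_, fun t ht => ?_⟩
  · refine isSolution_of_hasDerivAt (γ := 0) hβ (by linarith) one_pos hd1 hd2
      (hcont (-1) (by norm_num)) (hcont (-2) (by norm_num)) (fun K hK hKc T hT => ?_)
      (fun t ht => ?_) (fun x hx t ht => ?_)
    · rcases K.eq_empty_or_nonempty with rfl | hne
      · exact ⟨0, fun x hx => hx.elim⟩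
      obtain ⟨δ, hδK, hδ⟩ := hKc.exists_isLeast hne
      obtain ⟨C₁, hC₁0, hC₁⟩ := exists_abs_duhamel_le h0 h1 (by norm_num : (-1 : ℝ) < 1) hkc
        (hxr (hK hδK)) (T := T)
      obtain ⟨C₂, hC₂0, hC₂⟩ := exists_abs_duhamel_le h0 h1 (by norm_num : (-2 : ℝ) < 1) hkc
        (hxr (hK hδK)) (T := T)
      refine ⟨(C₁ + C₂) * T, fun x hx t ht => ?_⟩
      have hle : δ / √D ≤ x / √D := div_le_div_of_nonneg_right (hδ hx) hr.le
      have b1 := hC₁ (x / √D) t hle ⟨ht.1.le, ht.2⟩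
      have b2 := hC₂ (x / √D) t hle ⟨ht.1.le, ht.2⟩
      have b3 := mul_le_mul_of_nonneg_left ht.2 hC₁0
      have b4 := mul_le_mul_of_nonneg_left ht.2 hC₂0
      have b5 := mul_nonneg hC₁0 hT.le
      have b6 := mul_nonneg hC₂0 hT.le
      rw [neg_zero, Real.rpow_zero, mul_one, orderDeriv]
      split_ifs <;> linarith
    · exact contDiffOn_two_of_hasDerivAt isOpen_Ioi (hux1 t ht) (hux2 t ht) (hcx t ht)
    · rw [iteratedDeriv_two_of_hasDerivAt isOpen_Ioi (hux1 t ht) (hux2 t ht) hx,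
        mul_div_cancel₀ _ hD.ne', ← caputo_duhamel h0 h1 hkc (hxr hx) ht]
      exact caputo_congr (fun t ht => hu x t hx ht) ht
  · exact (hsmall 0 zero_lt_one x hx).congr' (eventually_nhdsWithin_of_forall fun t ht =>
      (hu x t hx ht).symm)
  · exact (hsmall (-1) (by norm_num) x hx).congr' (eventually_nhdsWithin_of_forall fun t ht =>
      (hd1 x hx t ht).deriv.symm)
  · have hl : Tendsto (fun x => x / √D) (𝓝[>] 0) (𝓝[>] 0) := by
      refine tendsto_nhdsWithin_iff.2 ⟨?_, eventually_nhdsWithin_of_forall fun x hx => hxr hx⟩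
      have : ContinuousAt (fun x => x / √D) 0 := by fun_prop
      simpa [ContinuousAt] using this.mono_left (nhdsWithin_le_nhds (s := Ioi 0))
    have h := (tendsto_duhamel_boundary h0 h1 hkc ht).comp hl
    have ek : k t = g t := by simp only [hk, max_eq_left ht.le]
    rw [ek] at h
    exact h.congr' (eventually_nhdsWithin_of_forall fun x hx => (hu x t hx ht).symm)
  · obtain ⟨M, hM0, hM⟩ := exists_abs_le_of_continuous hkc t
    obtain ⟨C, hC0, hC⟩ := exists_abs_waveKernel_le_space h0 h1 zero_lt_one
    have hl : Tendsto (fun x : ℝ => M * (C * (x / √D) ^ (-(1 - 0) / ν)) * t) atTop (𝓝 0) := by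
      have h1 : Tendsto (fun x : ℝ => (x / √D) ^ (-(1 / ν))) atTop (𝓝 0) :=
        (tendsto_rpow_neg_atTop (by positivity)).comp (tendsto_id.atTop_div_const hr)
      have := ((h1.const_mul C).const_mul M).mul_const t
      simpa [neg_div] using this
    refine squeeze_zero_norm' ?_ hl
    filter_upwards [Ioi_mem_atTop 0] with x hx
    rw [hu x t hx ht]
    have := intervalIntegral.norm_integral_le_of_norm_le_const (a := 0) (b := t)
      (C := M * (C * (x / √D) ^ (-(1 - 0) / ν)))
      (f := fun τ => k τ * waveKernel ν 0 (x / √D) (t - τ)) fun τ hτ => by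
        rw [uIoc_of_le ht.le] at hτ
        rw [norm_mul]
        exact mul_le_mul (hM τ ⟨hτ.1.le, hτ.2⟩) (hC _ _ (hxr hx)) (norm_nonneg _) hM0
    simpa only [sub_zero, abs_of_pos ht, duhamel] using this

end signalling

/-! ### Uniqueness for the Cauchy problem -/

lemma hasDerivAt_complex_schwartz_conv {P : ℝ → ℂ} (f : SchwartzMap ℝ ℝ) (hP : Integrable P)
    (x : ℝ) : HasDerivAt (fun x => ∫ ξ, P ξ * (f (x - ξ) : ℂ))
      (∫ ξ, P ξ * (sderiv f (x - ξ) : ℂ)) x := by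
  obtain ⟨C, hC0, hC⟩ := schwartz_bounded f
  obtain ⟨C', hC0', hC'⟩ := schwartz_bounded (sderiv f)
  have hm : ∀ (g : SchwartzMap ℝ ℝ) (x : ℝ),
      AEStronglyMeasurable (fun ξ => (g (x - ξ) : ℂ)) volume := fun g x =>
    (Complex.continuous_ofReal.comp (g.continuous.comp (by fun_prop))).aestronglyMeasurable
  refine (hasDerivAt_integral_of_dominated_loc_of_deriv_le (μ := volume) (s := univ)
    (F := fun x ξ => P ξ * (f (x - ξ) : ℂ)) (F' := fun x ξ => P ξ * (sderiv f (x - ξ) : ℂ))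
    (bound := fun ξ => ‖P ξ‖ * C') univ_mem
    (Eventually.of_forall fun x => hP.1.mul (hm f x))
    (hP.mul_bdd (c := C) (hm f x) (ae_of_all _ fun ξ => ?_))
    (hP.1.mul (hm _ x)) (ae_of_all _ fun ξ x _ => ?_) (hP.norm.mul_const _)
    (ae_of_all _ fun ξ x _ => ?_)).2
  · rw [Complex.norm_real]; exact hC _
  · rw [norm_mul, Complex.norm_real]
    exact mul_le_mul_of_nonneg_left (hC' _) (norm_nonneg _)
  · have h1 : HasDerivAt (fun x => x - ξ) 1 x := (hasDerivAt_id x).sub_const ξ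
    have := (((hasDerivAt_schwartz f (x - ξ)).comp x h1).ofReal_comp).const_mul (P ξ)
    simpa using this

lemma norm_complex_schwartz_conv_le {P : ℝ → ℂ} {f : SchwartzMap ℝ ℝ} {C : ℝ}
    (hC : ∀ x, |f x| ≤ C) (hP : Integrable P) (x : ℝ) :
    ‖∫ ξ, P ξ * (f (x - ξ) : ℂ)‖ ≤ (∫ ξ, ‖P ξ‖) * C := by
  rw [← integral_mul_const]
  refine norm_integral_le_of_norm_le (hP.norm.mul_const C) (ae_of_all _ fun y => ?_)
  rw [norm_mul, Complex.norm_real]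
  exact mul_le_mul_of_nonneg_left (hC _) (norm_nonneg _)

/-- On the whole line `d'' = l² d` has no bounded solution but zero. -/
lemma eq_zero_of_bounded_of_hasDerivAt {d e : ℝ → ℂ} {l : ℂ} {C : ℝ} (hl : 0 < l.re)
    (hb : ∀ x, ‖d x‖ ≤ C) (hd : ∀ x, HasDerivAt d (e x) x)
    (he : ∀ x, HasDerivAt e (l ^ 2 * d x) x) (x : ℝ) : d x = 0 := by
  have hl0 := ne_zero_of_re_pos hl
  obtain ⟨A, B, h⟩ := exists_eq_exp_add_exp convex_univ isOpen_univ hl0 (fun x _ => hd x)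
    fun x _ => he x
  have hA : A = 0 := eq_zero_of_bounded_exp hl (fun x _ => hb x) fun x _ => h x trivial
  have hB : B = 0 := eq_zero_of_bounded_exp (d := fun x => d (-x)) (B := A) hl
    (fun x _ => hb (-x)) fun x _ => by
      rw [h (-x) trivial, add_comm]
      push_cast
      simp only [mul_neg, neg_mul, neg_neg]
  rw [h x trivial, hA, hB, zero_mul, zero_mul, add_zero]

/-- Integrability against `e ^ (-s t)` on `t > 0` persists for larger `s`. -/
lemma integrableOn_exp_mul_mono {G : ℝ → ℝ → ℝ} {s σ : ℝ} (h : s ≤ σ)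
    (hG : IntegrableOn (fun p : ℝ × ℝ => Real.exp (-s * p.2) * G p.1 p.2) (univ ×ˢ Ioi 0)) :
    IntegrableOn (fun p : ℝ × ℝ => Real.exp (-σ * p.2) * G p.1 p.2) (univ ×ˢ Ioi 0) := by
  have h1 := hG.bdd_mul (c := 1) (f := fun p : ℝ × ℝ => Real.exp (-(σ - s) * p.2))
    (Continuous.aestronglyMeasurable (by fun_prop))
    ((ae_restrict_iff' (MeasurableSet.univ.prod measurableSet_Ioi)).2 (ae_of_all _ fun p hp => by
      rw [Real.norm_eq_abs, Real.abs_exp, Real.exp_le_one_iff]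
      have := mem_Ioi.1 hp.2
      nlinarith))
  refine h1.congr (ae_of_all _ fun p => ?_)
  simp only [← mul_assoc, ← Real.exp_add]
  ring_nf

lemma integrable_laplace_space_kernel {G : ℝ → ℝ → ℝ} {s : ℂ}
    (hG : IntegrableOn (fun p : ℝ × ℝ => Real.exp (-s.re * p.2) * G p.1 p.2) (univ ×ˢ Ioi 0)) :
    Integrable fun ξ => ∫ t in Ioi (0 : ℝ), Complex.exp (-s * t) * G ξ t :=
  (integrable_cexp_mul (integrable_prod_of_integrableOn hG)).integral_prod_left

section uniqueness
variable {ν D : ℝ} (h0 : 0 < ν) (h1 : ν < 1) (hD : 0 < D)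
include h0 h1

/-- The equation `D U'' = s ^ (2 ν) (U - f / s)` holds for the Laplace transform of the solution
given by any Green function. -/
lemma IsCauchyGreen.laplace_eq {G : ℝ → ℝ → ℝ} (hG : IsCauchyGreen (2 * ν) D G)
    (f : SchwartzMap ℝ ℝ) (x : ℝ) {s U V : ℂ} (hs : 0 < s.re)
    (hU : HasLaplace (fun t => ∫ ξ, G ξ t * f (x - ξ)) s U)
    (hV : HasLaplace (fun t => ∫ ξ, G ξ t * sderiv (sderiv f) (x - ξ)) s V) :
    D * V = s ^ ((2 * ν : ℝ) : ℂ) * (U - f x * s⁻¹) := by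
  have hβ : 0 < 2 * ν := by linarith
  have hS := hG.solves f
  have h := hasLaplace_rl hβ hs (hV.const_mul D)
  have h2 : HasLaplace (rl (2 * ν) fun t => D * ∫ ξ, G ξ t * sderiv (sderiv f) (x - ξ)) s
      (U - f x * s⁻¹) :=
    (hU.sub ((hasLaplace_one hs).const_mul (f x))).congr fun t ht => by
      simp only [mul_one]
      rw [← rl_caputo_eq_sub hβ (by linarith) ht (hS.solution.time_smooth x trivial)
        (hS.solution.time_integrable x trivial t ht) (hS.initial x) fun h => hS.initial_deriv h x]
      refine rl_congr ht fun τ hτ => ?_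
      rw [hS.solution.equation x trivial τ hτ.1,
        iteratedDeriv_two_schwartz_conv f (hG.space_integrable τ hτ.1)]
  rw [← h.unique h2, ← mul_assoc, ← Complex.cpow_add _ _ (ne_zero_of_re_pos hs), add_neg_cancel,
    Complex.cpow_zero, one_mul]

include hD in
/-- Two Green functions of the Cauchy problem agree: the difference of the Laplace transforms of
the solutions they give is a bounded solution of `d'' = (s ^ (2 ν) / D) d` on the line. -/
lemma IsCauchyGreen.eq {G₁ G₂ : ℝ → ℝ → ℝ} (hG₁ : IsCauchyGreen (2 * ν) D G₁)
    (hG₂ : IsCauchyGreen (2 * ν) D G₂) {t : ℝ} (ht : 0 < t) (x : ℝ) : G₁ x t = G₂ x t := by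
  have hr : 0 < √D := Real.sqrt_pos.2 hD
  obtain ⟨s₁, hs₁⟩ := hG₁.laplace
  obtain ⟨s₂, hs₂⟩ := hG₂.laplace
  set σ := max 1 (max s₁ s₂) with hσ
  have hσ0 : 0 < σ := one_pos.trans_le (le_max_left _ _)
  have hi₁ := integrableOn_exp_mul_mono ((le_max_left s₁ s₂).trans (le_max_right 1 _)) hs₁
  have hi₂ := integrableOn_exp_mul_mono ((le_max_right s₁ s₂).trans (le_max_right 1 _)) hs₂
  rw [← hσ] at hi₁ hi₂
  have key : ∀ f : SchwartzMap ℝ ℝ, ∫ ξ, G₁ ξ t * f (0 - ξ) = ∫ ξ, G₂ ξ t * f (0 - ξ) := by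
    intro f
    refine eqOn_of_hasLaplace (f := fun t => ∫ ξ, G₁ ξ t * f (0 - ξ))
      (g := fun t => ∫ ξ, G₂ ξ t * f (0 - ξ)) (σ := σ)
      ((hG₁.solves f).solution.time_smooth 0 trivial).continuousOn
      ((hG₂.solves f).solution.time_smooth 0 trivial).continuousOn (fun s hs => ?_) ht
    have hs0 : 0 < s.re := by rw [hs]; exact hσ0
    have hsne := ne_zero_of_re_pos hs0
    rw [← hs] at hi₁ hi₂
    set P₁ : ℝ → ℂ := fun ξ => ∫ t in Ioi (0 : ℝ), Complex.exp (-s * t) * G₁ ξ t with hP₁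
    set P₂ : ℝ → ℂ := fun ξ => ∫ t in Ioi (0 : ℝ), Complex.exp (-s * t) * G₂ ξ t with hP₂
    have iP₁ : Integrable P₁ := integrable_laplace_space_kernel hi₁
    have iP₂ : Integrable P₂ := integrable_laplace_space_kernel hi₂
    have L₁ : ∀ (f : SchwartzMap ℝ ℝ) (x : ℝ), HasLaplace (fun t => ∫ ξ, G₁ ξ t * f (x - ξ)) s
        (∫ ξ, P₁ ξ * (f (x - ξ) : ℂ)) := hasLaplace_space_conv hi₁
    have L₂ : ∀ (f : SchwartzMap ℝ ℝ) (x : ℝ), HasLaplace (fun t => ∫ ξ, G₂ ξ t * f (x - ξ)) s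
        (∫ ξ, P₂ ξ * (f (x - ξ) : ℂ)) := hasLaplace_space_conv hi₂
    set l : ℂ := s ^ (ν : ℂ) / (√D : ℝ) with hl
    have hlre : 0 < l.re := by
      rw [hl, Complex.div_ofReal_re]
      exact div_pos (re_cpow_pos h0 h1 hs0) hr
    have hl2 : D * l ^ 2 = s ^ ((2 * ν : ℝ) : ℂ) := mul_sq_cpow_div_sqrt ν hD hsne
    obtain ⟨C, hC0, hC⟩ := schwartz_bounded f
    have hz := eq_zero_of_bounded_of_hasDerivAt (l := l)
      (C := (∫ ξ, ‖P₁ ξ‖) * C + (∫ ξ, ‖P₂ ξ‖) * C)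
      (d := fun x => (∫ ξ, P₁ ξ * (f (x - ξ) : ℂ)) - ∫ ξ, P₂ ξ * (f (x - ξ) : ℂ))
      (e := fun x => (∫ ξ, P₁ ξ * (sderiv f (x - ξ) : ℂ)) - ∫ ξ, P₂ ξ * (sderiv f (x - ξ) : ℂ)) hlre
      (fun x => (norm_sub_le _ _).trans (add_le_add (norm_complex_schwartz_conv_le hC iP₁ x)
        (norm_complex_schwartz_conv_le hC iP₂ x)))
      (fun x => (hasDerivAt_complex_schwartz_conv f iP₁ x).sub
        (hasDerivAt_complex_schwartz_conv f iP₂ x)) (fun x => ?_) 0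
    · refine ⟨_, L₁ f 0, ?_⟩
      rw [sub_eq_zero.1 hz]
      exact L₂ f 0
    · refine ((hasDerivAt_complex_schwartz_conv (sderiv f) iP₁ x).sub
        (hasDerivAt_complex_schwartz_conv (sderiv f) iP₂ x)).congr_deriv ?_
      have e₁ := hG₁.laplace_eq h0 h1 f x hs0 (L₁ f x) (L₁ _ x)
      have e₂ := hG₂.laplace_eq h0 h1 f x hs0 (L₂ f x) (L₂ _ x)
      rw [← hl2] at e₁ e₂
      have hDc : (D : ℂ) ≠ 0 := by exact_mod_cast hD.ne'
      refine mul_left_cancel₀ hDc ?_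
      linear_combination e₁ - e₂
  have hc : ∀ {G : ℝ → ℝ → ℝ}, IsCauchyGreen (2 * ν) D G → Continuous fun x => G x t := by
    intro G hG
    rw [← continuousOn_univ]
    exact hG.cont.comp (f := fun x : ℝ => (x, t)) (by fun_prop) fun x _ => ⟨trivial, ht⟩
  have hae : ∀ᵐ ξ, G₁ ξ t - G₂ ξ t = 0 := by
    refine ae_eq_zero_of_integral_contDiff_smul_eq_zero
      ((hc hG₁).sub (hc hG₂)).locallyIntegrable fun g hg hgs => ?_
    have hgs' : HasCompactSupport fun x => g (-x) := hgs.comp_homeomorph (Homeomorph.neg ℝ)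
    have hk := key (hgs'.toSchwartzMap (hg.comp contDiff_neg))
    simp only [zero_sub, HasCompactSupport.toSchwartzMap_toFun, neg_neg] at hk
    have hb : ∃ C, ∀ x, ‖g x‖ ≤ C := hgs.exists_bound_of_continuous hg.continuous
    obtain ⟨C, hC⟩ := hb
    have i1 := (hG₁.space_integrable t ht).mul_bdd hg.continuous.aestronglyMeasurable
      (ae_of_all _ hC)
    have i2 := (hG₂.space_integrable t ht).mul_bdd hg.continuous.aestronglyMeasurable
      (ae_of_all _ hC)
    rw [← sub_eq_zero, ← integral_sub i1 i2] at hk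
    rw [← hk]
    congr 1 with ξ
    rw [smul_eq_mul]
    ring
  have := (Continuous.ae_eq_iff_eq volume ((hc hG₁).sub (hc hG₂)) continuous_const).1 hae
  exact sub_eq_zero.1 (congrFun this x)

end uniqueness

/-! ### Fractional integrals and integration over a parameter -/

lemma rl_const_mul (α c : ℝ) (f : ℝ → ℝ) (t : ℝ) :
    rl α (fun r => c * f r) t = c * rl α f t := by
  rw [rl, rl, ← intervalIntegral.integral_const_mul]
  simp only [mul_assoc]

lemma rl_congr_ae {α t : ℝ} {f g : ℝ → ℝ} (ht : 0 < t)
    (h : ∀ᵐ τ, τ ∈ Ioc 0 t → f τ = g τ) : rl α f t = rl α g t := by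
  rw [rl, rl, intervalIntegral.integral_of_le ht.le, intervalIntegral.integral_of_le ht.le]
  refine setIntegral_congr_ae measurableSet_Ioc ?_
  filter_upwards [h] with τ hτ hτt
  rw [hτ hτt]

lemma rl_eq_integral_indicator {α T τ : ℝ} (f : ℝ → ℝ) (hτ : τ ∈ Ioc 0 T) :
    rl α f τ = ∫ r in Ioc 0 T, f r * (Ioc 0 T).indicator (powKernel α) (τ - r) := by
  have e : EqOn (fun r => f r * (Ioc 0 T).indicator (powKernel α) (τ - r))
      ((Iio τ).indicator fun r => f r * powKernel α (τ - r)) (Ioc 0 T) := by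
    intro r hr
    by_cases h : r < τ
    · have : τ - r ∈ Ioc 0 T := ⟨by linarith, by linarith [hr.1, hτ.2]⟩
      simp only [indicator_of_mem this, indicator_of_mem (mem_Iio.2 h)]
    · have h1 : τ - r ∉ Ioc 0 T := fun h' => by linarith [h'.1]
      have h2 : r ∉ Iio τ := h
      simp only [indicator_of_notMem h1, indicator_of_notMem h2, mul_zero]
  rw [setIntegral_congr_fun measurableSet_Ioc e, setIntegral_indicator measurableSet_Iio, rl,
    intervalIntegral.integral_of_le hτ.1.le, integral_Ioc_eq_integral_Ioo]
  congr 2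
  ext r
  simp only [mem_Ioo, mem_inter_iff, mem_Ioc, mem_Iio]
  exact ⟨fun h => ⟨⟨h.1, h.2.le.trans hτ.2⟩, h.2⟩, fun h => ⟨h.1.1, h.2⟩⟩

/-- Integration over a parameter commutes with a fractional integral at almost every time. The
kernel may be unbounded, so that the joint integrability is only available after integration in
time. -/
lemma ae_integral_rl {α T : ℝ} (hα : 0 < α) {μ : Measure ℝ} [SFinite μ] {h : ℝ → ℝ → ℝ}
    (hi : Integrable (fun p : ℝ × ℝ => h p.1 p.2) (μ.prod (volume.restrict (Ioc 0 T)))) :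
    ∀ᵐ τ, τ ∈ Ioc 0 T → ∫ y, rl α (h y) τ ∂μ = rl α (fun r => ∫ y, h y r ∂μ) τ := by
  set p : ℝ → ℝ := (Ioc 0 T).indicator (powKernel α) with hp
  have ip : Integrable p :=
    (integrable_indicator_iff measurableSet_Ioc).2 (integrableOn_powKernel hα T)
  have h1 := Integrable.mul_prod hi ip
  have hshear : MeasurePreserving (fun q : (ℝ × ℝ) × ℝ => (q.1, q.2 - q.1.2))
      ((μ.prod (volume.restrict (Ioc 0 T))).prod volume)
      ((μ.prod (volume.restrict (Ioc 0 T))).prod volume) :=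
    (MeasurePreserving.id _).skew_product (g := fun (a : ℝ × ℝ) (t : ℝ) => t - a.2)
      (by fun_prop) (ae_of_all _ fun a => (measurePreserving_sub_right volume a.2).map_eq)
  have h2 := (hshear.integrable_comp h1.1).2 h1
  have h3 := h2.prod_left_ae
  filter_upwards [h3] with τ h4 hτ
  rw [rl_eq_integral_indicator _ hτ]
  simp_rw [rl_eq_integral_indicator _ hτ, ← integral_mul_const]
  exact integral_integral_swap (f := fun y r => h y r * p (τ - r)) h4

/-- For orders `α ≥ 1` the kernel is bounded and the interchange holds at every time. -/
lemma integral_rl_of_one_le {α t : ℝ} (hα : 1 ≤ α) (ht : 0 < t) {μ : Measure ℝ} [SFinite μ]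
    {h : ℝ → ℝ → ℝ}
    (hi : Integrable (fun p : ℝ × ℝ => h p.1 p.2) (μ.prod (volume.restrict (Ioc 0 t)))) :
    ∫ y, rl α (h y) t ∂μ = rl α (fun r => ∫ y, h y r ∂μ) t := by
  simp_rw [rl, intervalIntegral.integral_of_le ht.le, ← integral_mul_const]
  refine integral_integral_swap (f := fun y r => h y r * powKernel α (t - r)) ?_
  have hs : μ.prod (volume.restrict (Ioc 0 t)) =
      (μ.prod volume).restrict (univ ×ˢ Ioc 0 t) := by
    rw [← Measure.prod_restrict, Measure.restrict_univ]
  refine hi.mul_bdd (c := t ^ (α - 1) / Real.Gamma α)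
    ((measurable_powKernel α).comp (by fun_prop)).aestronglyMeasurable ?_
  rw [hs]
  refine (ae_restrict_iff' (MeasurableSet.univ.prod measurableSet_Ioc)).2
    (ae_of_all _ fun p hp => ?_)
  have hp2 := hp.2
  rw [Real.norm_eq_abs, abs_of_nonneg (powKernel_nonneg (by linarith) (by linarith [hp2.2]))]
  refine div_le_div_of_nonneg_right (Real.rpow_le_rpow (by linarith [hp2.2]) (by linarith [hp2.1])
    (by linarith)) (Real.Gamma_pos_of_pos (by linarith)).le

/-! ### Integral form of the equation on an interval -/

/-- The fractional integral in time of the equation, averaged over a compact interval. -/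
lemma IsSolution.rl_integral_eq {β D a b : ℝ} (hβ : 0 < β) (hβ2 : β < 2) (ha : 0 < a)
    {u : ℝ → ℝ → ℝ} (hu : IsSolution β D (Ioi 0) u)
    (h0 : ∀ x : ℝ, 0 < x → Tendsto (u x) (𝓝[>] 0) (𝓝 0))
    (h1 : 1 < β → ∀ x : ℝ, 0 < x → Tendsto (deriv (u x)) (𝓝[>] 0) (𝓝 0))
    {k : ℝ → ℝ} (hk : Continuous k) {t : ℝ} (ht : 0 < t) :
    rl β (fun τ => D * ∫ y in Icc a b, k y * iteratedDeriv 2 (fun z => u z τ) y) t =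
      ∫ y in Icc a b, k y * u y t := by
  have hsub : Icc a b ⊆ Ioi 0 := fun y hy => ha.trans_le hy.1
  set h : ℝ → ℝ → ℝ := fun y => iteratedDeriv ⌈β⌉₊ (u y) with hh
  have hj := hu.time_integrable_joint (Icc a b) hsub isCompact_Icc t ht
  rw [IntegrableOn, Measure.volume_eq_prod, ← Measure.prod_restrict] at hj
  obtain ⟨M, hM⟩ := isCompact_Icc.exists_bound_of_continuousOn (hk.continuousOn (s := Icc a b))
  have hjk : Integrable (fun p : ℝ × ℝ => k p.1 * h p.1 p.2)
      ((volume.restrict (Icc a b)).prod (volume.restrict (Ioc 0 t))) := by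
    refine hj.bdd_mul (c := M) (hk.comp continuous_fst).aestronglyMeasurable ?_
    rw [Measure.prod_restrict]
    exact (ae_restrict_iff' (measurableSet_Icc.prod measurableSet_Ioc)).2
      (ae_of_all _ fun p hp => hM _ hp.1)
  have hce : (1 : ℝ) ≤ ⌈β⌉₊ := by exact_mod_cast Nat.ceil_pos.2 hβ
  have eR : ∫ y in Icc a b, k y * u y t =
      rl ⌈β⌉₊ (fun r => ∫ y in Icc a b, k y * h y r) t := by
    rw [← integral_rl_of_one_le (h := fun y r => k y * h y r) hce ht hjk]
    refine setIntegral_congr_fun measurableSet_Icc fun y hy => ?_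
    simp only [rl_const_mul]
    rw [hh, rl_iteratedDeriv hβ hβ2 ht (hu.time_smooth y (hsub hy))
      (hu.time_integrable y (hsub hy) t ht) (h0 y (hsub hy)) fun h => h1 h y (hsub hy), sub_zero]
  have eL : ∀ τ, 0 < τ → D * ∫ y in Icc a b, k y * iteratedDeriv 2 (fun z => u z τ) y =
      ∫ y in Icc a b, k y * caputo β (u y) τ := by
    intro τ hτ
    rw [← integral_const_mul]
    refine setIntegral_congr_fun measurableSet_Icc fun y hy => ?_
    rw [hu.equation y (hsub hy) τ hτ]
    ring
  rw [eR, rl_congr ht fun τ hτ => eL τ hτ.1]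
  by_cases hm : β = (⌈β⌉₊ : ℝ)
  · rw [← hm]
    refine rl_congr ht fun τ _ => ?_
    simp only [caputo_eq_iteratedDeriv hm, hh]
  · have hlt : β < ⌈β⌉₊ := lt_of_le_of_ne (Nat.le_ceil β) hm
    have hae := ae_integral_rl (h := fun y r => k y * h y r) (sub_pos.2 hlt) hjk
    have e2 : rl β (fun τ => ∫ y in Icc a b, k y * caputo β (u y) τ) t =
        rl β (rl (⌈β⌉₊ - β) fun r => ∫ y in Icc a b, k y * h y r) t := by
      refine rl_congr_ae ht ?_
      filter_upwards [hae] with τ hτ hτt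
      rw [← hτ hτt]
      refine setIntegral_congr_fun measurableSet_Icc fun y _ => ?_
      simp only [rl_const_mul, caputo_eq_rl hm _ hτt.1, hh]
    rw [e2, rl_rl (sub_pos.2 hlt) hβ (by linarith) ht hjk.integral_prod_right, sub_add_cancel]

/-- Up to sign, the Green function of the second derivative on `[a, b]`: integration of `f''`
against it gives the deviation of `f` at `x` from its linear interpolation. -/
def tentKernel (a b x y : ℝ) : ℝ := max (x - y) 0 - (x - a) / (b - a) * (b - y)

lemma continuous_tentKernel (a b x : ℝ) : Continuous (tentKernel a b x) := by
  unfold tentKernel; fun_prop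

/-- Integration against `tentKernel`, in terms of repeated integrals from `a`. -/
lemma integral_tentKernel_mul {E : Type*} [NormedAddCommGroup E] [NormedSpace ℝ E] {a b x : ℝ}
    (hx : x ∈ Icc a b) {f : ℝ → E} (hf : IntegrableOn f (Icc a b)) :
    ∫ y in Icc a b, tentKernel a b x y • f y = (∫ y in a..x, (x - y) • f y) -
      ((x - a) / (b - a)) • ∫ y in a..b, (b - y) • f y := by
  have hab : a ≤ b := hx.1.trans hx.2
  have i1 : ∀ c : ℝ, IntegrableOn (fun y => (c - y) • f y) (Icc a b) := fun c =>
    hf.continuousOn_smul (by fun_prop) isCompact_Icc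
  have i2 : IntegrableOn (fun y => max (x - y) 0 • f y) (Icc a b) :=
    hf.continuousOn_smul (by fun_prop) isCompact_Icc
  have e : ∀ y, tentKernel a b x y • f y = max (x - y) 0 • f y -
      ((x - a) / (b - a)) • ((b - y) • f y) := fun y => by
    rw [tentKernel, sub_smul, mul_smul]
  have i3 : Integrable (fun y => ((x - a) / (b - a)) • ((b - y) • f y))
      (volume.restrict (Icc a b)) :=
    Integrable.smul _ (i1 b)
  simp_rw [e]
  rw [integral_sub i2 i3, integral_smul, integral_Icc_eq_integral_Ioc,
    integral_Icc_eq_integral_Ioc, ← intervalIntegral.integral_of_le hab,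
    ← intervalIntegral.integral_of_le hab]
  congr 1
  have j : ∀ {c d : ℝ}, c ∈ Icc a b → d ∈ Icc a b →
      IntervalIntegrable (fun y => max (x - y) 0 • f y) volume c d := fun hc hd =>
    (i2.mono_set (ordConnected_Icc.uIcc_subset hc hd)).intervalIntegrable
  rw [← intervalIntegral.integral_add_adjacent_intervals (j (left_mem_Icc.2 hab) hx)
    (j hx (right_mem_Icc.2 hab))]
  have z : ∫ y in x..b, max (x - y) 0 • f y = 0 := by
    refine (intervalIntegral.integral_congr (g := fun _ => (0 : E)) fun y hy => ?_).trans
      intervalIntegral.integral_zero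
    rw [uIcc_of_le hx.2] at hy
    simp only [max_eq_right (by linarith [hy.1] : x - y ≤ 0), zero_smul]
  rw [z, add_zero]
  refine intervalIntegral.integral_congr fun y hy => ?_
  rw [uIcc_of_le hx.1] at hy
  simp only [max_eq_left (by linarith [hy.2] : 0 ≤ x - y)]

lemma integral_tentKernel_mul_deriv {f : ℝ → ℝ} (hf : ContDiffOn ℝ 2 f (Ioi 0)) {a b x : ℝ}
    (ha : 0 < a) (hab : a < b) (hx : x ∈ Icc a b) :
    ∫ y in Icc a b, tentKernel a b x y * iteratedDeriv 2 f y =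
      f x - f a - (x - a) / (b - a) * (f b - f a) := by
  have hsub : Icc a b ⊆ Ioi 0 := fun y hy => ha.trans_le hy.1
  have hc : ContinuousOn (iteratedDeriv 2 f) (Ioi 0) :=
    continuousOn_iteratedDeriv_Ioi (n := 2) (by exact_mod_cast hf)
  have hd1 : ∀ y, 0 < y → HasDerivAt f (deriv f y) y := fun y hy =>
    hasDerivAt_of_contDiffOn_Ioi hf two_ne_zero hy
  have hd2 : ∀ y, 0 < y → HasDerivAt (deriv f) (iteratedDeriv 2 f y) y := by
    intro y hy
    have h : ContDiffOn ℝ 1 (deriv f) (Ioi 0) :=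
      ((contDiffOn_succ_iff_deriv_of_isOpen isOpen_Ioi).1
        (by exact_mod_cast hf : ContDiffOn ℝ (1 + 1) f (Ioi 0))).2.2
    rw [iteratedDeriv_succ, iteratedDeriv_one]
    exact hasDerivAt_of_contDiffOn_Ioi h one_ne_zero hy
  have T : ∀ c ∈ Icc a b, ∫ y in a..c, (c - y) * iteratedDeriv 2 f y =
      f c - f a - (c - a) * deriv f a := by
    intro c hcI
    have h := intervalIntegral.integral_eq_sub_of_hasDerivAt (a := a) (b := c)
      (f := fun y => (c - y) * deriv f y + f y) (f' := fun y => (c - y) * iteratedDeriv 2 f y)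
      (fun y hy => by
        rw [uIcc_of_le hcI.1] at hy
        have hy0 : 0 < y := ha.trans_le hy.1
        refine ((((hasDerivAt_id y).const_sub c).mul (hd2 y hy0)).add (hd1 y hy0)).congr_deriv ?_
        simp only [id]
        ring)
      (ContinuousOn.intervalIntegrable (ContinuousOn.mul (by fun_prop) (hc.mono (by
        rw [uIcc_of_le hcI.1]
        exact fun y hy => ha.trans_le hy.1))))
    rw [h]
    ring
  have hi : IntegrableOn (iteratedDeriv 2 f) (Icc a b) :=
    (hc.mono hsub).integrableOn_Icc
  have := integral_tentKernel_mul hx hi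
  simp only [smul_eq_mul] at this
  rw [this, T x hx, T b (right_mem_Icc.2 hab.le)]
  have : b - a ≠ 0 := by linarith
  field_simp
  ring

/-- An integrable solution of the integral form of `γ'' = c γ` is twice differentiable. -/
lemma hasDerivAt_of_integral_eq {γ : ℝ → ℂ} {a b : ℝ} {p q c : ℂ} (hi : IntegrableOn γ (Icc a b))
    (h : ∀ x ∈ Ioo a b, γ x = p + q * x + c * ∫ y in a..x, (x - y) • γ y) :
    ∀ x ∈ Ioo a b, HasDerivAt γ (q + c * ∫ y in a..x, γ y) x ∧
      HasDerivAt (fun x => q + c * ∫ y in a..x, γ y) (c * γ x) x := by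
  rcases le_or_gt b a with hba | hab
  · intro x hx; exact absurd (hx.1.trans hx.2) hba.not_gt
  have hI : Ioo a b ⊆ Icc a b := Ioo_subset_Icc_self
  have i2 : IntegrableOn (fun y : ℝ => (y : ℂ) * γ y) (Icc a b) :=
    hi.continuousOn_mul (by fun_prop) isCompact_Icc
  have ii : ∀ {f : ℝ → ℂ}, IntegrableOn f (Icc a b) → ∀ x ∈ Ioo a b,
      IntervalIntegrable f volume a x := fun hf x hx =>
    (hf.mono_set (by
      rw [uIcc_of_le hx.1.le]; exact Icc_subset_Icc_right hx.2.le)).intervalIntegrable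
  -- the right-hand side is continuous, hence so is `γ`, and then it is differentiable
  have h' : ∀ x ∈ Ioo a b, γ x = p + q * x +
      c * (x * (∫ y in a..x, γ y) - ∫ y in a..x, (y : ℂ) * γ y) := by
    intro x hx
    rw [h x hx, ← intervalIntegral.integral_const_mul (x : ℂ),
      ← intervalIntegral.integral_sub ((ii hi x hx).const_mul _) (ii i2 x hx)]
    congr 2
    refine intervalIntegral.integral_congr fun y _ => ?_
    simp only [Complex.real_smul]
    push_cast
    ring
  have cp : ∀ {f : ℝ → ℂ}, IntegrableOn f (Icc a b) →
      ContinuousOn (fun x => ∫ y in a..x, f y) (Ioo a b) := fun hf => by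
    have := intervalIntegral.continuousOn_primitive_interval (a := a) (b := b) (μ := volume)
      (by rwa [uIcc_of_le hab.le])
    rw [uIcc_of_le hab.le] at this
    exact this.mono hI
  have hγ : ContinuousOn γ (Ioo a b) := by
    refine ContinuousOn.congr ?_ h'
    refine ContinuousOn.add (by fun_prop) (continuousOn_const.mul ?_)
    exact (ContinuousOn.mul (by fun_prop) (cp hi)).sub (cp i2)
  have hd : ∀ {f : ℝ → ℂ}, IntegrableOn f (Icc a b) → ContinuousOn f (Ioo a b) → ∀ x ∈ Ioo a b,
      HasDerivAt (fun x => ∫ y in a..x, f y) (f x) x := fun hf hc x hx =>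
    intervalIntegral.integral_hasDerivAt_right (ii hf x hx)
      (hc.stronglyMeasurableAtFilter isOpen_Ioo x hx) (hc.continuousAt (Ioo_mem_nhds hx.1 hx.2))
  intro x hx
  have d1 := hd hi hγ x hx
  have d2 := hd i2 (ContinuousOn.mul (by fun_prop) hγ) x hx
  refine ⟨?_, (d1.const_mul c).const_add q⟩
  have dx : HasDerivAt (fun x : ℝ => (x : ℂ)) 1 x := Complex.ofRealCLM.hasDerivAt
  have d3 := ((dx.const_mul q).const_add p).add (((dx.mul d1).sub d2).const_mul c)
  refine (d3.congr_of_eventuallyEq ?_).congr_deriv ?_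
  · filter_upwards [Ioo_mem_nhds hx.1 hx.2] with y hy
    rw [h' y hy]
    rfl
  · ring

/-! ### Uniqueness for the signalling problem -/

lemma rl_one (f : ℝ → ℝ) (t : ℝ) : rl 1 f t = ∫ τ in (0 : ℝ)..t, f τ := by
  simp only [rl, powKernel_one, mul_one]

lemma abs_integral_le_of_laplace {f : ℝ → ℝ} {C σ t : ℝ} (hσ : 0 ≤ σ)
    (h : IntegrableOn (fun t => Real.exp (-σ * t) * f t) (Ioi 0) ∧
      ∫ t in Ioi (0 : ℝ), Real.exp (-σ * t) * |f t| ≤ C) (ht : 0 < t) :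
    |∫ τ in (0 : ℝ)..t, f τ| ≤ C * Real.exp (σ * t) := by
  have i1 : IntegrableOn (fun t => Real.exp (-σ * t) * |f t|) (Ioi 0) :=
    h.1.abs.congr (ae_of_all _ fun t => by simp only [abs_mul, Real.abs_exp])
  have hsub : Ioc 0 t ⊆ Ioi 0 := Ioc_subset_Ioi_self
  have i2 := (i1.mono_set hsub).const_mul (Real.exp (σ * t))
  have hle : ∀ τ ∈ Ioc 0 t, |f τ| ≤ Real.exp (σ * t) * (Real.exp (-σ * τ) * |f τ|) := by
    intro τ hτ
    rw [← mul_assoc, ← Real.exp_add]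
    refine le_mul_of_one_le_left (abs_nonneg _) (Real.one_le_exp ?_)
    nlinarith [hτ.2]
  rw [intervalIntegral.integral_of_le ht.le, ← Real.norm_eq_abs]
  refine (norm_integral_le_of_norm_le i2
    ((ae_restrict_iff' measurableSet_Ioc).2 (ae_of_all _ hle))).trans ?_
  rw [integral_const_mul, mul_comm]
  refine mul_le_mul_of_nonneg_right (le_trans ?_ h.2) (Real.exp_pos _).le
  exact setIntegral_mono_set i1 (ae_of_all _ fun τ => by positivity) hsub.eventuallyLE

section transform
variable {β D : ℝ} {G : ℝ → ℝ → ℝ}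

lemma IsSignallingGreen.continuousOn_time (hG : IsSignallingGreen β D G) {x : ℝ} (hx : 0 ≤ x) :
    ContinuousOn (G x) (Ioi 0) :=
  hG.cont.comp (f := fun t : ℝ => (x, t)) (by fun_prop) fun _ ht => ⟨hx, ht⟩

/-- The uniform Laplace bound at `s₀` persists at every `σ ≥ s₀`. -/
lemma IsSignallingGreen.laplace_mono (hG : IsSignallingGreen β D G) {s₀ C σ x : ℝ} (hσ : s₀ ≤ σ)
    (h : IntegrableOn (fun t => Real.exp (-s₀ * t) * G x t) (Ioi 0) ∧
      ∫ t in Ioi (0 : ℝ), Real.exp (-s₀ * t) * |G x t| ≤ C) (hx : 0 < x) :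
    IntegrableOn (fun t => Real.exp (-σ * t) * G x t) (Ioi 0) ∧
      ∫ t in Ioi (0 : ℝ), Real.exp (-σ * t) * |G x t| ≤ C := by
  have i0 : IntegrableOn (fun t => Real.exp (-s₀ * t) * |G x t|) (Ioi 0) :=
    h.1.abs.congr (ae_of_all _ fun t => by simp only [abs_mul, Real.abs_exp])
  have hle : ∀ t ∈ Ioi (0 : ℝ), Real.exp (-σ * t) * |G x t| ≤ Real.exp (-s₀ * t) * |G x t| :=
    fun t ht => mul_le_mul_of_nonneg_right
      (Real.exp_le_exp.2 (by nlinarith [mem_Ioi.1 ht])) (abs_nonneg _)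
  have hi : IntegrableOn (fun t => Real.exp (-σ * t) * G x t) (Ioi 0) := by
    refine Integrable.mono' i0 (ContinuousOn.aestronglyMeasurable
      (ContinuousOn.mul (by fun_prop) (hG.continuousOn_time hx.le)) measurableSet_Ioi)
      ((ae_restrict_iff' measurableSet_Ioi).2 (ae_of_all _ fun t ht => ?_))
    rw [Real.norm_eq_abs, abs_mul, Real.abs_exp]
    exact hle t ht
  have i1 : IntegrableOn (fun t => Real.exp (-σ * t) * |G x t|) (Ioi 0) :=
    hi.abs.congr (ae_of_all _ fun t => by simp only [abs_mul, Real.abs_exp])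
  exact ⟨hi, (setIntegral_mono_on i1 i0 measurableSet_Ioi hle).trans h.2⟩

lemma IsSignallingGreen.integrable_joint (hG : IsSignallingGreen β D G) {C σ a b : ℝ} (ha : 0 < a)
    (h : ∀ x, 0 < x → IntegrableOn (fun t => Real.exp (-σ * t) * G x t) (Ioi 0) ∧
      ∫ t in Ioi (0 : ℝ), Real.exp (-σ * t) * |G x t| ≤ C) :
    Integrable (fun p : ℝ × ℝ => Real.exp (-σ * p.2) * G p.1 p.2)
      ((volume.restrict (Icc a b)).prod (volume.restrict (Ioi 0))) := by
  have hm : AEStronglyMeasurable (fun p : ℝ × ℝ => Real.exp (-σ * p.2) * G p.1 p.2)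
      ((volume.restrict (Icc a b)).prod (volume.restrict (Ioi 0))) := by
    rw [Measure.prod_restrict]
    refine ContinuousOn.aestronglyMeasurable (ContinuousOn.mul (by fun_prop) (hG.cont.mono ?_))
      (measurableSet_Icc.prod measurableSet_Ioi)
    exact prod_mono (fun y hy => ha.le.trans hy.1) subset_rfl
  rw [integrable_prod_iff hm]
  have hpos : ∀ y ∈ Icc a b, 0 < y := fun y hy => ha.trans_le hy.1
  refine ⟨(ae_restrict_iff' measurableSet_Icc).2 (ae_of_all _ fun y hy => (h y (hpos y hy)).1), ?_⟩
  refine Integrable.mono' (g := fun _ => C) (integrableOn_const measure_Icc_lt_top.ne)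
    hm.norm.integral_prod_right' ((ae_restrict_iff' measurableSet_Icc).2
      (ae_of_all _ fun y hy => ?_))
  simp only [norm_mul, Real.norm_eq_abs, Real.abs_exp]
  rw [abs_of_nonneg (integral_nonneg fun t => by positivity)]
  exact (h y (hpos y hy)).2

end transform

section uniqueness
variable {ν D : ℝ} (h0 : 0 < ν) (h1 : ν < 1) (hD : 0 < D) {G : ℝ → ℝ → ℝ}
  (hG : IsSignallingGreen (2 * ν) D G)
include h0 h1 hG

/-- The Laplace transform `γ` of a Green function of the signalling problem satisfies the integral
form of `D γ'' = s ^ (2 ν) γ` on every compact interval of `x > 0`. -/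
lemma IsSignallingGreen.integral_eq {C a b x : ℝ} (ha : 0 < a) (hab : a < b) (hx : x ∈ Icc a b)
    {s : ℂ} (hs : 0 < s.re)
    (h : ∀ x, 0 < x → IntegrableOn (fun t => Real.exp (-s.re * t) * G x t) (Ioi 0) ∧
      ∫ t in Ioi (0 : ℝ), Real.exp (-s.re * t) * |G x t| ≤ C) {γ : ℝ → ℂ}
    (hγ : γ = fun y => ∫ t in Ioi (0 : ℝ), Complex.exp (-s * t) * G y t) :
    IntegrableOn γ (Icc a b) ∧ D * (γ x - γ a - ((x - a) / (b - a) : ℝ) * (γ b - γ a)) =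
      s ^ ((2 * ν : ℝ) : ℂ) * ∫ y in Icc a b, tentKernel a b x y • γ y := by
  have hβ : 0 < 2 * ν := by linarith
  have hsne := ne_zero_of_re_pos hs
  have hpos : ∀ y ∈ Icc a b, 0 < y := fun y hy => ha.trans_le hy.1
  have hj := hG.integrable_joint (b := b) ha h
  set k := tentKernel a b x with hk
  have hkc : Continuous k := continuous_tentKernel a b x
  obtain ⟨M, hM⟩ := isCompact_Icc.exists_bound_of_continuousOn (hkc.continuousOn (s := Icc a b))
  have hkb : ∀ {μ : Measure ℝ} [SFinite μ],
      ∀ᵐ p ∂(volume.restrict (Icc a b)).prod μ, ‖k p.1‖ ≤ M := by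
    intro μ _
    have : (volume.restrict (Icc a b)).prod μ = ((volume : Measure ℝ).prod μ).restrict
        (Icc a b ×ˢ univ) := by rw [← Measure.prod_restrict, Measure.restrict_univ]
    rw [this]
    exact (ae_restrict_iff' (measurableSet_Icc.prod MeasurableSet.univ)).2
      (ae_of_all _ fun p hp => hM _ hp.1)
  have hjk : Integrable (fun p : ℝ × ℝ => Real.exp (-s.re * p.2) * (k p.1 * G p.1 p.2))
      ((volume.restrict (Icc a b)).prod (volume.restrict (Ioi 0))) := by
    refine (hj.bdd_mul (hkc.comp continuous_fst).aestronglyMeasurable hkb).congr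
      (ae_of_all _ fun p => ?_)
    simp only [Function.comp_apply]
    ring
  have hLk := hasLaplace_integral (F := fun y t => k y * G y t) hjk
  have hγi : IntegrableOn γ (Icc a b) := by
    rw [hγ]
    exact (integrable_cexp_mul hj).integral_prod_left
  refine ⟨hγi, ?_⟩
  -- the solution with data `1` is the primitive in time of the Green function
  have hS := hG.solves (fun _ => 1) continuousOn_const
  simp only [mul_one] at hS
  have hu : ∀ y, 0 < y → HasLaplace (fun t => ∫ τ in (0 : ℝ)..t, G y τ) s (s⁻¹ * γ y) := by
    intro y hy
    have := hasLaplace_rl one_pos hs (hasLaplace_of_integrableOn (h y hy).1)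
    rw [Complex.ofReal_one, Complex.cpow_neg_one] at this
    rw [hγ]
    exact this.congr fun t _ => rl_one _ t
  have hE : HasLaplace (fun t => ∫ y in Icc a b, k y *
      iteratedDeriv 2 (fun z => ∫ τ in (0 : ℝ)..t, G z τ) y) s
      (s⁻¹ * γ x - s⁻¹ * γ a - ((x - a) / (b - a) : ℝ) * (s⁻¹ * γ b - s⁻¹ * γ a)) := by
    have hxp := hpos x hx
    refine (((hu x hxp).sub (hu a ha)).sub (((hu b (ha.trans hab)).sub (hu a ha)).const_mul
      ((x - a) / (b - a)))).congr fun t ht => ?_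
    exact (integral_tentKernel_mul_deriv (hS.solution.space_smooth t ht) ha hab hx).symm
  have hL := hasLaplace_rl hβ hs (hE.const_mul D)
  have hR : HasLaplace (rl (2 * ν) fun τ => D * ∫ y in Icc a b, k y *
      iteratedDeriv 2 (fun z => ∫ r in (0 : ℝ)..τ, G z r) y) s
      (s⁻¹ * ∫ y in Icc a b, k y • γ y) := by
    have h2 := hasLaplace_rl one_pos hs hLk
    rw [Complex.ofReal_one, Complex.cpow_neg_one] at h2
    have e : ∫ y in Icc a b, (∫ t in Ioi (0 : ℝ), Complex.exp (-s * t) * ((k y * G y t : ℝ) : ℂ)) =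
        ∫ y in Icc a b, k y • γ y := by
      congr 1 with y
      rw [hγ, Complex.real_smul, ← integral_const_mul]
      congr 1 with t
      push_cast
      ring
    rw [e] at h2
    refine h2.congr fun t ht => ?_
    have ht0 : 0 < t := ht
    rw [hS.solution.rl_integral_eq hβ (by linarith) ha hS.initial hS.initial_deriv hkc ht0]
    -- on bounded time intervals the weight `e ^ (-s t)` may be dropped
    have hjt : Integrable (fun p : ℝ × ℝ => k p.1 * G p.1 p.2)
        ((volume.restrict (Icc a b)).prod (volume.restrict (Ioc 0 t))) := by
      have h3 : Integrable (fun p : ℝ × ℝ => Real.exp (-s.re * p.2) * (k p.1 * G p.1 p.2))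
          ((volume.restrict (Icc a b)).prod (volume.restrict (Ioc 0 t))) :=
        hjk.mono_measure (Measure.prod_mono le_rfl
          (Measure.restrict_mono Ioc_subset_Ioi_self le_rfl))
      have h4 := h3.bdd_mul (c := Real.exp (s.re * t)) (f := fun p : ℝ × ℝ => Real.exp (s.re * p.2))
        (Continuous.aestronglyMeasurable (by fun_prop)) (by
          rw [Measure.prod_restrict]
          refine (ae_restrict_iff' (measurableSet_Icc.prod measurableSet_Ioc)).2
            (ae_of_all _ fun p hp => ?_)
          rw [Real.norm_eq_abs, Real.abs_exp, Real.exp_le_exp]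
          exact mul_le_mul_of_nonneg_left hp.2.2 hs.le)
      refine h4.congr (ae_of_all _ fun p => ?_)
      simp only
      rw [← mul_assoc, ← Real.exp_add]
      simp
    rw [← integral_rl_of_one_le (h := fun y t => k y * G y t) le_rfl ht0 hjt]
    simp only [rl_const_mul, rl_one]
  have key := hL.unique hR
  have e1 : s ^ ((2 * ν : ℝ) : ℂ) * s ^ (-(2 * ν : ℝ) : ℂ) = 1 := by
    rw [← Complex.cpow_add _ _ hsne, add_neg_cancel, Complex.cpow_zero]
  have e2 : s * s⁻¹ = 1 := mul_inv_cancel₀ hsne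
  linear_combination (s * s ^ ((2 * ν : ℝ) : ℂ)) * key +
    (s ^ ((2 * ν : ℝ) : ℂ) * ∫ y in Icc a b, k y • γ y) * e2 -
    (D * (γ x - γ a - ((x - a) / (b - a) : ℝ) * (γ b - γ a))) *
      (e1 + s ^ ((2 * ν : ℝ) : ℂ) * s ^ (-(2 * ν : ℝ) : ℂ) * e2)

include hD

/-- On some vertical line the Laplace transform of a Green function of the signalling problem is
`e ^ (-x s ^ ν / √D)`: it is the bounded solution of `γ'' = (s ^ (2 ν) / D) γ` on `x > 0` with
`γ(0⁺) = 1`. -/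
lemma IsSignallingGreen.exists_hasLaplace : ∃ σ : ℝ, 0 < σ ∧ ∀ s : ℂ, s.re = σ → ∀ x : ℝ, 0 < x →
    HasLaplace (G x) s (Complex.exp (-(x / √D : ℝ) * s ^ (ν : ℂ))) := by
  have hr : 0 < √D := Real.sqrt_pos.2 hD
  obtain ⟨s₀, C, hC⟩ := hG.laplace
  set σ₀ := max s₀ 0 with hσ₀
  have hσ₀0 : 0 ≤ σ₀ := le_max_right _ _
  refine ⟨σ₀ + 1, by linarith, fun s hs x hx => ?_⟩
  have hs0 : 0 < s.re := by linarith
  have hsne := ne_zero_of_re_pos hs0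
  have hC₀ := fun (x : ℝ) (hx : 0 < x) => hG.laplace_mono (le_max_left s₀ 0) (hC x hx) hx
  have hC₁ : ∀ x, 0 < x → IntegrableOn (fun t => Real.exp (-s.re * t) * G x t) (Ioi 0) ∧
      ∫ t in Ioi (0 : ℝ), Real.exp (-s.re * t) * |G x t| ≤ C := fun x hx =>
    hG.laplace_mono (by rw [hs]; linarith [le_max_left s₀ 0]) (hC x hx) hx
  set γ : ℝ → ℂ := fun y => ∫ t in Ioi (0 : ℝ), Complex.exp (-s * t) * G y t with hγ
  have hL : ∀ y, 0 < y → HasLaplace (G y) s (γ y) := fun y hy =>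
    hasLaplace_of_integrableOn (hC₁ y hy).1
  have hγb : ∀ y, 0 < y → ‖γ y‖ ≤ C := by
    intro y hy
    refine (norm_integral_le_integral_norm _).trans (le_trans (le_of_eq ?_) (hC₁ y hy).2)
    congr 1 with t
    rw [norm_mul, norm_exp_neg_mul_ofReal, Complex.norm_real, Real.norm_eq_abs]
  set l : ℂ := s ^ (ν : ℂ) / (√D : ℝ) with hl
  have hlre : 0 < l.re := by
    rw [hl, Complex.div_ofReal_re]
    exact div_pos (re_cpow_pos h0 h1 hs0) hr
  have hDc : (D : ℂ) ≠ 0 := by exact_mod_cast hD.ne'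
  have hl2 : D * l ^ 2 = s ^ ((2 * ν : ℝ) : ℂ) := mul_sq_cpow_div_sqrt ν hD hsne
  -- `γ'' = l² γ` near every point
  have hode : ∀ y ∈ Ioi (0 : ℝ), HasDerivAt γ (deriv γ y) y ∧
      HasDerivAt (deriv γ) (l ^ 2 * γ y) y := by
    intro y hy
    have hy0 : 0 < y := hy
    have ha : 0 < y / 2 := by linarith
    have hab : y / 2 < 2 * y := by linarith
    have hyI : y ∈ Ioo (y / 2) (2 * y) := ⟨by linarith, by linarith⟩
    have hI := fun z (hz : z ∈ Icc (y / 2) (2 * y)) =>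
      hG.integral_eq h0 h1 ha hab hz hs0 hC₁ hγ
    have hi := (hI y ⟨hyI.1.le, hyI.2.le⟩).1
    set a := y / 2
    set b := 2 * y
    set m : ℂ := (γ b - γ a - l ^ 2 * ∫ z in a..b, (b - z) • γ z) / ((b - a : ℝ) : ℂ) with hm
    have hba : ((b - a : ℝ) : ℂ) ≠ 0 := by exact_mod_cast (sub_pos.2 hab).ne'
    have hform : ∀ z ∈ Ioo a b, γ z = (γ a - m * a) + m * z +
        l ^ 2 * ∫ w in a..z, (z - w) • γ w := by
      intro z hz
      have h2 := (hI z ⟨hz.1.le, hz.2.le⟩).2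
      rw [← hl2, mul_assoc] at h2
      have h3 := mul_left_cancel₀ hDc h2
      rw [integral_tentKernel_mul ⟨hz.1.le, hz.2.le⟩ hi, Complex.real_smul] at h3
      have hm' : m * ((b - a : ℝ) : ℂ) = γ b - γ a - l ^ 2 * ∫ z in a..b, (b - z) • γ z := by
        rw [hm, div_mul_cancel₀ _ hba]
      have hq : (((z - a) / (b - a) : ℝ) : ℂ) * ((b - a : ℝ) : ℂ) = (z : ℂ) - a := by
        rw [← Complex.ofReal_mul, div_mul_cancel₀ _ (sub_pos.2 hab).ne']
        push_cast
        rfl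
      linear_combination h3 - (((z - a) / (b - a) : ℝ) : ℂ) * hm' + m * hq
    have hder := hasDerivAt_of_integral_eq hi hform
    refine ⟨(hder y hyI).1.differentiableAt.hasDerivAt, ?_⟩
    refine (hder y hyI).2.congr_of_eventuallyEq ?_
    filter_upwards [Ioo_mem_nhds hyI.1 hyI.2] with z hz
    exact (hder z hz).1.deriv
  obtain ⟨A, B, hAB⟩ := exists_eq_exp_add_exp (convex_Ioi 0) isOpen_Ioi (ne_zero_of_re_pos hlre)
    (fun y hy => (hode y hy).1) fun y hy => (hode y hy).2
  have hA : A = 0 := eq_zero_of_bounded_exp hlre hγb hAB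
  -- the boundary value `u(0⁺, t) = 1` gives `γ(0⁺) = 1`
  have hS := hG.solves (fun _ => 1) continuousOn_const
  simp only [mul_one] at hS
  have hu : ∀ y, 0 < y → HasLaplace (fun t => ∫ τ in (0 : ℝ)..t, G y τ) s (s⁻¹ * γ y) := by
    intro y hy
    have := hasLaplace_rl one_pos hs0 (hL y hy)
    rw [Complex.ofReal_one, Complex.cpow_neg_one] at this
    exact this.congr fun t _ => rl_one _ t
  have hlim : Tendsto (fun y => s⁻¹ * γ y) (𝓝[>] 0) (𝓝 s⁻¹) := by
    have h2 : Tendsto (fun y => ∫ t in Ioi (0 : ℝ), Complex.exp (-s * t) *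
        ((∫ τ in (0 : ℝ)..t, G y τ : ℝ) : ℂ)) (𝓝[>] 0)
        (𝓝 (∫ t in Ioi (0 : ℝ), Complex.exp (-s * t) * ((1 : ℝ) : ℂ))) := by
      refine tendsto_integral_filter_of_dominated_convergence (fun t => C * Real.exp (-1 * t))
        (eventually_nhdsWithin_of_forall fun y hy => (hu y hy).1.1)
        (eventually_nhdsWithin_of_forall fun y hy => ?_)
        ((integrableOn_exp_mul_Ioi (by norm_num : (-1 : ℝ) < 0) 0).const_mul C)
        ((ae_restrict_iff' measurableSet_Ioi).2 (ae_of_all _ fun t ht => ?_))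
      · refine (ae_restrict_iff' measurableSet_Ioi).2 (ae_of_all _ fun t ht => ?_)
        rw [norm_mul, norm_exp_neg_mul_ofReal, Complex.norm_real, Real.norm_eq_abs]
        calc _ ≤ Real.exp (-s.re * t) * (C * Real.exp (σ₀ * t)) :=
              mul_le_mul_of_nonneg_left (abs_integral_le_of_laplace hσ₀0 (hC₀ y hy) ht)
                (Real.exp_pos _).le
          _ = C * (Real.exp (-s.re * t) * Real.exp (σ₀ * t)) := by ring
          _ = C * Real.exp (-1 * t) := by
            rw [← Real.exp_add, hs]
            ring_nf
      · exact ((Complex.continuous_ofReal.tendsto 1).comp (hS.boundary t ht)).const_mul _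
    rw [(hasLaplace_one hs0).2] at h2
    exact h2.congr' (eventually_nhdsWithin_of_forall fun y hy => (hu y hy).2)
  have hB : B = 1 := by
    have h3 : Tendsto (fun y : ℝ => s⁻¹ * (B * Complex.exp (-l * y))) (𝓝[>] 0) (𝓝 (s⁻¹ * B)) := by
      have : ContinuousAt (fun y : ℝ => s⁻¹ * (B * Complex.exp (-l * y))) 0 := by fun_prop
      simpa [ContinuousAt] using this.mono_left (nhdsWithin_le_nhds (s := Ioi 0))
    have h4 := tendsto_nhds_unique (hlim.congr' (eventually_nhdsWithin_of_forall fun y hy => by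
      rw [hAB y hy, hA, zero_mul, zero_add])) h3
    exact (mul_left_cancel₀ (inv_ne_zero hsne) (by rw [mul_one]; exact h4)).symm
  have hx2 := hL x hx
  rw [hAB x hx, hA, hB, zero_mul, zero_add, one_mul] at hx2
  convert hx2 using 2
  rw [hl]
  push_cast
  ring

/-- A Green function of the signalling problem is the signalling kernel. -/
lemma IsSignallingGreen.eq {x t : ℝ} (hx : 0 ≤ x) (ht : 0 < t) :
    G x t = waveKernel ν 0 (x / √D) t := by
  have hr : 0 < √D := Real.sqrt_pos.2 hD
  obtain ⟨σ, hσ, hL⟩ := hG.exists_hasLaplace h0 h1 hD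
  have hc := continuousOn_waveKernel h0 h1 zero_lt_one
  have hpos : ∀ y, 0 < y → G y t = waveKernel ν 0 (y / √D) t := by
    intro y hy
    have hy' : 0 < y / √D := div_pos hy hr
    refine eqOn_of_hasLaplace (σ := σ) (hG.continuousOn_time hy.le)
      (continuous_waveKernel_time h0 h1 zero_lt_one hy').continuousOn (fun s hs => ?_) ht
    refine ⟨_, hL s hs y hy, ?_⟩
    simpa using hasLaplace_waveKernel h0 h1 zero_lt_one hy' (s := s) (by rw [hs]; exact hσ)
  rcases hx.eq_or_lt with rfl | hx
  · have l1 : Tendsto (fun y => G y t) (𝓝[>] 0) (𝓝 (G 0 t)) :=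
      ((hG.cont.comp (f := fun y : ℝ => (y, t)) (by fun_prop) fun y hy => ⟨hy, ht⟩)
        0 self_mem_Ici).mono_left (nhdsWithin_mono _ Ioi_subset_Ici_self)
    have l2 : Tendsto (fun y => waveKernel ν 0 (y / √D) t) (𝓝[>] 0)
        (𝓝 (waveKernel ν 0 (0 / √D) t)) :=
      ((hc.comp (f := fun y : ℝ => (y / √D, t)) (s := Ici 0) (by fun_prop) fun y hy =>
        ⟨div_nonneg hy hr.le, ht⟩) 0 self_mem_Ici).mono_left
          (nhdsWithin_mono _ Ioi_subset_Ici_self)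
    exact tendsto_nhds_unique l1 (l2.congr' (eventually_nhdsWithin_of_forall fun y hy =>
      (hpos y hy).symm))
  · exact hpos x hx

end uniqueness

end DiffusionWave

end

theorem mainTheorem3 (ν D : ℝ) (hν0 : 0 < ν) (hν1 : ν < 1) (hD : 0 < D) :
    -- the Green function of the Cauchy problem
    (∀ Gc : ℝ → ℝ → ℝ, DiffusionWave.IsCauchyGreen (2 * ν) D Gc ↔
      ∀ x t : ℝ, 0 < t →
        (Gc x t : ℂ) = ((t ^ (-ν) / (2 * √D) : ℝ) : ℂ) *
          DiffusionWave.wrightM ν ((|x| / (√D * t ^ ν) : ℝ) : ℂ)) ∧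
    -- the Green function of the signalling problem
    (∀ Gs : ℝ → ℝ → ℝ, DiffusionWave.IsSignallingGreen (2 * ν) D Gs ↔
      ∀ x t : ℝ, 0 ≤ x → 0 < t →
        (Gs x t : ℂ) = ((ν * x * t ^ (-ν - 1) / √D : ℝ) : ℂ) *
          DiffusionWave.wrightM ν ((x / (√D * t ^ ν) : ℝ) : ℂ)) ∧
    -- their Laplace transforms in time
    (∀ Gc : ℝ → ℝ → ℝ, DiffusionWave.IsCauchyGreen (2 * ν) D Gc →
      ∀ (x : ℝ) (s : ℂ), 0 < s.re →
        DiffusionWave.HasLaplace (Gc x) s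
          (Complex.exp (-((|x| / √D : ℝ) : ℂ) * s ^ (ν : ℂ)) /
            (2 * ((√D : ℝ) : ℂ) * s ^ (1 - (ν : ℂ))))) ∧
    (∀ Gs : ℝ → ℝ → ℝ, DiffusionWave.IsSignallingGreen (2 * ν) D Gs →
      ∀ (x : ℝ) (s : ℂ), 0 < x → 0 < s.re →
        DiffusionWave.HasLaplace (Gs x) s
          (Complex.exp (-((x / √D : ℝ) : ℂ) * s ^ (ν : ℂ)))) ∧
    -- the reciprocity relation
    (∀ Gc Gs : ℝ → ℝ → ℝ, DiffusionWave.IsCauchyGreen (2 * ν) D Gc →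
      DiffusionWave.IsSignallingGreen (2 * ν) D Gs →
      ∀ x t z : ℝ, 0 < x → 0 < t → z = x / (√D * t ^ ν) →
        2 * ν * x * Gc x t = t * Gs x t ∧
        ((t * Gs x t : ℝ) : ℂ) = DiffusionWave.wrightF ν (z : ℂ) ∧
        DiffusionWave.wrightF ν (z : ℂ) = (ν : ℂ) * (z : ℂ) * DiffusionWave.wrightM ν (z : ℂ)) ∧
    (∀ z : ℂ, DiffusionWave.wrightF ν z = (ν : ℂ) * z * DiffusionWave.wrightM ν z) := by
  have hr : 0 < √D := Real.sqrt_pos.2 hD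
  have hC : ∀ Gc : ℝ → ℝ → ℝ, DiffusionWave.IsCauchyGreen (2 * ν) D Gc ↔
      ∀ x t : ℝ, 0 < t → Gc x t = DiffusionWave.cauchyKernel ν D x t := fun Gc =>
    ⟨fun h x t ht => h.eq hν0 hν1 hD
      (DiffusionWave.isCauchyGreen_of_eq hν0 hν1 hD fun _ _ _ => rfl) ht x,
      DiffusionWave.isCauchyGreen_of_eq hν0 hν1 hD⟩
  have hS : ∀ Gs : ℝ → ℝ → ℝ, DiffusionWave.IsSignallingGreen (2 * ν) D Gs ↔
      ∀ x t : ℝ, 0 ≤ x → 0 < t → Gs x t = DiffusionWave.waveKernel ν 0 (x / √D) t := fun Gs =>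
    ⟨fun h x t hx ht => h.eq hν0 hν1 hD hx ht, DiffusionWave.isSignallingGreen_of_eq hν0 hν1 hD⟩
  have hz : ∀ x t : ℝ, 0 < t → x / √D * t ^ (-ν) = x / (√D * t ^ ν) := fun x t ht => by
    rw [Real.rpow_neg ht.le, ← div_eq_mul_inv, div_div]
  have hM : ∀ x t : ℝ, 0 < t → (DiffusionWave.waveKernel ν (1 - ν) (x / √D) t : ℂ) =
      ((t ^ (-ν) : ℝ) : ℂ) * DiffusionWave.wrightM ν ((x / (√D * t ^ ν) : ℝ) : ℂ) := fun x t ht => by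
    rw [DiffusionWave.waveKernel_eq_wright hν0 hν1 (by linarith) _ ht, hz x t ht,
      DiffusionWave.wrightM, sub_sub_cancel_left]
    push_cast
    rfl
  have hF : ∀ x t : ℝ, 0 < t → ((t * DiffusionWave.waveKernel ν 0 (x / √D) t : ℝ) : ℂ) =
      DiffusionWave.wrightF ν ((x / (√D * t ^ ν) : ℝ) : ℂ) := fun x t ht => by
    rw [Complex.ofReal_mul, DiffusionWave.waveKernel_eq_wright hν0 hν1 zero_lt_one _ ht, hz x t ht,
      DiffusionWave.wrightF, ← mul_assoc, ← Complex.ofReal_mul, zero_sub, Real.rpow_neg_one,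
      mul_inv_cancel₀ ht.ne', Complex.ofReal_one, one_mul, Complex.ofReal_zero]
  have hFM := DiffusionWave.wrightF_eq_mul_wrightM hν0 hν1
  have hrec : ∀ x t : ℝ, 0 < t → t * DiffusionWave.waveKernel ν 0 (x / √D) t =
      ν * (x / √D) * DiffusionWave.waveKernel ν (1 - ν) (x / √D) t := fun x t ht =>
    DiffusionWave.waveKernel_reciprocity hν0 hν1 _ ht
  refine ⟨fun Gc => ?_, fun Gs => ?_, fun Gc hGc x s hs => ?_, fun Gs hGs x s hx hs => ?_,
    fun Gc Gs hGc hGs x t z hx ht hzx => ?_, hFM⟩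
  · rw [hC]
    refine forall_congr' fun x => forall_congr' fun t => imp_congr_right fun ht => ?_
    rw [← Complex.ofReal_inj, DiffusionWave.cauchyKernel, Complex.ofReal_mul, hM _ t ht]
    refine Eq.congr_right ?_
    push_cast
    ring
  · rw [hS]
    refine forall_congr' fun x => forall_congr' fun t => imp_congr_right fun _ =>
      imp_congr_right fun ht => ?_
    have e : DiffusionWave.waveKernel ν 0 (x / √D) t =
        ν * x * t⁻¹ / √D * DiffusionWave.waveKernel ν (1 - ν) (x / √D) t := by
      have := hrec x t ht
      field_simp at this ⊢
      linarith
    have e2 : t ^ (-ν - 1) = t⁻¹ * t ^ (-ν) := by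
      rw [← Real.rpow_neg_one t, ← Real.rpow_add ht]
      ring_nf
    rw [← Complex.ofReal_inj, e, Complex.ofReal_mul, hM _ t ht, e2]
    refine Eq.congr_right ?_
    push_cast
    ring
  · have h := (DiffusionWave.hasLaplace_cauchyKernel (D := D) hν0 hν1 x hs).congr fun t ht =>
      ((hC Gc).1 hGc x t ht).symm
    convert h using 1
    have e : -((1 - ν : ℝ) : ℂ) = -(1 - (ν : ℂ)) := by push_cast; rfl
    rw [e, Complex.cpow_neg]
    push_cast
    field_simp
  · have h := (DiffusionWave.hasLaplace_waveKernel hν0 hν1 zero_lt_one (div_pos hx hr) hs).congr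
      fun t ht => ((hS Gs).1 hGs x t hx.le ht).symm
    simpa using h
  · refine ⟨?_, ?_, hFM z⟩
    · rw [(hC Gc).1 hGc x t ht, (hS Gs).1 hGs x t hx.le ht, hrec x t ht,
        DiffusionWave.cauchyKernel, abs_of_pos hx]
      field_simp
    · rw [(hS Gs).1 hGs x t hx.le ht, hF x t ht, hzx]
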